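/- Let $R>0$, $\tau_{\rm buoy}>0$, $\kappa,\nu\ge 0$, $\delta_0\in\mathbb R$, and set $\tau_\kappa^2(0)=\tau_{\rm buoy}^2+\kappa^2+\frac{R^2}{8}$, $\mathrm d_r f=\partial_r f+\frac fr$, $L^2_r=L^2((R,\infty),r\,dr)$. Let $(\zeta,q,\delta)$ be the global solution of the linear ($\varepsilon=0$) waves–structure system for a freely floating cylinder of radius $R$ released without velocity in water at rest: $$\begin{cases}\partial_t\zeta+\mathrm d_r q=0, & r>R,\\ (1-\kappa^2\partial_r\mathrm d_r)\partial_t q+\partial_r\zeta=\nu\,\partial_r\mathrm d_r q, & r>R,\\ q=-\tfrac R2\dot\delta, & r=R,\\ \tau_\kappa^2(0)\ddot\delta+\nu\dot\delta+\delta=\kappa^2\ddot\zeta+\nu\dot\zeta+\zeta, & r=R,\end{cases}\qquad (\zeta,q,\delta,\dot\delta)_{|t=0}=(0,0,\delta_0,0),$$ with $\zeta,q\in C^1([0,\infty);L^2_r)$, $\mathrm d_rq\in C([0,\infty);L^2_r)$, $\kappa\,\mathrm d_r q\in C^1([0,\infty);L^2_r)$, $\delta\in C^2([0,\infty))$, the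 second equation being understood as $\partial_r\Pi=-\partial_tq$ in $L^2_r$ with $\Pi=\zeta+\nu\dot\zeta+\kappa^2\ddot\zeta=\zeta-\nu\,\mathrm d_rq-\kappa^2\mathrm d_r\partial_tq\in H^1((R,\infty),r\,dr)$, and the last equation as the value of the trace of $\Pi$ at $r=R$. For $\operatorname{Re}s>0$ let $K_\alpha(s)=\int_0^\infty e^{-s\cosh t}\cosh(\alpha t)\,dt$ and, with the principal square root, $$\mathcal P(s)=2\tau_\kappa^2(0)s^2+2\nu s+Rs\sqrt{1+\nu s+\kappa^2s^2}\,B(s)+2,\qquad B(s)=\frac{K_0\big(Rs/\sqrt{1+\nu s+\kappa^2s^2}\big)}{K_1\big(Rs/\sqrt{1+\nu s+\kappa^2s^2}\big)} .$$ Assume that there is $\mathcal P_{\min}>0$ with $|\mathcal P(s)|\ge\mathcal P_{\min}$ for all $s$ with $\operatorname{Re}s>0$ (equivalently, on the closed right half-plane, for the continuous extension of $\mathcal P$). Then $\delta\in H^2(\mathbb R^+)$. Moreover, with $\kappa_*=\kappa$ if $\kappa>0$ and $\kappa_*=1$ if $\kappa=0$, for every $\Lambda$ there is a constant $C>0$ depending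 only on $\tau_{\rm buoy}$ and $\Lambda$ (in particular, not on $R$, $\delta_0$, $\mathcal P_{\min}$, nor on $\kappa,\nu\in[0,\Lambda]$) such that, whenever $\kappa,\nu\le\Lambda$, $$\|\delta\|_{L^2(\mathbb R^+)}\le C|\delta_0|\Big(\kappa_*^{-\frac12}\big(\kappa_*^{-1}+1+R(1+\nu\kappa_*^{-1})\big)\mathcal P_{\min}^{-1}+\kappa_*^{-\frac12}\Big),$$ $$\|\dot\delta\|_{L^2(\mathbb R^+)}\le C|\delta_0|\Big(\kappa_*^{-\frac12}\mathcal P_{\min}^{-1}+\frac{\kappa_*^{-\frac32}}{\tau_{\rm buoy}^2}\Big),\qquad \|\ddot\delta\|_{L^2(\mathbb R^+)}\le C|\delta_0|\Big(\kappa_*^{-\frac12}\mathcal P_{\min}^{-1}+\frac{\kappa_*^{-\frac12}}{\tau_{\rm buoy}^2}\Big).$$ -/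

import Mathlib

open MeasureTheory Set
open scoped ENNReal ContDiff

namespace FloatingCylinder

noncomputable section

/-! ### Function spaces on the exterior domain `r > R` -/

/-- The measure `r dr` on the exterior domain `(R, ∞)`. -/
def radialMeasure (R : ℝ) : Measure ℝ :=
  (volume.restrict (Ioi R)).withDensity (fun r => ENNReal.ofReal r)

/-- `L²_r`, the real Hilbert space `L²((R, ∞), r dr)`. -/
abbrev L2r (R : ℝ) : Type := Lp ℝ 2 (radialMeasure R)

/-- `f ∈ H¹_r` with radial derivative `∂_r f = g ∈ L²_r` and trace `c` at `r = R`: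
`f` agrees almost everywhere with the absolutely continuous function
`r ↦ c + ∫_R^r g`. -/
def HasRadialDeriv {R : ℝ} (f g : L2r R) (c : ℝ) : Prop :=
  ∀ᵐ r ∂(radialMeasure R), f r = c + ∫ x in R..r, g x

/-- `q ∈ H¹_r` has trace `c` at `r = R` and radial divergence `d_r q = ∂_r q + q / r` equal
to `D`. -/
def HasRadialDiv {R : ℝ} (q D : L2r R) (c : ℝ) : Prop :=
  ∃ g : L2r R, HasRadialDeriv q g c ∧ ∀ᵐ r ∂(radialMeasure R), D r = g r + q r / r

/-! ### The linear waves-structure system -/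

/-- Time derivative on `[0, ∞)` (one-sided at `t = 0`). -/
def timeDeriv {E : Type*} [NormedAddCommGroup E] [NormedSpace ℝ E] (f : ℝ → E) : ℝ → E :=
  derivWithin f (Ici 0)

/-- The added-mass coefficient `τ_κ²(0) = τ_buoy² + κ² + R² / 8`. -/
def addedMass (τb κ R : ℝ) : ℝ := τb ^ 2 + κ ^ 2 + R ^ 2 / 8

/-- The quantity `ζ + ν ∂_t ζ + κ² ∂_t² ζ`. The last term is written `κ ∂_t (κ ∂_t ζ)`, so that
no second time derivative is involved when `κ = 0`. Because `∂_t ζ = - d_r q`, this is also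
`ζ - ν d_r q - κ² d_r ∂_t q`. -/
def waveHead {R : ℝ} (κ ν : ℝ) (ζ : ℝ → L2r R) (t : ℝ) : L2r R :=
  ζ t + ν • timeDeriv ζ t + κ • timeDeriv (fun t' => κ • timeDeriv ζ t') t

/-- `(ζ, q, δ)` is the global solution of the linear (`ε = 0`) waves-structure system without
external force and with initial data `(ζ, q, δ, ∂_t δ) = (0, 0, δ₀, 0)`:
* `∂_t ζ + d_r q = 0` for `r > R`;
* `(1 - κ² ∂_r d_r) ∂_t q + ∂_r ζ = ν ∂_r d_r q` for `r > R`;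
* `q = - (R / 2) ∂_t δ` at `r = R`;
* `τ_κ²(0) ∂_t² δ + ν ∂_t δ + δ = κ² ∂_t² ζ + ν ∂_t ζ + ζ` at `r = R`.
-/
structure IsSolution (τb κ ν R δ₀ : ℝ) (ζ q : ℝ → L2r R) (δ : ℝ → ℝ) : Prop where
  /-- `ζ ∈ C¹([0, ∞); L²_r)`; hence `d_r q = - ∂_t ζ ∈ C([0, ∞); L²_r)`. -/
  contDiffOn_zeta : ContDiffOn ℝ 1 ζ (Ici 0)
  /-- `q ∈ C¹([0, ∞); L²_r)`. -/
  contDiffOn_q : ContDiffOn ℝ 1 q (Ici 0)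
  /-- `κ d_r q = - κ ∂_t ζ ∈ C¹([0, ∞); L²_r)`; no condition when `κ = 0`. -/
  contDiffOn_disp : ContDiffOn ℝ 1 (fun t => κ • timeDeriv ζ t) (Ici 0)
  /-- `δ ∈ C²([0, ∞))`. -/
  contDiffOn_delta : ContDiffOn ℝ 2 δ (Ici 0)
  /-- Conservation of mass `d_r q = - ∂_t ζ` and transmission condition
  `q = - (R / 2) ∂_t δ` at `r = R`. -/
  mass : ∀ t, 0 ≤ t → HasRadialDiv (q t) (-timeDeriv ζ t) (-(R / 2) * timeDeriv δ t)
  /-- Momentum equation `∂_r (ζ - ν d_r q - κ² d_r ∂_t q) = - ∂_t q`, together with the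
  equation of motion of the solid, which prescribes the trace at `r = R` of
  `ζ + ν ∂_t ζ + κ² ∂_t² ζ = ζ - ν d_r q - κ² d_r ∂_t q`. -/
  momentum_newton : ∀ t, 0 ≤ t →
    HasRadialDeriv (waveHead κ ν ζ t) (-timeDeriv q t)
      (addedMass τb κ R * timeDeriv (timeDeriv δ) t + ν * timeDeriv δ t + δ t)
  zeta_init : ζ 0 = 0
  q_init : q 0 = 0
  delta_init : δ 0 = δ₀
  delta_dot_init : timeDeriv δ 0 = 0

/-! ### The denominator of the transfer function -/

/-- The modified Bessel function of the second kind, for `Re s > 0`: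
`K_α(s) = ∫_0^∞ exp (- s cosh t) cosh (α t) dt`. -/
def besselK (α : ℝ) (s : ℂ) : ℂ :=
  ∫ t in Ioi (0 : ℝ), Complex.exp (-s * (Real.cosh t : ℂ)) * (Real.cosh (α * t) : ℂ)

/-- `√(1 + ν s + κ² s²)`, principal branch. -/
def dispRoot (κ ν : ℝ) (s : ℂ) : ℂ :=
  (1 + (ν : ℂ) * s + (κ : ℂ) ^ 2 * s ^ 2) ^ (1 / 2 : ℂ)

/-- `B(s) = K₀(R s / √(1 + ν s + κ² s²)) / K₁(R s / √(1 + ν s + κ² s²))`. -/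
def besselRatio (κ ν R : ℝ) (s : ℂ) : ℂ :=
  besselK 0 ((R : ℂ) * s / dispRoot κ ν s) / besselK 1 ((R : ℂ) * s / dispRoot κ ν s)

/-- `𝒫(s) = 2 τ_κ²(0) s² + 2 ν s + R s √(1 + ν s + κ² s²) B(s) + 2`, for `Re s > 0`. -/
def transferDenom (τb κ ν R : ℝ) (s : ℂ) : ℂ :=
  2 * (addedMass τb κ R : ℂ) * s ^ 2 + 2 * (ν : ℂ) * s
    + (R : ℂ) * s * dispRoot κ ν s * besselRatio κ ν R s + 2

/-- `κ_* = κ` if `κ > 0`, and `κ_* = 1` if `κ = 0`. -/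
def kappaStar (κ : ℝ) : ℝ := if 0 < κ then κ else 1

/-! ### Sobolev space on the half-line -/

/-- Lebesgue measure on `ℝ⁺ = (0, ∞)`. -/
abbrev halfLine : Measure ℝ := volume.restrict (Ioi 0)

/-- `g` is the weak derivative of `f` on `(0, ∞)`. -/
def IsWeakDeriv (f g : ℝ → ℝ) : Prop :=
  ∀ φ : ℝ → ℝ, ContDiff ℝ ∞ φ → HasCompactSupport φ → tsupport φ ⊆ Ioi 0 →
    ∫ t, f t * deriv φ t ∂halfLine = -∫ t, g t * φ t ∂halfLine

/-- `f ∈ H²(ℝ⁺)`: `f` and its first two weak derivatives are in `L²(ℝ⁺)`. -/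
def MemH2 (f : ℝ → ℝ) : Prop :=
  ∃ g h : ℝ → ℝ, MemLp f 2 halfLine ∧ MemLp g 2 halfLine ∧ MemLp h 2 halfLine ∧
    IsWeakDeriv f g ∧ IsWeakDeriv g h

end

end FloatingCylinder

/-!
# Decay of the free motion of a floating cylinder

The displacement is controlled through its Laplace transform. If `σ = s / √(1 + ν s + κ² s²)`, then
`K₀(σ r)` and `K₁(σ r)` decay exponentially and solve the system adjoint to the transformed fluid
equations. Pairing the fluid unknowns with them (`exists_besselK_pairings`, a consequence of the
Green formula `HasRadialDeriv.inner_add_inner`) eliminates the fluid and leaves the scalar identity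
`𝒫(s) L[δ'](s) = -2 δ₀` for `Re s > 0` (`IsSolution.transferDenom_mul_laplace_timeDeriv`). The
transforms converge because the energy of the system does not increase (`IsSolution.exists_bound`).

The hypothesis bounds `𝒫` from below by `Pmin`, which is only useful at bounded frequency. At high
frequency `|𝒫(s)| ≥ τ_buoy² |s|²` as soon as `|s|` exceeds a constant that depends on `τ_buoy` and
`Λ` alone (`exists_mul_sq_le_norm_transferDenom`): because `|K₀ / K₁| ≤ √2` on the right half-plane
(`norm_besselK_zero_le`), the radiation term is at most `√2 κ R |s|²` to leading order, and the
added mass term `2 (κ² + R² / 8) |s|²` dominates it by completing the square. The bound on `K₀ / K₁`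
is read off the representations of `K₀(z)` and `z K₁(z)` as Gaussian integrals of `(v² + 2
z)^(∓1/2)`. Both ranges of frequency together give `1 / |𝒫(s)| ≤ C / (Pmin (1 + (Im s)²))`.

On the line `Re s = η`, Plancherel's theorem turns this bound into `L²` bounds on `e^{-η t} δ'` and,
through difference quotients, on `e^{-η t} (δ'' - η δ')` (`eLpNorm_exp_mul_le`,
`eLpNorm_deriv_exp_mul_le`); Fatou's lemma lets `η → 0`. For `δ` itself one has
`𝒫(s) L[δ](s) = δ₀ (2 τ_κ²(0) s + 2 ν + R √(1 + ν s + κ² s²) B(s))`, which gives a bound of order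
`(1 + R) / Pmin` for `|Im s| ≤ 1 / (1 + R)` and of order `1 / (Pmin |Im s|)` above that frequency.
The resulting constants do not involve `κ_*`; since `κ_* ≤ max Λ 1`, the weights `κ_*^(-1/2)` can be
inserted at the cost of the factor `√(max Λ 1)`.
-/

namespace FloatingCylinder

open Filter Topology

/-! ### Modified Bessel functions on the right half-plane -/

/-- The moments `∫_0^∞ exp (-z cosh t) cosh(t)^n dt`. The cases `n = 0, 1` are `K₀` and `K₁`, and
differentiation in `z` only shifts `n`. -/
noncomputable def coshMoment (n : ℕ) (z : ℂ) : ℂ :=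
  ∫ t in Ioi (0 : ℝ), Complex.exp (-z * (Real.cosh t : ℂ)) * (Real.cosh t : ℂ) ^ n

lemma besselK_zero (z : ℂ) : besselK 0 z = coshMoment 0 z := by
  simp [besselK, coshMoment]

lemma besselK_one (z : ℂ) : besselK 1 z = coshMoment 1 z := by
  simp [besselK, coshMoment]

lemma exp_half_le_cosh (t : ℝ) : Real.exp t / 2 ≤ Real.cosh t := by
  rw [Real.cosh_eq]; linarith [Real.exp_pos (-t)]

lemma norm_exp_neg_mul_cosh (z : ℂ) (t : ℝ) (n : ℕ) :
    ‖Complex.exp (-z * (Real.cosh t : ℂ)) * (Real.cosh t : ℂ) ^ n‖ =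
      Real.exp (-z.re * Real.cosh t) * Real.cosh t ^ n := by
  rw [norm_mul, norm_pow, Complex.norm_exp, Complex.norm_real, Real.norm_eq_abs,
    abs_of_pos (Real.cosh_pos t), Complex.mul_re, Complex.ofReal_re, Complex.ofReal_im, mul_zero,
    sub_zero, Complex.neg_re]

lemma exp_neg_mul_cosh_le {x : ℝ} (hx : 0 < x) (n : ℕ) (t : ℝ) :
    Real.exp (-x * Real.cosh t) * Real.cosh t ^ n ≤
      2 * ((n + 1).factorial / x ^ (n + 1)) * Real.exp (-1 * t) := by
  have hc := Real.cosh_pos t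
  have h1 : (x * Real.cosh t) ^ (n + 1) / (n + 1).factorial ≤ Real.exp (x * Real.cosh t) :=
    Real.pow_div_factorial_le_exp _ (by positivity) _
  have h2 : Real.exp t / 2 ≤ Real.cosh t := exp_half_le_cosh t
  have e1 : Real.exp (-x * Real.cosh t) = (Real.exp (x * Real.cosh t))⁻¹ := by
    rw [← Real.exp_neg]; ring_nf
  have e2 : Real.exp (-1 * t) = (Real.exp t)⁻¹ := by rw [← Real.exp_neg]; ring_nf
  rw [e1, e2, inv_mul_le_iff₀ (Real.exp_pos _)]
  have hf : (0 : ℝ) < (n + 1).factorial := by exact_mod_cast Nat.factorial_pos _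
  have het := Real.exp_pos t
  calc Real.cosh t ^ n = Real.cosh t ^ (n + 1) / Real.cosh t := by rw [pow_succ]; field_simp
    _ ≤ Real.cosh t ^ (n + 1) / (Real.exp t / 2) := by gcongr
    _ = (x * Real.cosh t) ^ (n + 1) / (n + 1).factorial *
        (2 * ((n + 1).factorial / x ^ (n + 1)) * (Real.exp t)⁻¹) := by
      rw [mul_pow]; field_simp
    _ ≤ _ := by gcongr

lemma continuous_coshMoment_integrand (n : ℕ) (z : ℂ) :
    Continuous fun t : ℝ => Complex.exp (-z * (Real.cosh t : ℂ)) * (Real.cosh t : ℂ) ^ n := by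
  fun_prop

lemma integrableOn_exp_neg_mul_cosh {x : ℝ} (hx : 0 < x) (n : ℕ) :
    IntegrableOn (fun t : ℝ => Real.exp (-x * Real.cosh t) * Real.cosh t ^ n) (Ioi 0) := by
  refine Integrable.mono' (((exp_neg_integrableOn_Ioi 0 one_pos)).const_mul
    (2 * ((n + 1).factorial / x ^ (n + 1)))) (by fun_prop) (.of_forall fun t => ?_)
  rw [Real.norm_of_nonneg (by have := Real.cosh_pos t; positivity)]
  exact exp_neg_mul_cosh_le hx n t

lemma integrableOn_coshMoment_integrand {z : ℂ} (hz : 0 < z.re) (n : ℕ) :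
    IntegrableOn (fun t : ℝ => Complex.exp (-z * (Real.cosh t : ℂ)) * (Real.cosh t : ℂ) ^ n)
      (Ioi 0) := by
  refine Integrable.mono' (integrableOn_exp_neg_mul_cosh hz n)
    (continuous_coshMoment_integrand n z).aestronglyMeasurable (.of_forall fun t => ?_)
  rw [norm_exp_neg_mul_cosh]

lemma hasDerivAt_coshMoment {z : ℂ} (hz : 0 < z.re) (n : ℕ) :
    HasDerivAt (coshMoment n) (-coshMoment (n + 1) z) z := by
  have hs : {w : ℂ | z.re / 2 < w.re} ∈ 𝓝 z :=
    (isOpen_lt continuous_const Complex.continuous_re).mem_nhds (by simp; linarith)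
  have key := (hasDerivAt_integral_of_dominated_loc_of_deriv_le (𝕜 := ℂ)
    (μ := volume.restrict (Ioi (0 : ℝ)))
    (F := fun w t => Complex.exp (-w * (Real.cosh t : ℂ)) * (Real.cosh t : ℂ) ^ n)
    (F' := fun w t => -(Complex.exp (-w * (Real.cosh t : ℂ)) * (Real.cosh t : ℂ) ^ (n + 1)))
    (bound := fun t => Real.exp (-(z.re / 2) * Real.cosh t) * Real.cosh t ^ (n + 1)) hs
    (.of_forall fun w => (continuous_coshMoment_integrand n w).aestronglyMeasurable)
    (integrableOn_coshMoment_integrand hz n)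
    (continuous_coshMoment_integrand (n + 1) z).neg.aestronglyMeasurable
    (.of_forall fun t w hw => ?_)
    (integrableOn_exp_neg_mul_cosh (half_pos hz) (n + 1))
    (.of_forall fun t w _ => ?_)).2
  · rw [integral_neg] at key
    exact key
  · rw [norm_neg, norm_exp_neg_mul_cosh]
    have hc := Real.cosh_pos t
    have hw' : z.re / 2 < w.re := hw
    gcongr
  · have h1 : HasDerivAt (fun w : ℂ => -w * (Real.cosh t : ℂ)) (-1 * (Real.cosh t : ℂ)) w :=
      (hasDerivAt_id w).neg.mul_const _
    refine (h1.cexp.mul_const ((Real.cosh t : ℂ) ^ n)).congr_deriv ?_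
    ring

/-- An integration by parts in the `t` variable. -/
lemma coshMoment_one_eq {z : ℂ} (hz : 0 < z.re) :
    coshMoment 1 z = z * (coshMoment 2 z - coshMoment 0 z) := by
  set f : ℝ → ℂ := fun t => Complex.exp (-z * (Real.cosh t : ℂ)) * (Real.sinh t : ℂ)
  set f' : ℝ → ℂ := fun t => Complex.exp (-z * (Real.cosh t : ℂ)) * (Real.cosh t : ℂ) ^ 1 -
    z * (Complex.exp (-z * (Real.cosh t : ℂ)) * (Real.cosh t : ℂ) ^ 2 -
      Complex.exp (-z * (Real.cosh t : ℂ)) * (Real.cosh t : ℂ) ^ 0)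
  have i0 := integrableOn_coshMoment_integrand hz 0
  have i1 := integrableOn_coshMoment_integrand hz 1
  have i2 := integrableOn_coshMoment_integrand hz 2
  have hd : ∀ t ∈ Ici (0 : ℝ), HasDerivAt f (f' t) t := by
    intro t _
    have h1 : HasDerivAt (fun t : ℝ => -z * (Real.cosh t : ℂ)) (-z * (Real.sinh t : ℂ)) t :=
      ((Real.hasDerivAt_cosh t).ofReal_comp).const_mul _
    have h2 : HasDerivAt (fun t : ℝ => (Real.sinh t : ℂ)) (Real.cosh t : ℂ) t :=
      (Real.hasDerivAt_sinh t).ofReal_comp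
    refine (h1.cexp.mul h2).congr_deriv ?_
    have h3 : (Real.cosh t : ℂ) ^ 2 = (Real.sinh t : ℂ) ^ 2 + 1 := by
      exact_mod_cast Real.cosh_sq t
    simp only [f', pow_one, pow_zero, mul_one, h3]
    ring
  have hf' : IntegrableOn f' (Ioi 0) := i1.sub ((i2.sub i0).const_mul z)
  have hlim : Tendsto f atTop (𝓝 0) := by
    refine squeeze_zero_norm (a := fun t => 2 * ((1 + 1).factorial / z.re ^ (1 + 1)) *
      Real.exp (-1 * t)) (fun t => ?_) ?_
    · refine le_trans ?_ (exp_neg_mul_cosh_le hz 1 t)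
      simp only [f]
      rw [norm_mul, Complex.norm_exp, Complex.norm_real, Real.norm_eq_abs, pow_one,
        Complex.mul_re, Complex.ofReal_re, Complex.ofReal_im, mul_zero,
        sub_zero, Complex.neg_re]
      gcongr
      rw [abs_le]
      constructor
      · rw [Real.cosh_eq, Real.sinh_eq]; linarith [Real.exp_pos t]
      · exact (Real.sinh_lt_cosh t).le
    · simpa only [mul_zero, neg_mul, one_mul] using
        (Real.tendsto_exp_neg_atTop_nhds_zero).const_mul
          (2 * (((1 + 1).factorial : ℝ) / z.re ^ (1 + 1)))
  have := integral_Ioi_of_hasDerivAt_of_tendsto' hd hf' hlim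
  have e : ∫ t in Ioi (0 : ℝ), f' t =
      coshMoment 1 z - z * (coshMoment 2 z - coshMoment 0 z) := by
    simp only [f', coshMoment]
    rw [← integral_sub i2 i0, ← integral_const_mul]
    exact integral_sub i1 ((i2.sub i0).const_mul z)
  rw [e] at this
  have hf0 : f 0 = 0 := by simp [f]
  rw [hf0, sub_zero] at this
  exact sub_eq_zero.mp this

lemma hasDerivAt_besselK_zero {z : ℂ} (hz : 0 < z.re) :
    HasDerivAt (besselK 0) (-besselK 1 z) z := by
  have : besselK 0 = coshMoment 0 := funext besselK_zero
  rw [this, besselK_one]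
  exact hasDerivAt_coshMoment hz 0

lemma hasDerivAt_besselK_one {z : ℂ} (hz : 0 < z.re) :
    HasDerivAt (besselK 1) (-besselK 0 z - besselK 1 z / z) z := by
  have e : besselK 1 = coshMoment 1 := funext besselK_one
  have hz0 : z ≠ 0 := by rintro rfl; simp at hz
  rw [e, besselK_zero]
  convert hasDerivAt_coshMoment hz 1 using 1
  rw [coshMoment_one_eq hz]
  field_simp
  ring

lemma norm_coshMoment_le (z : ℂ) (n : ℕ) :
    ‖coshMoment n z‖ ≤
      ∫ t in Ioi (0 : ℝ), Real.exp (-z.re * Real.cosh t) * Real.cosh t ^ n := by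
  refine (norm_integral_le_integral_norm _).trans (le_of_eq ?_)
  simp only [norm_exp_neg_mul_cosh]

/-- Exponential decay of the Bessel functions along the ray `σ (R, ∞)`. -/
lemma norm_coshMoment_mul_le {σ : ℂ} (hσ : 0 < σ.re) {R r : ℝ} (hR : 0 < R) (hr : R ≤ r) (n : ℕ) :
    ‖coshMoment n (σ * r)‖ ≤
      (∫ t in Ioi (0 : ℝ), Real.exp (-(σ.re * R / 2) * Real.cosh t) * Real.cosh t ^ n) *
        Real.exp (-(σ.re / 2) * r) := by
  have hr0 : 0 < r := hR.trans_le hr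
  have hre : (σ * r).re = σ.re * r := by simp
  refine (norm_coshMoment_le _ n).trans ?_
  rw [hre, ← integral_mul_const]
  refine setIntegral_mono_on (integrableOn_exp_neg_mul_cosh (by positivity) n)
    ((integrableOn_exp_neg_mul_cosh (by positivity) n).mul_const _) measurableSet_Ioi
    fun t _ => ?_
  have hc := Real.one_le_cosh t
  rw [mul_right_comm, ← Real.exp_add]
  gcongr
  have h1 : σ.re * R * Real.cosh t ≤ σ.re * r * Real.cosh t := by gcongr
  have h2 : σ.re * r * 1 ≤ σ.re * r * Real.cosh t := by gcongr
  nlinarith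

/-! ### Gaussian representations of `K₀` and `K₁` -/

lemma re_le_norm_sq_add {z : ℂ} {x : ℝ} (hz : x ≤ z.re) (v : ℝ) :
    2 * x ≤ ‖((v ^ 2 : ℝ) : ℂ) + 2 * z‖ := by
  refine le_trans ?_ (Complex.re_le_norm _)
  simp only [Complex.add_re, Complex.ofReal_re, Complex.mul_re, Complex.re_ofNat, Complex.im_ofNat]
  nlinarith [sq_nonneg v]

lemma two_mul_norm_le {z : ℂ} (hz : 0 < z.re) (v : ℝ) :
    2 * ‖z‖ ≤ ‖((v ^ 2 : ℝ) : ℂ) + 2 * z‖ := by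
  rw [← Real.sqrt_sq (norm_nonneg (((v ^ 2 : ℝ) : ℂ) + 2 * z))]
  refine Real.le_sqrt_of_sq_le ?_
  rw [mul_pow, ← Complex.normSq_eq_norm_sq, ← Complex.normSq_eq_norm_sq, Complex.normSq_apply,
    Complex.normSq_apply]
  simp only [Complex.add_re, Complex.ofReal_re, Complex.mul_re, Complex.re_ofNat, Complex.im_ofNat,
    Complex.add_im, Complex.ofReal_im, Complex.mul_im]
  nlinarith [mul_nonneg (sq_nonneg v) hz.le, sq_nonneg (v ^ 2)]

lemma sq_add_two_mul_mem_slitPlane {z : ℂ} (hz : 0 < z.re) (v : ℝ) :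
    ((v ^ 2 : ℝ) : ℂ) + 2 * z ∈ Complex.slitPlane := by
  refine Or.inl ?_
  simp only [Complex.add_re, Complex.ofReal_re, Complex.mul_re, Complex.re_ofNat, Complex.im_ofNat]
  nlinarith [sq_nonneg v]

/-- `∫_0^∞ p(v) (v² + 2 z)^c dv`, which gives `K₀` and `K₁` for Gaussian-type weights `p`. -/
noncomputable def powerIntegral (p : ℝ → ℝ) (c : ℝ) (z : ℂ) : ℂ :=
  ∫ v in Ioi (0 : ℝ), (p v : ℂ) * (((v ^ 2 : ℝ) : ℂ) + 2 * z) ^ (c : ℂ)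

lemma continuous_powerIntegral_integrand {p : ℝ → ℝ} (hp : Continuous p) (c : ℝ) {z : ℂ}
    (hz : 0 < z.re) :
    Continuous fun v : ℝ => (p v : ℂ) * (((v ^ 2 : ℝ) : ℂ) + 2 * z) ^ (c : ℂ) := by
  refine (by fun_prop : Continuous fun v : ℝ => (p v : ℂ)).mul ?_
  refine Continuous.cpow (by fun_prop) continuous_const fun v => sq_add_two_mul_mem_slitPlane hz v

lemma integrableOn_powerIntegral_integrand {p : ℝ → ℝ} (hp : Continuous p)
    (hp0 : IntegrableOn p (Ioi 0)) (hp2 : IntegrableOn (fun v => p v * v ^ 2) (Ioi 0))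
    {c : ℝ} (hc : c ≤ 1) {z : ℂ} (hz : 0 < z.re) :
    IntegrableOn (fun v : ℝ => (p v : ℂ) * (((v ^ 2 : ℝ) : ℂ) + 2 * z) ^ (c : ℂ)) (Ioi 0) := by
  refine Integrable.mono' ((hp2.norm.add (hp0.norm.const_mul (2 * ‖z‖))).const_mul
    ((2 * z.re) ^ (c - 1)))
    (continuous_powerIntegral_integrand hp c hz).aestronglyMeasurable (.of_forall fun v => ?_)
  have h1 := re_le_norm_sq_add (le_refl z.re) v
  have hpos : 0 < ‖((v ^ 2 : ℝ) : ℂ) + 2 * z‖ := lt_of_lt_of_le (by positivity) h1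
  have h2 : ‖((v ^ 2 : ℝ) : ℂ) + 2 * z‖ ≤ v ^ 2 + 2 * ‖z‖ := by
    refine (norm_add_le _ _).trans ?_
    rw [norm_mul, Complex.norm_real, Real.norm_of_nonneg (sq_nonneg v)]
    simp
  have h3 : ‖((v ^ 2 : ℝ) : ℂ) + 2 * z‖ ^ c ≤ (v ^ 2 + 2 * ‖z‖) * (2 * z.re) ^ (c - 1) := by
    calc ‖((v ^ 2 : ℝ) : ℂ) + 2 * z‖ ^ c
        = ‖((v ^ 2 : ℝ) : ℂ) + 2 * z‖ * ‖((v ^ 2 : ℝ) : ℂ) + 2 * z‖ ^ (c - 1) := by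
          rw [Real.rpow_sub_one hpos.ne']; field_simp
      _ ≤ _ := by
          gcongr ?_ * ?_
          exact Real.rpow_le_rpow_of_nonpos (by positivity) h1 (by linarith)
  rw [norm_mul, Complex.norm_cpow_real, Complex.norm_real]
  calc ‖p v‖ * ‖((v ^ 2 : ℝ) : ℂ) + 2 * z‖ ^ c
      ≤ ‖p v‖ * ((v ^ 2 + 2 * ‖z‖) * (2 * z.re) ^ (c - 1)) := by gcongr
    _ = _ := by
      simp only [Pi.add_apply, norm_mul, norm_pow, Real.norm_eq_abs, sq_abs]
      ring

lemma differentiableAt_powerIntegral {p : ℝ → ℝ} (hp : Continuous p)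
    (hp0 : IntegrableOn p (Ioi 0)) (hp2 : IntegrableOn (fun v => p v * v ^ 2) (Ioi 0))
    {c : ℝ} (hc : c ≤ 1) {z : ℂ} (hz : 0 < z.re) :
    DifferentiableAt ℂ (powerIntegral p c) z := by
  have hs : {w : ℂ | z.re / 2 < w.re} ∈ 𝓝 z :=
    (isOpen_lt continuous_const Complex.continuous_re).mem_nhds (by simp; linarith)
  have hpos : {w : ℂ | 0 < w.re} ∈ 𝓝 z :=
    (isOpen_lt continuous_const Complex.continuous_re).mem_nhds hz
  refine (hasDerivAt_integral_of_dominated_loc_of_deriv_le (𝕜 := ℂ)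
    (μ := volume.restrict (Ioi (0 : ℝ)))
    (F := fun w v => (p v : ℂ) * (((v ^ 2 : ℝ) : ℂ) + 2 * w) ^ (c : ℂ))
    (F' := fun w v => (2 * c : ℂ) * ((p v : ℂ) * (((v ^ 2 : ℝ) : ℂ) + 2 * w) ^ ((c - 1 : ℝ) : ℂ)))
    (bound := fun v => 2 * |c| * (‖p v‖ * z.re ^ (c - 1))) hs
    ?_ (integrableOn_powerIntegral_integrand hp hp0 hp2 hc hz)
    (continuous_const.mul (continuous_powerIntegral_integrand hp (c - 1) hz)).aestronglyMeasurable
    (.of_forall fun v w hw => ?_) ((hp0.norm.mul_const _).const_mul _)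
    (.of_forall fun v w hw => ?_)).2.differentiableAt
  · filter_upwards [hpos] with w hw
    exact (continuous_powerIntegral_integrand hp c hw).aestronglyMeasurable
  · have hw' : z.re / 2 ≤ w.re := le_of_lt hw
    have h1 := re_le_norm_sq_add hw' v
    rw [norm_mul, norm_mul, norm_mul, Complex.norm_cpow_real, Complex.norm_real, Complex.norm_real,
      Complex.norm_ofNat, Real.norm_eq_abs c]
    gcongr 2 * |c| * (‖p v‖ * ?_)
    exact Real.rpow_le_rpow_of_nonpos hz (by linarith) (by linarith)
  · have hw' : 0 < w.re := lt_trans (by linarith) (hw : z.re / 2 < w.re)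
    have h1 : HasDerivAt (fun w : ℂ => ((v ^ 2 : ℝ) : ℂ) + 2 * w) 2 w := by
      simpa using ((hasDerivAt_id w).const_mul 2).const_add ((v ^ 2 : ℝ) : ℂ)
    refine ((h1.cpow_const (c := (c : ℂ)) (sq_add_two_mul_mem_slitPlane hw' v)).const_mul
      (p v : ℂ)).congr_deriv ?_
    push_cast
    ring

lemma integrableOn_pow_mul_gaussian (n : ℕ) :
    IntegrableOn (fun v : ℝ => v ^ n * Real.exp (-v ^ 2)) (Ioi 0) := by
  have := integrableOn_rpow_mul_exp_neg_mul_sq (b := 1) one_pos (s := n)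
    (by have : (0 : ℝ) ≤ n := Nat.cast_nonneg n
        linarith)
  simpa [Real.rpow_natCast] using this

lemma integral_gaussian_half : ∫ v in Ioi (0 : ℝ), Real.exp (-v ^ 2) = √Real.pi / 2 := by
  simpa using integral_gaussian_Ioi 1

lemma integral_sq_mul_gaussian_half :
    ∫ v in Ioi (0 : ℝ), v ^ 2 * Real.exp (-v ^ 2) = √Real.pi / 4 := by
  have := integral_rpow_mul_exp_neg_rpow (p := 2) (q := 2) (by norm_num) (by norm_num)
  have h : ((2 : ℝ) + 1) / 2 = 1 / 2 + 1 := by norm_num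
  rw [h, Real.Gamma_add_one (by norm_num), Real.Gamma_one_half_eq] at this
  simp only [Real.rpow_two] at this
  rw [this]; ring

/-- The substitution `v = √(2 x) sinh (t / 2)`, for which `v² = x (cosh t - 1)`. -/
lemma integral_sinh_half_substitution {x : ℝ} (hx : 0 < x) {g : ℝ → ℝ} (hg : Continuous g)
    (hgi : IntegrableOn g (Ioi 0))
    (hi : IntegrableOn (fun t => g (√(2 * x) * Real.sinh (t / 2)) *
      (√(2 * x) * (Real.cosh (t / 2) / 2))) (Ioi 0)) :
    ∫ t in Ioi (0 : ℝ), g (√(2 * x) * Real.sinh (t / 2)) * (√(2 * x) * (Real.cosh (t / 2) / 2)) =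
      ∫ v in Ioi (0 : ℝ), g v := by
  have hd : ∀ t : ℝ, HasDerivAt (fun t => √(2 * x) * Real.sinh (t / 2))
      (√(2 * x) * (Real.cosh (t / 2) / 2)) t := by
    intro t
    refine HasDerivAt.const_mul _ ?_
    refine ((Real.hasDerivAt_sinh (t / 2)).comp t ((hasDerivAt_id t).div_const 2)).congr_deriv ?_
    ring
  have himg : (fun t => √(2 * x) * Real.sinh (t / 2)) '' Ici 0 ⊆ Ici 0 := by
    rintro _ ⟨t, ht, rfl⟩
    have ht : (0 : ℝ) ≤ t := ht
    have : 0 ≤ Real.sinh (t / 2) := Real.sinh_nonneg_iff.mpr (by linarith)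
    exact mul_nonneg (Real.sqrt_nonneg _) this
  have hlim : Tendsto (fun t => √(2 * x) * Real.sinh (t / 2)) atTop atTop := by
    refine Tendsto.const_mul_atTop (Real.sqrt_pos.mpr (by positivity)) ?_
    refine tendsto_atTop_mono' atTop ?_ (tendsto_id.atTop_div_const (two_pos))
    filter_upwards [eventually_ge_atTop (0 : ℝ)] with t ht
    exact Real.self_le_sinh_iff.mpr (by positivity)
  have := integral_comp_mul_deriv_Ioi (f := fun t => √(2 * x) * Real.sinh (t / 2))
    (f' := fun t => √(2 * x) * (Real.cosh (t / 2) / 2)) (g := g) (a := 0)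
    (continuous_iff_continuousAt.mpr fun t => (hd t).continuousAt).continuousOn hlim
    (fun t _ => (hd t).hasDerivWithinAt) hg.continuousOn
    (((integrableOn_Ici_iff_integrableOn_Ioi).mpr hgi).mono_set himg)
    ((integrableOn_Ici_iff_integrableOn_Ioi).mpr hi)
  simpa using this

lemma two_mul_sinh_half_sq (t : ℝ) : 2 * Real.sinh (t / 2) ^ 2 = Real.cosh t - 1 := by
  have h1 := Real.cosh_two_mul (t / 2)
  have h2 := Real.cosh_sq (t / 2)
  rw [show 2 * (t / 2) = t by ring] at h1
  linarith

lemma sqrt_sinh_half {x : ℝ} (hx : 0 < x) (t : ℝ) :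
    √((√(2 * x) * Real.sinh (t / 2)) ^ 2 + 2 * x) = √(2 * x) * Real.cosh (t / 2) := by
  rw [mul_pow, Real.sq_sqrt (by positivity),
    show 2 * x * Real.sinh (t / 2) ^ 2 + 2 * x = 2 * x * Real.cosh (t / 2) ^ 2 by
      rw [Real.cosh_sq]; ring,
    Real.sqrt_mul (by positivity), Real.sqrt_sq (Real.cosh_pos _).le]

lemma exp_sinh_half {x : ℝ} (hx : 0 < x) (t : ℝ) :
    Real.exp (-(√(2 * x) * Real.sinh (t / 2)) ^ 2) =
      Real.exp x * Real.exp (-x * Real.cosh t) := by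
  rw [← Real.exp_add, mul_pow, Real.sq_sqrt (by positivity)]
  congr 1
  linear_combination -x * two_mul_sinh_half_sq t

lemma ofReal_powerIntegral_integrand {x : ℝ} (hx : 0 < x) (p : ℝ → ℝ) (c v : ℝ) :
    (p v : ℂ) * (((v ^ 2 : ℝ) : ℂ) + 2 * (x : ℂ)) ^ (c : ℂ) =
      ((p v * (v ^ 2 + 2 * x) ^ c : ℝ) : ℂ) := by
  rw [Complex.ofReal_mul, Complex.ofReal_cpow (by positivity)]
  push_cast
  rfl

lemma continuous_gaussian : Continuous fun v : ℝ => Real.exp (-v ^ 2) := by fun_prop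

lemma integrableOn_gaussian : IntegrableOn (fun v : ℝ => Real.exp (-v ^ 2)) (Ioi 0) := by
  simpa using integrableOn_pow_mul_gaussian 0

lemma integrableOn_gaussian_mul_sq :
    IntegrableOn (fun v : ℝ => Real.exp (-v ^ 2) * v ^ 2) (Ioi 0) := by
  simpa [mul_comm] using integrableOn_pow_mul_gaussian 2

lemma continuous_sq_mul_gaussian : Continuous fun v : ℝ => v ^ 2 * Real.exp (-v ^ 2) := by
  fun_prop

lemma integrableOn_sq_mul_gaussian :
    IntegrableOn (fun v : ℝ => v ^ 2 * Real.exp (-v ^ 2)) (Ioi 0) :=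
  integrableOn_pow_mul_gaussian 2

lemma integrableOn_sq_mul_gaussian_mul_sq :
    IntegrableOn (fun v : ℝ => v ^ 2 * Real.exp (-v ^ 2) * v ^ 2) (Ioi 0) :=
  (integrableOn_pow_mul_gaussian 4).congr_fun (fun v _ => by ring) measurableSet_Ioi

lemma integral_powerIntegral_substitution {x : ℝ} (hx : 0 < x) {p : ℝ → ℝ} (hp : Continuous p)
    (hp0 : IntegrableOn p (Ioi 0)) (hp2 : IntegrableOn (fun v => p v * v ^ 2) (Ioi 0))
    {c : ℝ} (hc : c ≤ 1) {h : ℝ → ℝ} (hh : IntegrableOn h (Ioi 0))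
    (he : ∀ t, p (√(2 * x) * Real.sinh (t / 2)) *
      ((√(2 * x) * Real.sinh (t / 2)) ^ 2 + 2 * x) ^ c * (√(2 * x) * (Real.cosh (t / 2) / 2)) =
        h t) :
    powerIntegral p c x = ((∫ t in Ioi (0 : ℝ), h t : ℝ) : ℂ) := by
  have hx' : 0 < (x : ℂ).re := by simpa using hx
  have hgi : IntegrableOn (fun v => p v * (v ^ 2 + 2 * x) ^ c) (Ioi 0) := by
    have := (integrableOn_powerIntegral_integrand hp hp0 hp2 hc hx').re
    refine this.congr (.of_forall fun v => ?_)
    simp only [ofReal_powerIntegral_integrand hx]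
    rfl
  have hg : Continuous fun v => p v * (v ^ 2 + 2 * x) ^ c :=
    hp.mul ((by fun_prop : Continuous fun v : ℝ => v ^ 2 + 2 * x).rpow_const
      fun v => Or.inl (by positivity))
  have key := integral_sinh_half_substitution hx hg hgi
    (by simpa only [he] using hh)
  simp only [he] at key
  rw [powerIntegral, key, ← integral_complex_ofReal]
  simp only [ofReal_powerIntegral_integrand hx]

lemma besselK_zero_ofReal {x : ℝ} (hx : 0 < x) :
    besselK 0 x = 2 * Complex.exp (-x) *
      powerIntegral (fun v => Real.exp (-v ^ 2)) (-(1 / 2)) x := by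
  rw [integral_powerIntegral_substitution hx continuous_gaussian integrableOn_gaussian
    integrableOn_gaussian_mul_sq (by norm_num)
    (h := fun t => Real.exp x / 2 * (Real.exp (-x * Real.cosh t) * Real.cosh t ^ 0))
    ((integrableOn_exp_neg_mul_cosh hx 0).const_mul _) ?_, integral_const_mul, besselK_zero,
    coshMoment]
  · rw [← Complex.ofReal_neg]
    simp only [← Complex.ofReal_mul, ← Complex.ofReal_exp, ← Complex.ofReal_pow]
    rw [integral_complex_ofReal]
    have : Real.exp (-x) * Real.exp x = 1 := by rw [← Real.exp_add]; simp
    rw [show ∀ I : ℝ, (2 : ℂ) * (Real.exp (-x) : ℂ) * ((Real.exp x / 2 * I : ℝ) : ℂ) =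
      ((Real.exp (-x) * Real.exp x * I : ℝ) : ℂ) by intro I; push_cast; ring, this, one_mul]
  · intro t
    have hc := Real.cosh_pos (t / 2)
    have hs : 0 < √(2 * x) := Real.sqrt_pos.mpr (by positivity)
    rw [exp_sinh_half hx, Real.rpow_neg (by positivity), ← Real.sqrt_eq_rpow, sqrt_sinh_half hx]
    field_simp

lemma mul_besselK_one_ofReal {x : ℝ} (hx : 0 < x) :
    x * besselK 1 x = 2 * Complex.exp (-x) *
      powerIntegral (fun v => v ^ 2 * Real.exp (-v ^ 2)) (1 / 2) x := by
  have hx' : 0 < (x : ℂ).re := by simpa using hx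
  have hi : IntegrableOn (fun t => Real.exp x * x ^ 2 / 2 *
      (Real.exp (-x * Real.cosh t) * Real.cosh t ^ 2 -
        Real.exp (-x * Real.cosh t) * Real.cosh t ^ 0)) (Ioi 0) :=
    ((integrableOn_exp_neg_mul_cosh hx 2).sub (integrableOn_exp_neg_mul_cosh hx 0)).const_mul _
  rw [integral_powerIntegral_substitution hx continuous_sq_mul_gaussian
    integrableOn_sq_mul_gaussian integrableOn_sq_mul_gaussian_mul_sq (by norm_num)
    hi ?_, integral_const_mul, besselK_one, coshMoment_one_eq hx', coshMoment, coshMoment,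
    integral_sub (integrableOn_exp_neg_mul_cosh hx 2) (integrableOn_exp_neg_mul_cosh hx 0)]
  · rw [← Complex.ofReal_neg]
    simp only [← Complex.ofReal_mul, ← Complex.ofReal_exp, ← Complex.ofReal_pow]
    rw [integral_complex_ofReal, integral_complex_ofReal]
    have : Real.exp (-x) * Real.exp x = 1 := by rw [← Real.exp_add]; simp
    rw [show ∀ I : ℝ, (2 : ℂ) * (Real.exp (-x) : ℂ) * ((Real.exp x * x ^ 2 / 2 * I : ℝ) : ℂ) =
      ((Real.exp (-x) * Real.exp x * (x ^ 2 * I) : ℝ) : ℂ) by intro I; push_cast; ring, this,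
      one_mul]
    push_cast
    ring
  · intro t
    have h2 : Real.cosh t = Real.cosh (t / 2) ^ 2 + Real.sinh (t / 2) ^ 2 := by
      rw [← Real.cosh_two_mul]; ring_nf
    have h3 := Real.cosh_sq (t / 2)
    rw [exp_sinh_half hx, ← Real.sqrt_eq_rpow, sqrt_sinh_half hx, mul_pow,
      Real.sq_sqrt (by positivity)]
    have h4 : √(2 * x) * Real.cosh (t / 2) * (√(2 * x) * (Real.cosh (t / 2) / 2)) =
        x * Real.cosh (t / 2) ^ 2 := by
      linear_combination (Real.cosh (t / 2) ^ 2 / 2) *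
        Real.mul_self_sqrt (show 0 ≤ 2 * x by positivity)
    rw [mul_assoc _ (√(2 * x) * Real.cosh (t / 2)), h4]
    have h5 : Real.cosh t ^ 2 - 1 = 4 * Real.sinh (t / 2) ^ 2 * Real.cosh (t / 2) ^ 2 := by
      rw [h2, h3]; ring
    linear_combination (-(Real.exp x * x ^ 2 / 2 * Real.exp (-x * Real.cosh t))) * h5

/-- The identity theorem on the right half-plane. -/
lemma eqOn_re_pos_of_eq_ofReal {f g : ℂ → ℂ}
    (hf : ∀ z : ℂ, 0 < z.re → DifferentiableAt ℂ f z)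
    (hg : ∀ z : ℂ, 0 < z.re → DifferentiableAt ℂ g z)
    (h : ∀ x : ℝ, 0 < x → f x = g x) {z : ℂ} (hz : 0 < z.re) : f z = g z := by
  have hU : IsOpen {z : ℂ | 0 < z.re} := isOpen_lt continuous_const Complex.continuous_re
  have hconv : Convex ℝ {z : ℂ | 0 < z.re} := convex_halfSpace_re_gt 0
  refine AnalyticOnNhd.eqOn_of_preconnected_of_frequently_eq (z₀ := 1)
    (DifferentiableOn.analyticOnNhd (fun w hw => (hf w hw).differentiableWithinAt) hU)
    (DifferentiableOn.analyticOnNhd (fun w hw => (hg w hw).differentiableWithinAt) hU)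
    hconv.isPreconnected (show 0 < (1 : ℂ).re by simp) ?_ hz
  have ht : Tendsto (fun x : ℝ => (x : ℂ)) (𝓝[≠] 1) (𝓝[≠] 1) := by
    refine tendsto_nhdsWithin_iff.mpr ⟨?_, ?_⟩
    · exact (Complex.continuous_ofReal.tendsto' 1 1 (by simp)).mono_left nhdsWithin_le_nhds
    · filter_upwards [self_mem_nhdsWithin] with x hx
      simpa using hx
  refine ht.frequently (Eventually.frequently ?_)
  filter_upwards [nhdsWithin_le_nhds (lt_mem_nhds (one_pos : (0 : ℝ) < 1))] with x hx
  exact h x hx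

/-- The substitution `v = √(2 z) sinh (t / 2)`, made for real `z` and continued analytically, gives
a representation of `K₀` that is uniform up to the imaginary axis. -/
lemma besselK_zero_eq {z : ℂ} (hz : 0 < z.re) :
    besselK 0 z = 2 * Complex.exp (-z) *
      powerIntegral (fun v => Real.exp (-v ^ 2)) (-(1 / 2)) z := by
  refine eqOn_re_pos_of_eq_ofReal (f := besselK 0) (g := fun z => 2 * Complex.exp (-z) *
      powerIntegral (fun v => Real.exp (-v ^ 2)) (-(1 / 2)) z)
    (fun w hw => (hasDerivAt_besselK_zero hw).differentiableAt) (fun w hw => ?_)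
    (fun x hx => besselK_zero_ofReal hx) hz
  have := differentiableAt_powerIntegral continuous_gaussian integrableOn_gaussian
    integrableOn_gaussian_mul_sq (c := -(1 / 2)) (by norm_num) hw
  fun_prop

lemma mul_besselK_one_eq {z : ℂ} (hz : 0 < z.re) :
    z * besselK 1 z = 2 * Complex.exp (-z) *
      powerIntegral (fun v => v ^ 2 * Real.exp (-v ^ 2)) (1 / 2) z := by
  refine eqOn_re_pos_of_eq_ofReal (f := fun z => z * besselK 1 z)
    (g := fun z => 2 * Complex.exp (-z) *
      powerIntegral (fun v => v ^ 2 * Real.exp (-v ^ 2)) (1 / 2) z)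
    (fun w hw => ?_) (fun w hw => ?_) (fun x hx => mul_besselK_one_ofReal hx) hz
  · have := (hasDerivAt_besselK_one hw).differentiableAt
    fun_prop
  · have := differentiableAt_powerIntegral continuous_sq_mul_gaussian integrableOn_sq_mul_gaussian
      integrableOn_sq_mul_gaussian_mul_sq (c := 1 / 2) (by norm_num) hw
    fun_prop

lemma sqrt_norm_le_re_cpow_half {w : ℂ} (hw : 0 ≤ w.re) :
    √‖w‖ ≤ √2 * (w ^ ((1 / 2 : ℝ) : ℂ)).re := by
  have h : ((1 / 2 : ℝ) : ℂ) = 2⁻¹ := by push_cast; norm_num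
  rw [h, Complex.cpow_inv_two_re, ← Real.sqrt_mul (by norm_num)]
  exact Real.sqrt_le_sqrt (by linarith)

lemma norm_powerIntegral_gaussian_le {z : ℂ} (hz : 0 < z.re) :
    ‖powerIntegral (fun v => Real.exp (-v ^ 2)) (-(1 / 2)) z‖ ≤
      (√(2 * ‖z‖))⁻¹ * (√Real.pi / 2) := by
  have hz0 : 0 < ‖z‖ := hz.trans_le (Complex.re_le_norm z)
  rw [← integral_gaussian_half, ← integral_const_mul]
  refine norm_integral_le_of_norm_le (integrableOn_gaussian.const_mul _) (.of_forall fun v => ?_)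
  rw [norm_mul, Complex.norm_real, Complex.norm_cpow_real, Real.norm_of_nonneg (Real.exp_nonneg _),
    mul_comm, Real.rpow_neg (norm_nonneg _), ← Real.sqrt_eq_rpow]
  gcongr
  exact two_mul_norm_le hz v

lemma le_norm_powerIntegral_sq_mul_gaussian {z : ℂ} (hz : 0 < z.re) :
    √(2 * ‖z‖) * (√Real.pi / 4) ≤
      √2 * ‖powerIntegral (fun v => v ^ 2 * Real.exp (-v ^ 2)) (1 / 2) z‖ := by
  have hi := integrableOn_powerIntegral_integrand continuous_sq_mul_gaussian
    integrableOn_sq_mul_gaussian integrableOn_sq_mul_gaussian_mul_sq (c := 1 / 2) (by norm_num) hz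
  have h1 : √(2 * ‖z‖) * (√Real.pi / 4) ≤
      √2 * (powerIntegral (fun v => v ^ 2 * Real.exp (-v ^ 2)) (1 / 2) z).re := by
    rw [← integral_sq_mul_gaussian_half, ← integral_const_mul, powerIntegral,
      ← Complex.reCLM_apply, ← ContinuousLinearMap.integral_comp_comm _ hi, ← integral_const_mul]
    refine setIntegral_mono_on (integrableOn_sq_mul_gaussian.const_mul _)
      (hi.re.const_mul _) measurableSet_Ioi fun v _ => ?_
    have h2 : √(2 * ‖z‖) ≤ √‖((v ^ 2 : ℝ) : ℂ) + 2 * z‖ :=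
      Real.sqrt_le_sqrt (two_mul_norm_le hz v)
    have hre : 0 ≤ (((v ^ 2 : ℝ) : ℂ) + 2 * z).re := by
      simp only [Complex.add_re, Complex.ofReal_re, Complex.mul_re, Complex.re_ofNat,
        Complex.im_ofNat]
      nlinarith [sq_nonneg v]
    have h3 := sqrt_norm_le_re_cpow_half hre
    rw [Complex.reCLM_apply, Complex.re_ofReal_mul]
    calc √(2 * ‖z‖) * (v ^ 2 * Real.exp (-v ^ 2))
        ≤ (√2 * ((((v ^ 2 : ℝ) : ℂ) + 2 * z) ^ ((1 / 2 : ℝ) : ℂ)).re) *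
          (v ^ 2 * Real.exp (-v ^ 2)) := by gcongr; exact h2.trans h3
      _ = _ := by ring
  refine h1.trans ?_
  gcongr
  exact Complex.re_le_norm _

lemma besselK_one_ne_zero {z : ℂ} (hz : 0 < z.re) : besselK 1 z ≠ 0 := by
  intro h
  have hz0 : 0 < ‖z‖ := hz.trans_le (Complex.re_le_norm z)
  have h1 := mul_besselK_one_eq hz
  have h2 := le_norm_powerIntegral_sq_mul_gaussian hz
  rw [h, mul_zero, eq_comm, mul_eq_zero] at h1
  have h3 := h1.resolve_left (mul_ne_zero two_ne_zero (Complex.exp_ne_zero _))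
  rw [h3, norm_zero, mul_zero] at h2
  have : 0 < √(2 * ‖z‖) * (√Real.pi / 4) := by positivity
  linarith

/-- In the Gaussian representations, `|v² + 2 z| ≥ 2 |z|` and the square root of `v² + 2 z` has its
argument in `[-π/4, π/4]`. -/
lemma norm_besselK_zero_le {z : ℂ} (hz : 0 < z.re) :
    ‖besselK 0 z‖ ≤ √2 * ‖besselK 1 z‖ := by
  have hz0 : 0 < ‖z‖ := hz.trans_le (Complex.re_le_norm z)
  have h0 := norm_powerIntegral_gaussian_le hz
  have h1 := le_norm_powerIntegral_sq_mul_gaussian hz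
  have hs : 0 < √(2 * ‖z‖) := by positivity
  have hss : √(2 * ‖z‖) * √(2 * ‖z‖) = 2 * ‖z‖ := Real.mul_self_sqrt (by positivity)
  refine le_of_mul_le_mul_left ?_ hz0
  have e1 : ‖z‖ * (√2 * ‖besselK 1 z‖) = √2 * ‖z * besselK 1 z‖ := by rw [norm_mul]; ring
  rw [e1, mul_besselK_one_eq hz, besselK_zero_eq hz, norm_mul, norm_mul _ (powerIntegral _ _ _)]
  set E := ‖2 * Complex.exp (-z)‖
  calc ‖z‖ * (E * ‖powerIntegral (fun v => Real.exp (-v ^ 2)) (-(1 / 2)) z‖)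
      ≤ ‖z‖ * (E * ((√(2 * ‖z‖))⁻¹ * (√Real.pi / 2))) := by gcongr
    _ = E * (√(2 * ‖z‖) * (√Real.pi / 4)) := by
      have h2 : ‖z‖ * (√(2 * ‖z‖))⁻¹ = √(2 * ‖z‖) / 2 := by
        rw [← div_eq_mul_inv, div_eq_iff hs.ne']
        linear_combination (-1 / 2) * hss
      linear_combination (E * (√Real.pi / 2)) * h2
    _ ≤ E * (√2 * ‖powerIntegral (fun v => v ^ 2 * Real.exp (-v ^ 2)) (1 / 2) z‖) := by gcongr
    _ = _ := by ring

/-! ### The dispersive square root and the denominator -/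

/-- The symbol `1 + ν s + κ² s²` of the operator that maps `ζ` to `ζ + ν ∂_t ζ + κ² ∂_t² ζ`. -/
noncomputable def dispSymbol (κ ν : ℝ) (s : ℂ) : ℂ := 1 + (ν : ℂ) * s + (κ : ℂ) ^ 2 * s ^ 2

lemma dispRoot_eq (κ ν : ℝ) (s : ℂ) : dispRoot κ ν s = dispSymbol κ ν s ^ (2⁻¹ : ℂ) := by
  simp [dispRoot, dispSymbol]

lemma dispRoot_sq (κ ν : ℝ) (s : ℂ) : dispRoot κ ν s ^ 2 = dispSymbol κ ν s := by
  rw [dispRoot_eq]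
  exact_mod_cast Complex.cpow_nat_inv_pow (dispSymbol κ ν s) two_ne_zero

lemma dispSymbol_re (κ ν : ℝ) (s : ℂ) :
    (dispSymbol κ ν s).re = 1 + ν * s.re + κ ^ 2 * (s.re ^ 2 - s.im ^ 2) := by
  simp [dispSymbol, sq, Complex.mul_re, Complex.mul_im]

lemma dispSymbol_im (κ ν : ℝ) (s : ℂ) :
    (dispSymbol κ ν s).im = s.im * (ν + 2 * κ ^ 2 * s.re) := by
  simp [dispSymbol, sq, Complex.mul_re, Complex.mul_im]
  ring

lemma dispSymbol_mem_slitPlane {κ ν : ℝ} (hν : 0 ≤ ν) {s : ℂ} (hs : 0 < s.re) :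
    dispSymbol κ ν s ∈ Complex.slitPlane := by
  rw [Complex.mem_slitPlane_iff, dispSymbol_re, dispSymbol_im]
  by_cases h : s.im * (ν + 2 * κ ^ 2 * s.re) = 0
  · left
    rcases mul_eq_zero.mp h with h | h
    · rw [h]
      have h1 : 0 ≤ ν * s.re := by positivity
      have h2 : 0 ≤ κ ^ 2 * s.re ^ 2 := by positivity
      nlinarith
    · have h2 : 0 ≤ 2 * κ ^ 2 * s.re := by positivity
      have h3 : 2 * κ ^ 2 * s.re = 0 := by linarith
      have h4 : κ ^ 2 = 0 := by
        rcases mul_eq_zero.mp h3 with h5 | h5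
        · linarith
        · exact absurd h5 hs.ne'
      rw [h4]
      have : 0 ≤ ν * s.re := by positivity
      linarith
  · exact Or.inr h

lemma dispRoot_re_pos {κ ν : ℝ} (hν : 0 ≤ ν) {s : ℂ} (hs : 0 < s.re) :
    0 < (dispRoot κ ν s).re := by
  rw [dispRoot_eq, Complex.cpow_inv_two_re]
  have h := dispSymbol_mem_slitPlane (κ := κ) hν hs
  refine Real.sqrt_pos.mpr (half_pos ?_)
  have h1 := Complex.abs_re_le_norm (dispSymbol κ ν s)
  rcases h with h | h
  · have := norm_nonneg (dispSymbol κ ν s); linarith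
  · have h2 := (Complex.abs_re_lt_norm).mpr h
    linarith [neg_abs_le (dispSymbol κ ν s).re]

lemma dispRoot_ne_zero {κ ν : ℝ} (hν : 0 ≤ ν) {s : ℂ} (hs : 0 < s.re) : dispRoot κ ν s ≠ 0 := by
  intro h
  have := dispRoot_re_pos (κ := κ) hν hs
  simp [h] at this

/-- The imaginary parts of `s` and of the root have the same sign, so that dividing `s` by the root
brings it closer to the real axis. -/
lemma div_dispRoot_re_pos {κ ν : ℝ} (hν : 0 ≤ ν) {s : ℂ} (hs : 0 < s.re) :
    0 < (s / dispRoot κ ν s).re := by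
  have hw := dispRoot_re_pos (κ := κ) hν hs
  have h2 : 2 * (dispRoot κ ν s).re * (dispRoot κ ν s).im = s.im * (ν + 2 * κ ^ 2 * s.re) := by
    rw [← dispSymbol_im, ← dispRoot_sq, sq, Complex.mul_im]; ring
  have h3 : 0 ≤ s.im * (dispRoot κ ν s).im := by
    have : (2 * (dispRoot κ ν s).re) * (s.im * (dispRoot κ ν s).im) =
        s.im ^ 2 * (ν + 2 * κ ^ 2 * s.re) := by linear_combination s.im * h2
    have h4 : 0 ≤ s.im ^ 2 * (ν + 2 * κ ^ 2 * s.re) := by positivity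
    rw [← this] at h4
    exact nonneg_of_mul_nonneg_right h4 (by positivity)
  have hn : 0 < Complex.normSq (dispRoot κ ν s) :=
    Complex.normSq_pos.mpr (dispRoot_ne_zero hν hs)
  rw [Complex.div_re, ← add_div]
  refine div_pos ?_ hn
  have := mul_pos hs hw
  linarith

lemma norm_besselRatio_le {κ ν R : ℝ} (hν : 0 ≤ ν) (hR : 0 < R) {s : ℂ} (hs : 0 < s.re) :
    ‖besselRatio κ ν R s‖ ≤ √2 := by
  have hz : 0 < ((R : ℂ) * s / dispRoot κ ν s).re := by
    rw [mul_div_assoc, Complex.re_ofReal_mul]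
    exact mul_pos hR (div_dispRoot_re_pos hν hs)
  rw [besselRatio, norm_div, div_le_iff₀ (norm_pos_iff.mpr (besselK_one_ne_zero hz))]
  exact norm_besselK_zero_le hz

lemma norm_dispRoot_le {κ ν : ℝ} (hκ : 0 ≤ κ) (hν : 0 ≤ ν) (s : ℂ) :
    ‖dispRoot κ ν s‖ ≤ 1 + √(ν * ‖s‖) + κ * ‖s‖ := by
  have h1 : ‖dispRoot κ ν s‖ ^ 2 ≤ 1 + ν * ‖s‖ + κ ^ 2 * ‖s‖ ^ 2 := by
    rw [← norm_pow, dispRoot_sq, dispSymbol]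
    refine (norm_add₃_le).trans ?_
    simp [abs_of_nonneg hν]
  have h2 : 0 ≤ ν * ‖s‖ := by positivity
  refine abs_le_of_sq_le_sq' (h1.trans ?_) (by positivity) |>.2
  nlinarith [Real.sq_sqrt h2, Real.sqrt_nonneg (ν * ‖s‖), mul_nonneg hκ (norm_nonneg s),
    mul_nonneg (Real.sqrt_nonneg (ν * ‖s‖)) (mul_nonneg hκ (norm_nonneg s))]

lemma norm_radiation_le {κ ν R : ℝ} (hκ : 0 ≤ κ) (hν : 0 ≤ ν) (hR : 0 < R) {s : ℂ}
    (hs : 0 < s.re) :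
    ‖(R : ℂ) * dispRoot κ ν s * besselRatio κ ν R s‖ ≤
      R * (1 + √(ν * ‖s‖) + κ * ‖s‖) * √2 := by
  rw [norm_mul, norm_mul, Complex.norm_real, Real.norm_of_nonneg hR.le]
  gcongr
  · exact norm_dispRoot_le hκ hν s
  · exact norm_besselRatio_le hν hR hs

/-- `𝒫(s) → 2` as `s → 0⁺`. -/
lemma le_two_of_le_norm_transferDenom {τb κ ν R Pmin : ℝ} (hκ : 0 ≤ κ) (hν : 0 ≤ ν) (hR : 0 < R)
    (hP : ∀ s : ℂ, 0 < s.re → Pmin ≤ ‖transferDenom τb κ ν R s‖) : Pmin ≤ 2 := by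
  have hτ : 0 ≤ addedMass τb κ R := by unfold addedMass; positivity
  have hb : ∀ x : ℝ, 0 < x → Pmin ≤ 2 * addedMass τb κ R * x ^ 2 + 2 * ν * x +
      x * (R * (1 + √(ν * x) + κ * x) * √2) + 2 := by
    intro x hx
    have hx' : 0 < (x : ℂ).re := by simpa using hx
    refine (hP x hx').trans ?_
    have h1 := norm_radiation_le hκ hν hR hx'
    have hn : ‖(x : ℂ)‖ = x := by rw [Complex.norm_real, Real.norm_of_nonneg hx.le]
    rw [hn] at h1
    have e : transferDenom τb κ ν R x = 2 * (addedMass τb κ R : ℂ) * (x : ℂ) ^ 2 + 2 * (ν : ℂ) * x +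
        x * ((R : ℂ) * dispRoot κ ν x * besselRatio κ ν R x) + 2 := by
      rw [transferDenom]; ring
    rw [e]
    refine (norm_add_le _ _).trans (add_le_add ((norm_add₃_le).trans ?_) (by simp))
    rw [norm_mul (x : ℂ), hn]
    gcongr
    · simp [abs_of_nonneg hτ]
    · simp [abs_of_nonneg hν, abs_of_pos hx]
  have hlim : Tendsto (fun x : ℝ => 2 * addedMass τb κ R * x ^ 2 + 2 * ν * x +
      x * (R * (1 + √(ν * x) + κ * x) * √2) + 2) (𝓝[>] 0) (𝓝 2) := by
    refine (Continuous.tendsto' (by fun_prop) 0 2 (by simp)).mono_left nhdsWithin_le_nhds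
  refine ge_of_tendsto hlim ?_
  filter_upwards [self_mem_nhdsWithin] with x hx
  exact hb x hx

/-- Quadratic growth of the denominator, uniformly in `κ, ν ∈ [0, Λ]` and in `R > 0`. The constant
`√2` in `norm_besselRatio_le` is what the added mass `κ² + R² / 8 ≥ κ R / √2` can absorb. -/
lemma exists_mul_sq_le_norm_transferDenom {τb : ℝ} (hτb : 0 < τb) (Λ : ℝ) :
    ∃ M : ℝ, 1 ≤ M ∧ ∀ κ ν R : ℝ, 0 ≤ κ → κ ≤ Λ → 0 ≤ ν → ν ≤ Λ → 0 < R → ∀ s : ℂ, 0 < s.re →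
      M ≤ ‖s‖ → τb ^ 2 * ‖s‖ ^ 2 ≤ ‖transferDenom τb κ ν R s‖ := by
  have hε : Tendsto (fun y : ℝ => √2 * (y + √(Λ * y))) (𝓝 0) (𝓝 0) :=
    Continuous.tendsto' (by fun_prop) 0 0 (by simp)
  have hφ : Tendsto (fun y : ℝ => (3 * Λ + 1) * (√2 * (y + √(Λ * y))) + 2 * Λ * y + 2 * y ^ 2)
      (𝓝 0) (𝓝 0) := Continuous.tendsto' (by fun_prop) 0 0 (by simp)
  obtain ⟨M, hM⟩ := eventually_atTop.mp
    (((hε.comp tendsto_inv_atTop_zero).eventually_le_const (one_pos : (0 : ℝ) < 1)).and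
      ((hφ.comp tendsto_inv_atTop_zero).eventually_le_const (by positivity : 0 < τb ^ 2)))
  refine ⟨max M 1, le_max_right _ _, fun κ ν R hκ hκΛ hν hνΛ hR s hs hMs => ?_⟩
  obtain ⟨h1, h2⟩ := hM ‖s‖ ((le_max_left _ _).trans hMs)
  have ha : 1 ≤ ‖s‖ := (le_max_right _ _).trans hMs
  have hΛ : 0 ≤ Λ := hκ.trans hκΛ
  set a := ‖s‖
  simp only [Function.comp_apply] at h1 h2
  set ε := √2 * (a⁻¹ + √(Λ * a⁻¹))
  have ha0 : 0 < a := by linarith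
  have hε0 : 0 ≤ ε := by positivity
  have hεa : ε * a ^ 2 = √2 * a * (1 + √(Λ * a)) := by
    have h3 : √(Λ * a) = √(Λ * a⁻¹) * a := by
      rw [← Real.sqrt_sq ha0.le, ← Real.sqrt_mul (by positivity), Real.sqrt_sq ha0.le]
      congr 1
      field_simp
    rw [h3]
    simp only [ε]
    field_simp
  have hrad := norm_radiation_le hκ hν hR hs
  have hsν : √(ν * a) ≤ √(Λ * a) := Real.sqrt_le_sqrt (by gcongr)
  have hlow : 2 * addedMass τb κ R * a ^ 2 - 2 * Λ * a -
      a * (R * (1 + √(Λ * a) + κ * a) * √2) - 2 ≤ ‖transferDenom τb κ ν R s‖ := by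
    have hτ : 0 ≤ addedMass τb κ R := by unfold addedMass; positivity
    have e : 2 * (addedMass τb κ R : ℂ) * s ^ 2 = transferDenom τb κ ν R s - 2 * (ν : ℂ) * s -
        s * ((R : ℂ) * dispRoot κ ν s * besselRatio κ ν R s) - 2 := by
      rw [transferDenom]; ring
    have e1 : ‖2 * (addedMass τb κ R : ℂ) * s ^ 2‖ = 2 * addedMass τb κ R * a ^ 2 := by
      simp [abs_of_nonneg hτ, a]
    have e2 : ‖2 * (ν : ℂ) * s‖ ≤ 2 * Λ * a := by
      simp only [norm_mul, Complex.norm_ofNat, Complex.norm_real, Real.norm_of_nonneg hν]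
      gcongr
    have e3 : ‖s * ((R : ℂ) * dispRoot κ ν s * besselRatio κ ν R s)‖ ≤
        a * (R * (1 + √(Λ * a) + κ * a) * √2) := by
      rw [norm_mul]
      refine mul_le_mul_of_nonneg_left (hrad.trans ?_) ha0.le
      gcongr
    have e4 := norm_sub_le (transferDenom τb κ ν R s - 2 * (ν : ℂ) * s -
        s * ((R : ℂ) * dispRoot κ ν s * besselRatio κ ν R s)) 2
    have e5 := norm_sub_le (transferDenom τb κ ν R s - 2 * (ν : ℂ) * s)
        (s * ((R : ℂ) * dispRoot κ ν s * besselRatio κ ν R s))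
    have e6 := norm_sub_le (transferDenom τb κ ν R s) (2 * (ν : ℂ) * s)
    rw [← e, e1, Complex.norm_ofNat] at e4
    linarith
  refine le_trans ?_ hlow
  -- The square completed here is `2 κ² + R² / 4 - √2 κ R`.
  set d := √2 * κ - R / 2
  have h22 : √2 * √2 = 2 := Real.mul_self_sqrt (by norm_num)
  have hd2 : d ^ 2 = 2 * κ ^ 2 + R ^ 2 / 4 - √2 * κ * R := by
    simp only [d]; linear_combination κ ^ 2 * h22
  have hs2 : √2 ≤ 3 / 2 := by
    rw [Real.sqrt_le_left (by norm_num)]; norm_num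
  have hRd : R ≤ 3 * Λ + 1 + d ^ 2 := by
    have : √2 * κ ≤ 3 / 2 * Λ := by gcongr
    have hR2 : R = 2 * (√2 * κ) - 2 * d := by simp only [d]; ring
    nlinarith [sq_nonneg (d + 1)]
  have hmain : (R * ε + 2 * Λ * a⁻¹ + 2 * a⁻¹ ^ 2) * a ^ 2 ≤ (τb ^ 2 + d ^ 2) * a ^ 2 := by
    gcongr ?_ * a ^ 2
    have h5 : R * ε ≤ (3 * Λ + 1) * ε + d ^ 2 := by
      calc R * ε ≤ (3 * Λ + 1 + d ^ 2) * ε := by gcongr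
        _ = (3 * Λ + 1) * ε + d ^ 2 * ε := by ring
        _ ≤ (3 * Λ + 1) * ε + d ^ 2 * 1 := by gcongr
        _ = _ := by ring
    linarith
  have hexp : (R * ε + 2 * Λ * a⁻¹ + 2 * a⁻¹ ^ 2) * a ^ 2 =
      R * (√2 * a * (1 + √(Λ * a))) + 2 * Λ * a + 2 := by
    rw [← hεa]; field_simp
  rw [hexp, hd2] at hmain
  unfold addedMass
  nlinarith

/-! ### Integration by parts on the exterior domain -/

lemma ae_radialMeasure_iff {R : ℝ} (hR : 0 < R) {p : ℝ → Prop} :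
    (∀ᵐ r ∂radialMeasure R, p r) ↔ ∀ᵐ r ∂volume.restrict (Ioi R), p r := by
  rw [radialMeasure, ae_withDensity_iff (by fun_prop), ae_restrict_iff' measurableSet_Ioi,
    ae_restrict_iff' measurableSet_Ioi]
  refine eventually_congr (.of_forall fun r => ?_)
  refine forall_congr' fun hr => ?_
  have : 0 < r := hR.trans hr
  simp [this]

lemma integral_radialMeasure {R : ℝ} (hR : 0 < R) (f : ℝ → ℝ) :
    ∫ r, f r ∂radialMeasure R = ∫ r in Ioi R, r * f r := by
  rw [radialMeasure, integral_withDensity_eq_integral_toReal_smul (by fun_prop) (by simp)]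
  refine setIntegral_congr_fun measurableSet_Ioi fun r hr => ?_
  have : 0 < r := hR.trans hr
  simp [this.le]

lemma integrable_radialMeasure_iff {R : ℝ} (hR : 0 < R) {f : ℝ → ℝ} :
    Integrable f (radialMeasure R) ↔ IntegrableOn (fun r => r * f r) (Ioi R) := by
  rw [radialMeasure, integrable_withDensity_iff_integrable_smul' (by fun_prop) (by simp)]
  refine integrableOn_congr_fun (fun r hr => ?_) measurableSet_Ioi
  have : 0 < r := hR.trans hr
  simp [this.le]

lemma restrict_le_smul_radialMeasure {R : ℝ} (hR : 0 < R) :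
    volume.restrict (Ioi R) ≤ ENNReal.ofReal R⁻¹ • radialMeasure R := by
  rw [radialMeasure, ← withDensity_smul _ (by fun_prop)]
  conv_lhs => rw [← withDensity_one (μ := volume.restrict (Ioi R))]
  refine withDensity_mono ?_
  filter_upwards [ae_restrict_mem measurableSet_Ioi] with r hr
  have hr : R < r := hr
  simp only [Pi.one_apply, Pi.smul_apply, smul_eq_mul]
  rw [← ENNReal.ofReal_mul (by positivity), ← ENNReal.ofReal_one]
  refine ENNReal.ofReal_le_ofReal ?_
  rw [inv_mul_eq_div, le_div_iff₀ hR]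
  linarith

lemma L2r.memLp_restrict {R : ℝ} (hR : 0 < R) (f : L2r R) :
    MemLp f 2 (volume.restrict (Ioi R)) :=
  (Lp.memLp f).of_measure_le_smul (by simp) (restrict_le_smul_radialMeasure hR)

lemma L2r.intervalIntegrable {R T : ℝ} (hR : 0 < R) (hT : R ≤ T) (f : L2r R) :
    IntervalIntegrable f volume R T := by
  rw [intervalIntegrable_iff_integrableOn_Ioc_of_le hT]
  have h := (L2r.memLp_restrict hR f).mono_measure
    (Measure.restrict_mono (Ioc_subset_Ioi_self : Ioc R T ⊆ Ioi R) le_rfl)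
  exact h.integrable (by norm_num)

lemma L2r.integrable_mul {R : ℝ} (f g : L2r R) :
    Integrable (fun r => f r * g r) (radialMeasure R) :=
  (Lp.memLp f).integrable_mul (Lp.memLp g)

lemma L2r.inner_eq {R : ℝ} (f g : L2r R) :
    inner ℝ f g = ∫ r, f r * g r ∂radialMeasure R := by
  rw [L2.inner_def]
  simp [mul_comm]

/-- Green's formula: the boundary term at infinity vanishes because `r f q` has a limit there and
is integrable. -/
lemma HasRadialDeriv.inner_add_inner {R : ℝ} (hR : 0 < R) {f f' q D : L2r R} {c d : ℝ}
    (hf : HasRadialDeriv f f' c) (hq : HasRadialDiv q D d) :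
    inner ℝ f' q + inner ℝ f D = -(R * c * d) := by
  obtain ⟨g, hg, hD⟩ := hq
  unfold HasRadialDeriv at hf hg
  rw [ae_radialMeasure_iff hR] at hf hg hD
  set F : ℝ → ℝ := fun r => c + ∫ x in R..r, f' x
  set G : ℝ → ℝ := fun r => d + ∫ x in R..r, g x
  set h : ℝ → ℝ := fun r => r * (f' r * q r) + r * (f r * D r)
  have hi1 := (integrable_radialMeasure_iff hR).mp (L2r.integrable_mul f' q)
  have hi2 := (integrable_radialMeasure_iff hR).mp (L2r.integrable_mul f D)
  have hi3 := (integrable_radialMeasure_iff hR).mp (L2r.integrable_mul f q)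
  have hi : IntegrableOn h (Ioi R) := hi1.add hi2
  have hsum : inner ℝ f' q + inner ℝ f D = ∫ r in Ioi R, h r := by
    rw [L2r.inner_eq, L2r.inner_eq, integral_radialMeasure hR, integral_radialMeasure hR,
      ← integral_add hi1 hi2]
  have hAC : ∀ T, R ≤ T → ∫ r in R..T, h r = F T * (T * G T) - R * c * d := by
    intro T hT
    have hRT : R ∈ uIcc R T := left_mem_uIcc
    have hc : AbsolutelyContinuousOnInterval (fun _ : ℝ => c) R T :=
      (contDiffOn_const (n := 1)).absolutelyContinuousOnInterval
    have hdc : AbsolutelyContinuousOnInterval (fun _ : ℝ => d) R T :=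
      (contDiffOn_const (n := 1)).absolutelyContinuousOnInterval
    have hid : AbsolutelyContinuousOnInterval (fun r : ℝ => r) R T :=
      (contDiffOn_id (n := 1)).absolutelyContinuousOnInterval
    have hFac : AbsolutelyContinuousOnInterval F R T :=
      hc.add ((L2r.intervalIntegrable hR hT f').absolutelyContinuousOnInterval_intervalIntegral hRT)
    have hGac : AbsolutelyContinuousOnInterval G R T :=
      hdc.add ((L2r.intervalIntegrable hR hT g).absolutelyContinuousOnInterval_intervalIntegral hRT)
    have hrG : AbsolutelyContinuousOnInterval (fun r => r * G r) R T := hid.mul hGac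
    have key := hFac.integral_deriv_mul_eq_sub hrG
    have hFR : F R = c := by simp [F]
    have hGR : G R = d := by simp [G]
    rw [hFR, hGR] at key
    rw [show R * c * d = c * (R * d) by ring, ← key]
    refine intervalIntegral.integral_congr_ae ?_
    rw [ae_restrict_iff' measurableSet_Ioi] at hf hg hD
    filter_upwards [hf, hg, hD, (L2r.intervalIntegrable hR hT f').ae_hasDerivAt_integral,
      (L2r.intervalIntegrable hR hT g).ae_hasDerivAt_integral] with r h1 h2 h3 h4 h5 hr
    have hr' : r ∈ uIcc R T := uIoc_subset_uIcc hr
    rw [uIoc_of_le hT] at hr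
    have hr1 : R < r := hr.1
    have hr0 : r ≠ 0 := (hR.trans hr1).ne'
    have dF : HasDerivAt F (f' r) r := (h4 hr' R hRT).const_add c
    have dG : HasDerivAt G (g r) r := (h5 hr' R hRT).const_add d
    have drG : HasDerivAt (fun r => r * G r) (1 * G r + r * g r) r := (hasDerivAt_id r).mul dG
    rw [dF.deriv, drG.deriv]
    have h1' : f r = F r := h1 hr1
    have h2' : q r = G r := h2 hr1
    simp only [h, h3 hr1, ← h1', ← h2']
    field_simp
    ring
  have hlim : Tendsto (fun T => F T * (T * G T)) atTop (𝓝 ((∫ r in Ioi R, h r) + R * c * d)) := by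
    refine ((intervalIntegral_tendsto_integral_Ioi R hi tendsto_id).add_const (R * c * d)).congr' ?_
    filter_upwards [eventually_ge_atTop R] with T hT
    simp only [id]
    rw [hAC T hT]; ring
  have hint : IntegrableOn (fun T => F T * (T * G T)) (Ioi R) := by
    refine hi3.congr ?_
    filter_upwards [hf, hg] with r h1 h2
    rw [h1, h2]
    ring
  have hz := IntegrableAtFilter.eq_zero_of_tendsto ⟨Ioi R, Ioi_mem_atTop R, hint⟩
    (fun s hs => by
      obtain ⟨b, hb⟩ := mem_atTop_sets.mp hs
      refine le_antisymm le_top ?_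
      rw [← Real.volume_Ici (a := b)]
      exact measure_mono hb) hlim
  rw [hsum]
  linarith

/-! ### The energy estimate -/

section TimeDerivative

variable {E : Type*} [NormedAddCommGroup E] [NormedSpace ℝ E]

lemma hasDerivWithinAt_timeDeriv {f : ℝ → E} (hf : ContDiffOn ℝ 1 f (Ici 0)) {t : ℝ}
    (ht : 0 ≤ t) : HasDerivWithinAt f (timeDeriv f t) (Ici 0) t :=
  ((hf.differentiableOn one_ne_zero) t ht).hasDerivWithinAt

lemma hasDerivAt_timeDeriv {f : ℝ → E} (hf : ContDiffOn ℝ 1 f (Ici 0)) {t : ℝ}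
    (ht : 0 < t) : HasDerivAt f (timeDeriv f t) t :=
  (hasDerivWithinAt_timeDeriv hf ht.le).hasDerivAt (Ici_mem_nhds ht)

lemma continuousOn_timeDeriv {f : ℝ → E} (hf : ContDiffOn ℝ 1 f (Ici 0)) :
    ContinuousOn (timeDeriv f) (Ici 0) :=
  hf.continuousOn_derivWithin (uniqueDiffOn_Ici 0) le_rfl

lemma contDiffOn_timeDeriv {f : ℝ → E} (hf : ContDiffOn ℝ 2 f (Ici 0)) :
    ContDiffOn ℝ 1 (timeDeriv f) (Ici 0) :=
  hf.derivWithin (uniqueDiffOn_Ici 0) (by norm_num)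

end TimeDerivative

lemma addedMass_pos {τb : ℝ} (hτb : 0 < τb) (κ R : ℝ) : 0 < addedMass τb κ R := by
  unfold addedMass; positivity

/-- Twice the mechanical energy of the fluid and of the solid. -/
noncomputable def energy {R : ℝ} (τ2 κ : ℝ) (ζ q : ℝ → L2r R) (δ : ℝ → ℝ) (t : ℝ) : ℝ :=
  ‖q t‖ ^ 2 + ‖ζ t‖ ^ 2 + ‖κ • timeDeriv ζ t‖ ^ 2 +
    R ^ 2 / 2 * (τ2 * timeDeriv δ t ^ 2 + δ t ^ 2)

namespace IsSolution

variable {τb κ ν R δ₀ : ℝ} {ζ q : ℝ → L2r R} {δ : ℝ → ℝ}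

/-- Green's formula for `waveHead` and `q` cancels all the exchange terms between the fluid and the
solid, so that only the viscous dissipation is left. -/
lemma hasDerivWithinAt_energy (hR : 0 < R) (h : IsSolution τb κ ν R δ₀ ζ q δ) {t : ℝ}
    (ht : 0 ≤ t) :
    HasDerivWithinAt (energy (addedMass τb κ R) κ ζ q δ)
      (-(2 * ν * ‖timeDeriv ζ t‖ ^ 2 + R ^ 2 * ν * timeDeriv δ t ^ 2)) (Ici 0) t := by
  have h1 := (hasDerivWithinAt_timeDeriv h.contDiffOn_q ht).norm_sq
  have h2 := (hasDerivWithinAt_timeDeriv h.contDiffOn_zeta ht).norm_sq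
  have h3 := (hasDerivWithinAt_timeDeriv h.contDiffOn_disp ht).norm_sq
  have h4 := hasDerivWithinAt_timeDeriv (h.contDiffOn_delta.of_le (by norm_num)) ht
  have h5 := hasDerivWithinAt_timeDeriv (contDiffOn_timeDeriv h.contDiffOn_delta) ht
  have key := (h.momentum_newton t ht).inner_add_inner hR (h.mass t ht)
  have hder := ((h1.add h2).add h3).add
    ((((h5.pow 2).const_mul (addedMass τb κ R)).add (h4.pow 2)).const_mul (R ^ 2 / 2))
  refine hder.congr_deriv ?_
  simp only [waveHead, inner_neg_left, inner_neg_right, inner_add_left, real_inner_smul_left] at key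
  rw [real_inner_self_eq_norm_sq, real_inner_comm (q t)] at key
  rw [real_inner_smul_left,
    real_inner_comm (timeDeriv _ t) (timeDeriv ζ t)]
  push_cast
  linear_combination (-2) * key

lemma energy_le (hR : 0 < R) (hν : 0 ≤ ν) (h : IsSolution τb κ ν R δ₀ ζ q δ) {t : ℝ}
    (ht : 0 ≤ t) :
    energy (addedMass τb κ R) κ ζ q δ t ≤ energy (addedMass τb κ R) κ ζ q δ 0 := by
  have hanti : AntitoneOn (energy (addedMass τb κ R) κ ζ q δ) (Ici 0) := by
    refine antitoneOn_of_hasDerivWithinAt_nonpos (convex_Ici 0)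
      (f' := fun t => -(2 * ν * ‖timeDeriv ζ t‖ ^ 2 + R ^ 2 * ν * timeDeriv δ t ^ 2))
      (fun t ht => (h.hasDerivWithinAt_energy hR ht).continuousWithinAt)
      (fun t ht => (h.hasDerivWithinAt_energy hR (interior_subset ht)).mono interior_subset)
      (fun t _ => ?_)
    have : 0 ≤ 2 * ν * ‖timeDeriv ζ t‖ ^ 2 + R ^ 2 * ν * timeDeriv δ t ^ 2 := by positivity
    linarith
  exact hanti self_mem_Ici ht ht

lemma exists_bound (hτb : 0 < τb) (hR : 0 < R) (hν : 0 ≤ ν)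
    (h : IsSolution τb κ ν R δ₀ ζ q δ) :
    ∃ K : ℝ, ∀ t, 0 ≤ t → ‖q t‖ ≤ K ∧ ‖ζ t‖ ≤ K ∧ ‖κ • timeDeriv ζ t‖ ≤ K ∧
      |δ t| ≤ K ∧ |timeDeriv δ t| ≤ K := by
  have hτ := addedMass_pos hτb κ R
  set E := energy (addedMass τb κ R) κ ζ q δ 0
  have hE : 0 ≤ E := by
    simp only [E, energy]; positivity
  have aux : ∀ x c : ℝ, 0 ≤ c → x ^ 2 ≤ c * E → |x| ≤ 1 + c * E := by
    intro x c hc hx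
    rw [← sq_abs] at hx
    nlinarith [abs_nonneg x, sq_nonneg (|x| - 1)]
  set c₁ := 2 / R ^ 2
  set c₂ := 2 / (R ^ 2 * addedMass τb κ R)
  have hc₁ : 0 ≤ c₁ := by positivity
  have hc₂ : 0 ≤ c₂ := by positivity
  refine ⟨1 + (1 + c₁ + c₂) * E, fun t ht => ?_⟩
  have hle := h.energy_le hR hν ht
  unfold energy at hle
  change _ ≤ E at hle
  have p1 := sq_nonneg ‖q t‖
  have p2 := sq_nonneg ‖ζ t‖
  have p3 := sq_nonneg ‖κ • timeDeriv ζ t‖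
  have p4 : 0 ≤ R ^ 2 / 2 * (addedMass τb κ R * timeDeriv δ t ^ 2) := by positivity
  have p5 : 0 ≤ R ^ 2 / 2 * δ t ^ 2 := by positivity
  rw [mul_add] at hle
  have m1 : c₁ * E ≤ (1 + c₁ + c₂) * E := by gcongr; linarith
  have m2 : c₂ * E ≤ (1 + c₁ + c₂) * E := by gcongr; linarith
  have m0 : 1 * E ≤ (1 + c₁ + c₂) * E := by gcongr; linarith
  refine ⟨?_, ?_, ?_, ?_, ?_⟩
  · have := aux ‖q t‖ 1 zero_le_one (by linarith)
    rw [abs_of_nonneg (norm_nonneg _)] at this; linarith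
  · have := aux ‖ζ t‖ 1 zero_le_one (by linarith)
    rw [abs_of_nonneg (norm_nonneg _)] at this; linarith
  · have := aux ‖κ • timeDeriv ζ t‖ 1 zero_le_one (by linarith)
    rw [abs_of_nonneg (norm_nonneg _)] at this; linarith
  · have := aux (δ t) c₁ hc₁ (by
      have : δ t ^ 2 = c₁ * (R ^ 2 / 2 * δ t ^ 2) := by simp only [c₁]; field_simp
      rw [this]; gcongr; linarith)
    linarith
  · have := aux (timeDeriv δ t) c₂ hc₂ (by
      have : timeDeriv δ t ^ 2 =
          c₂ * (R ^ 2 / 2 * (addedMass τb κ R * timeDeriv δ t ^ 2)) := by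
        simp only [c₂]; field_simp
      rw [this]; gcongr; linarith)
    linarith

end IsSolution

/-! ### Pairings with the Bessel functions -/

lemma HasRadialDeriv.of_hasDerivAt {R : ℝ} (hR : 0 < R) {φ φ' : ℝ → ℝ}
    (hd : ∀ r, R ≤ r → HasDerivAt φ (φ' r) r) (hc : ContinuousOn φ' (Ici R)) {f g : L2r R}
    (hf : ∀ᵐ r ∂radialMeasure R, f r = φ r) (hg : ∀ᵐ r ∂radialMeasure R, g r = φ' r) :
    HasRadialDeriv f g (φ R) := by
  unfold HasRadialDeriv
  rw [ae_radialMeasure_iff hR] at hf hg ⊢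
  filter_upwards [hf, ae_restrict_mem measurableSet_Ioi] with r hr hRr
  have hRr : R < r := hRr
  rw [ae_restrict_iff' measurableSet_Ioi] at hg
  have h1 : ∫ x in R..r, g x = ∫ x in R..r, φ' x := by
    refine intervalIntegral.integral_congr_ae ?_
    filter_upwards [hg] with x hx hxm
    rw [uIoc_of_le hRr.le] at hxm
    exact hx hxm.1
  rw [hr, h1, intervalIntegral.integral_eq_sub_of_hasDerivAt]
  · ring
  · intro x hx
    rw [uIcc_of_le hRr.le] at hx
    exact hd x hx.1
  · refine (hc.mono ?_).intervalIntegrable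
    rw [uIcc_of_le hRr.le]
    exact Icc_subset_Ici_self

lemma memLp_of_norm_le_exp {R : ℝ} (hR : 0 < R) {k : ℝ → ℂ} (hk : ContinuousOn k (Ici R))
    {C b : ℝ} (hb : 0 < b) (hle : ∀ r, R ≤ r → ‖k r‖ ≤ C * Real.exp (-b * r)) :
    MemLp k 2 (radialMeasure R) := by
  have hm : AEStronglyMeasurable k (radialMeasure R) :=
    ((hk.mono Ioi_subset_Ici_self).aestronglyMeasurable measurableSet_Ioi).mono_ac
      (withDensity_absolutelyContinuous _ _)
  rw [memLp_two_iff_integrable_sq_norm hm, integrable_radialMeasure_iff hR]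
  have h1 : IntegrableOn (fun r : ℝ => C ^ 2 * (r * Real.exp (-(2 * b) * r))) (Ioi R) := by
    have := (integrableOn_rpow_mul_exp_neg_mul_rpow (s := 1) (p := 1) (b := 2 * b) (by norm_num)
      (by norm_num) (by positivity)).mono_set (Ioi_subset_Ioi hR.le)
    simp only [Real.rpow_one] at this
    exact this.const_mul (C ^ 2)
  refine Integrable.mono' h1 ?_ ?_
  · exact ContinuousOn.aestronglyMeasurable
      (by have := (hk.mono Ioi_subset_Ici_self).norm; fun_prop) measurableSet_Ioi
  · filter_upwards [ae_restrict_mem measurableSet_Ioi] with r hr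
    have hr : R < r := hr
    have hr0 : 0 < r := hR.trans hr
    rw [Real.norm_of_nonneg (by positivity)]
    have h2 : ‖k r‖ ^ 2 ≤ (C * Real.exp (-b * r)) ^ 2 := by
      gcongr
      exact hle r hr.le
    have h3 : (C * Real.exp (-b * r)) ^ 2 = C ^ 2 * Real.exp (-(2 * b) * r) := by
      rw [mul_pow, ← Real.exp_nat_mul]; congr 2; push_cast; ring
    rw [h3] at h2
    nlinarith

section BesselRay

variable {σ : ℂ} {R : ℝ}

lemma re_mul_ofReal_pos (hσ : 0 < σ.re) {r : ℝ} (hr : 0 < r) : 0 < (σ * r).re := by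
  simpa using mul_pos hσ hr

lemma hasDerivAt_besselK_zero_ray (hσ : 0 < σ.re) {r : ℝ} (hr : 0 < r) :
    HasDerivAt (fun r : ℝ => besselK 0 (σ * r)) (-(σ * besselK 1 (σ * r))) r := by
  have h1 : HasDerivAt (fun r : ℝ => σ * (r : ℂ)) σ r := by
    simpa using (Complex.ofRealCLM.hasDerivAt (x := r)).const_mul σ
  refine ((hasDerivAt_besselK_zero (re_mul_ofReal_pos hσ hr)).comp r h1).congr_deriv ?_
  ring

lemma hasDerivAt_besselK_one_ray (hσ : 0 < σ.re) {r : ℝ} (hr : 0 < r) :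
    HasDerivAt (fun r : ℝ => besselK 1 (σ * r))
      (-(σ * besselK 0 (σ * r)) - besselK 1 (σ * r) / r) r := by
  have h1 : HasDerivAt (fun r : ℝ => σ * (r : ℂ)) σ r := by
    simpa using (Complex.ofRealCLM.hasDerivAt (x := r)).const_mul σ
  have hσ0 : σ ≠ 0 := by rintro rfl; simp at hσ
  have hr0 : (r : ℂ) ≠ 0 := by exact_mod_cast hr.ne'
  refine ((hasDerivAt_besselK_one (re_mul_ofReal_pos hσ hr)).comp r h1).congr_deriv ?_
  field_simp

lemma continuousOn_besselK_zero_ray (hσ : 0 < σ.re) (hR : 0 < R) :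
    ContinuousOn (fun r : ℝ => besselK 0 (σ * r)) (Ici R) := fun _ hr =>
  (hasDerivAt_besselK_zero_ray hσ (hR.trans_le hr)).continuousAt.continuousWithinAt

lemma continuousOn_besselK_one_ray (hσ : 0 < σ.re) (hR : 0 < R) :
    ContinuousOn (fun r : ℝ => besselK 1 (σ * r)) (Ici R) := fun _ hr =>
  (hasDerivAt_besselK_one_ray hσ (hR.trans_le hr)).continuousAt.continuousWithinAt

lemma memLp_besselK_zero_ray (hσ : 0 < σ.re) (hR : 0 < R) :
    MemLp (fun r : ℝ => besselK 0 (σ * r)) 2 (radialMeasure R) := by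
  refine memLp_of_norm_le_exp hR (continuousOn_besselK_zero_ray hσ hR) (half_pos hσ)
    (C := ∫ t in Ioi (0 : ℝ), Real.exp (-(σ.re * R / 2) * Real.cosh t) * Real.cosh t ^ 0)
    fun r hr => ?_
  rw [besselK_zero]
  exact norm_coshMoment_mul_le hσ hR hr 0

lemma memLp_besselK_one_ray (hσ : 0 < σ.re) (hR : 0 < R) :
    MemLp (fun r : ℝ => besselK 1 (σ * r)) 2 (radialMeasure R) := by
  refine memLp_of_norm_le_exp hR (continuousOn_besselK_one_ray hσ hR) (half_pos hσ)
    (C := ∫ t in Ioi (0 : ℝ), Real.exp (-(σ.re * R / 2) * Real.cosh t) * Real.cosh t ^ 1)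
    fun r hr => ?_
  rw [besselK_one]
  exact norm_coshMoment_mul_le hσ hR hr 1

lemma continuousOn_besselK_one_div_ray (hσ : 0 < σ.re) (hR : 0 < R) :
    ContinuousOn (fun r : ℝ => besselK 1 (σ * r) / (r : ℂ)) (Ici R) := by
  refine (continuousOn_besselK_one_ray hσ hR).div (by fun_prop) fun r hr => ?_
  exact_mod_cast (hR.trans_le hr).ne'

lemma memLp_besselK_one_div_ray (hσ : 0 < σ.re) (hR : 0 < R) :
    MemLp (fun r : ℝ => besselK 1 (σ * r) / (r : ℂ)) 2 (radialMeasure R) := by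
  refine memLp_of_norm_le_exp hR (continuousOn_besselK_one_div_ray hσ hR) (half_pos hσ)
    (C := (∫ t in Ioi (0 : ℝ), Real.exp (-(σ.re * R / 2) * Real.cosh t) * Real.cosh t ^ 1) / R)
    fun r hr => ?_
  have hr0 : 0 < r := hR.trans_le hr
  rw [besselK_one, norm_div, Complex.norm_real, Real.norm_of_nonneg hr0.le, div_mul_eq_mul_div]
  have := norm_coshMoment_mul_le hσ hR hr 1
  exact div_le_div₀ ((norm_nonneg _).trans this) this hR hr

end BesselRay

lemma L2r.coeFn_neg_add_smul {R : ℝ} (a b : ℝ) (u v : L2r R) :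
    ∀ᵐ r ∂radialMeasure R, (-(a • u + b • v) : L2r R) r = -(a * u r + b * v r) := by
  filter_upwards [Lp.coeFn_neg (a • u + b • v), Lp.coeFn_add (a • u) (b • v), Lp.coeFn_smul a u,
    Lp.coeFn_smul b v] with r h1 h2 h3 h4
  rw [h1, Pi.neg_apply, h2, Pi.add_apply, h3, h4, Pi.smul_apply, Pi.smul_apply, smul_eq_mul,
    smul_eq_mul]

/-- The pairing `x ↦ ⟨u + i v, x⟩` of a real function with a complex one. -/
noncomputable def complexPairing {R : ℝ} (u v : L2r R) : L2r R →L[ℝ] ℂ :=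
  (innerSL ℝ u).smulRight (1 : ℂ) + (innerSL ℝ v).smulRight Complex.I

lemma complexPairing_apply {R : ℝ} (u v x : L2r R) :
    complexPairing u v x = ((inner ℝ u x : ℝ) : ℂ) + ((inner ℝ v x : ℝ) : ℂ) * Complex.I := by
  simp [complexPairing]

/-- The functionals `A = ⟨K₀(σ ·), ·⟩` and `B = ⟨K₁(σ ·), ·⟩` on `L²_r`, with what Green's formula
gives for them. -/
lemma exists_besselK_pairings {R : ℝ} (hR : 0 < R) {σ : ℂ} (hσ : 0 < σ.re) :
    ∃ A B : L2r R →L[ℝ] ℂ,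
      (∀ (f f' : L2r R) (c : ℝ), HasRadialDeriv f f' c →
        B f' = σ * A f - R * c * besselK 1 (σ * R)) ∧
      (∀ (q D : L2r R) (d : ℝ), HasRadialDiv q D d →
        A D = σ * B q - R * d * besselK 0 (σ * R)) := by
  have m0 := memLp_besselK_zero_ray hσ hR
  have m1 := memLp_besselK_one_ray hσ hR
  have m2 := memLp_besselK_one_div_ray hσ hR
  set u0 : L2r R := m0.re.toLp
  set v0 : L2r R := m0.im.toLp
  set u1 : L2r R := m1.re.toLp
  set v1 : L2r R := m1.im.toLp
  set u2 : L2r R := m2.re.toLp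
  set v2 : L2r R := m2.im.toLp
  have eu0 : ∀ᵐ r ∂radialMeasure R, u0 r = (besselK 0 (σ * r)).re := m0.re.coeFn_toLp
  have ev0 : ∀ᵐ r ∂radialMeasure R, v0 r = (besselK 0 (σ * r)).im := m0.im.coeFn_toLp
  have eu1 : ∀ᵐ r ∂radialMeasure R, u1 r = (besselK 1 (σ * r)).re := m1.re.coeFn_toLp
  have ev1 : ∀ᵐ r ∂radialMeasure R, v1 r = (besselK 1 (σ * r)).im := m1.im.coeFn_toLp
  have eu2 : ∀ᵐ r ∂radialMeasure R, u2 r = (besselK 1 (σ * r) / r).re := m2.re.coeFn_toLp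
  have ev2 : ∀ᵐ r ∂radialMeasure R, v2 r = (besselK 1 (σ * r) / r).im := m2.im.coeFn_toLp
  have c0 := continuousOn_besselK_zero_ray hσ hR
  have c1 := continuousOn_besselK_one_ray hσ hR
  have c2 := continuousOn_besselK_one_div_ray hσ hR
  have hre := fun (k : ℝ → ℂ) (k' : ℂ) (r : ℝ) (h : HasDerivAt k k' r) =>
    (Complex.reCLM.hasFDerivAt.comp_hasDerivAt r h)
  have him := fun (k : ℝ → ℂ) (k' : ℂ) (r : ℝ) (h : HasDerivAt k k' r) =>
    (Complex.imCLM.hasFDerivAt.comp_hasDerivAt r h)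
  have du0 : HasRadialDeriv u0 (-(σ.re • u1 + (-σ.im) • v1)) (besselK 0 (σ * R)).re := by
    refine HasRadialDeriv.of_hasDerivAt hR (φ := fun r : ℝ => (besselK 0 (σ * r)).re)
      (φ' := fun r : ℝ => (-(σ * besselK 1 (σ * r))).re)
      (fun r hr => hre _ _ r (hasDerivAt_besselK_zero_ray hσ (hR.trans_le hr)))
      (Complex.continuous_re.comp_continuousOn (continuousOn_const.mul c1).neg) eu0 ?_
    filter_upwards [eu1, ev1, L2r.coeFn_neg_add_smul σ.re (-σ.im) u1 v1] with r h1 h2 h3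
    rw [h3, h1, h2, Complex.neg_re, Complex.mul_re]
    ring
  have dv0 : HasRadialDeriv v0 (-(σ.re • v1 + σ.im • u1)) (besselK 0 (σ * R)).im := by
    refine HasRadialDeriv.of_hasDerivAt hR (φ := fun r : ℝ => (besselK 0 (σ * r)).im)
      (φ' := fun r : ℝ => (-(σ * besselK 1 (σ * r))).im)
      (fun r hr => him _ _ r (hasDerivAt_besselK_zero_ray hσ (hR.trans_le hr)))
      (Complex.continuous_im.comp_continuousOn (continuousOn_const.mul c1).neg) ev0 ?_
    filter_upwards [eu1, ev1, L2r.coeFn_neg_add_smul σ.re σ.im v1 u1] with r h1 h2 h3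
    rw [h3, h1, h2, Complex.neg_im, Complex.mul_im]
  have du1 : HasRadialDiv u1 (-(σ.re • u0 + (-σ.im) • v0)) (besselK 1 (σ * R)).re := by
    refine ⟨-(σ.re • u0 + (-σ.im) • v0) - u2, ?_, ?_⟩
    · refine HasRadialDeriv.of_hasDerivAt hR (φ := fun r : ℝ => (besselK 1 (σ * r)).re)
        (φ' := fun r : ℝ => (-(σ * besselK 0 (σ * r)) - besselK 1 (σ * r) / r).re)
        (fun r hr => hre _ _ r (hasDerivAt_besselK_one_ray hσ (hR.trans_le hr)))
        (Complex.continuous_re.comp_continuousOn ((continuousOn_const.mul c0).neg.sub c2)) eu1 ?_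
      filter_upwards [eu0, ev0, eu2, L2r.coeFn_neg_add_smul σ.re (-σ.im) u0 v0,
        Lp.coeFn_sub (-(σ.re • u0 + (-σ.im) • v0)) u2] with r h1 h2 h3 h4 h5
      rw [h5, Pi.sub_apply, h4, h1, h2, h3, Complex.sub_re, Complex.neg_re, Complex.mul_re]
      ring
    · filter_upwards [eu1, eu2, Lp.coeFn_sub (-(σ.re • u0 + (-σ.im) • v0)) u2] with r h1 h2 h3
      rw [h3, Pi.sub_apply, h1, h2, Complex.div_ofReal_re]
      ring
  have dv1 : HasRadialDiv v1 (-(σ.re • v0 + σ.im • u0)) (besselK 1 (σ * R)).im := by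
    refine ⟨-(σ.re • v0 + σ.im • u0) - v2, ?_, ?_⟩
    · refine HasRadialDeriv.of_hasDerivAt hR (φ := fun r : ℝ => (besselK 1 (σ * r)).im)
        (φ' := fun r : ℝ => (-(σ * besselK 0 (σ * r)) - besselK 1 (σ * r) / r).im)
        (fun r hr => him _ _ r (hasDerivAt_besselK_one_ray hσ (hR.trans_le hr)))
        (Complex.continuous_im.comp_continuousOn ((continuousOn_const.mul c0).neg.sub c2)) ev1 ?_
      filter_upwards [eu0, ev0, ev2, L2r.coeFn_neg_add_smul σ.re σ.im v0 u0,
        Lp.coeFn_sub (-(σ.re • v0 + σ.im • u0)) v2] with r h1 h2 h3 h4 h5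
      rw [h5, Pi.sub_apply, h4, h1, h2, h3, Complex.sub_im, Complex.neg_im, Complex.mul_im]
    · filter_upwards [ev1, ev2, Lp.coeFn_sub (-(σ.re • v0 + σ.im • u0)) v2] with r h1 h2 h3
      rw [h3, Pi.sub_apply, h1, h2, Complex.div_ofReal_im]
      ring
  refine ⟨complexPairing u0 v0, complexPairing u1 v1, fun f f' c hf => ?_, fun q D d hq => ?_⟩
  · have k1 := hf.inner_add_inner hR du1
    have k2 := hf.inner_add_inner hR dv1
    simp only [inner_neg_right, inner_add_right, real_inner_smul_right] at k1 k2
    simp only [real_inner_comm _ f, real_inner_comm _ f'] at k1 k2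
    simp only [complexPairing_apply]
    refine Complex.ext ?_ ?_
    · simp
      linarith
    · simp
      linarith
  · have k1 := du0.inner_add_inner hR hq
    have k2 := dv0.inner_add_inner hR hq
    simp only [inner_neg_left, inner_add_left, real_inner_smul_left] at k1 k2
    simp only [complexPairing_apply]
    refine Complex.ext ?_ ?_
    · simp
      linarith
    · simp
      linarith

/-! ### The Laplace transform of the velocity -/

lemma norm_exp_neg_mul (s : ℂ) (t : ℝ) : ‖Complex.exp (-s * t)‖ = Real.exp (-s.re * t) := by
  rw [Complex.norm_exp]; simp

lemma continuous_exp_neg_mul (s : ℂ) : Continuous fun t : ℝ => Complex.exp (-s * t) := by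
  fun_prop

lemma ofReal_continuousOn {f : ℝ → ℝ} {s : Set ℝ} (hf : ContinuousOn f s) :
    ContinuousOn (fun t => (f t : ℂ)) s :=
  Complex.continuous_ofReal.comp_continuousOn hf

lemma integrableOn_laplace {s : ℂ} (hs : 0 < s.re) {f : ℝ → ℂ} (hf : ContinuousOn f (Ici 0))
    {K : ℝ} (hK : ∀ t, 0 ≤ t → ‖f t‖ ≤ K) :
    IntegrableOn (fun t : ℝ => Complex.exp (-s * t) * f t) (Ioi 0) := by
  refine Integrable.mono' ((exp_neg_integrableOn_Ioi 0 hs).mul_const K) ?_ ?_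
  · exact ((continuous_exp_neg_mul s).continuousOn.mul
      (hf.mono Ioi_subset_Ici_self)).aestronglyMeasurable measurableSet_Ioi
  · filter_upwards [ae_restrict_mem measurableSet_Ioi] with t ht
    rw [norm_mul, norm_exp_neg_mul]
    gcongr
    exact hK t (le_of_lt ht)

lemma tendsto_laplace {s : ℂ} (hs : 0 < s.re) {f : ℝ → ℂ} (hf : ContinuousOn f (Ici 0))
    {K : ℝ} (hK : ∀ t, 0 ≤ t → ‖f t‖ ≤ K) :
    Tendsto (fun T : ℝ => ∫ t in (0 : ℝ)..T, Complex.exp (-s * t) * f t) atTop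
      (𝓝 (∫ t in Ioi (0 : ℝ), Complex.exp (-s * t) * f t)) :=
  intervalIntegral_tendsto_integral_Ioi 0 (integrableOn_laplace hs hf hK) tendsto_id

lemma tendsto_exp_neg_mul_bounded {s : ℂ} (hs : 0 < s.re) {f : ℝ → ℂ} {K : ℝ}
    (hK : ∀ t, 0 ≤ t → ‖f t‖ ≤ K) :
    Tendsto (fun T : ℝ => Complex.exp (-s * T) * f T) atTop (𝓝 0) := by
  have h1 : Tendsto (fun T : ℝ => Real.exp (-s.re * T) * K) atTop (𝓝 0) := by
    rw [← zero_mul K]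
    refine Tendsto.mul_const K (Real.tendsto_exp_atBot.comp ?_)
    exact tendsto_id.const_mul_atTop_of_neg (by linarith)
  refine squeeze_zero_norm' ?_ h1
  filter_upwards [eventually_ge_atTop (0 : ℝ)] with T hT
  rw [norm_mul, norm_exp_neg_mul]
  gcongr
  exact hK T hT

lemma intervalIntegrable_laplace (s : ℂ) {f : ℝ → ℂ} (hf : ContinuousOn f (Ici 0)) {T : ℝ}
    (hT : 0 ≤ T) :
    IntervalIntegrable (fun t : ℝ => Complex.exp (-s * t) * f t) volume 0 T := by
  refine ContinuousOn.intervalIntegrable ?_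
  rw [uIcc_of_le hT]
  exact (continuous_exp_neg_mul s).continuousOn.mul (hf.mono Icc_subset_Ici_self)

/-- The Laplace transform of a derivative, over a bounded time interval. -/
lemma laplace_deriv (s : ℂ) {f f' : ℝ → ℂ}
    (hf : ∀ t, 0 ≤ t → HasDerivWithinAt f (f' t) (Ici 0) t) (hf' : ContinuousOn f' (Ici 0))
    {T : ℝ} (hT : 0 ≤ T) :
    ∫ t in (0 : ℝ)..T, Complex.exp (-s * t) * f' t =
      Complex.exp (-s * T) * f T - f 0 + s * ∫ t in (0 : ℝ)..T, Complex.exp (-s * t) * f t := by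
  have hfc : ContinuousOn f (Ici 0) := fun t ht => (hf t ht).continuousWithinAt
  have i1 := intervalIntegrable_laplace s hf' hT
  have i2 := intervalIntegrable_laplace s hfc hT
  have key := intervalIntegral.integral_eq_sub_of_hasDeriv_right_of_le hT
    (f := fun t : ℝ => Complex.exp (-s * t) * f t)
    (f' := fun t => Complex.exp (-s * t) * f' t - s * (Complex.exp (-s * t) * f t))
    ((continuous_exp_neg_mul s).continuousOn.mul (hfc.mono Icc_subset_Ici_self))
    (fun t ht => ?_) (i1.sub (i2.const_mul s))
  · rw [intervalIntegral.integral_sub i1 (i2.const_mul s), intervalIntegral.integral_const_mul]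
      at key
    simp only [Complex.ofReal_zero, mul_zero, Complex.exp_zero, one_mul] at key
    linear_combination key
  · have h1 : HasDerivAt (fun t : ℝ => -s * (t : ℂ)) (-s) t := by
      simpa using (Complex.ofRealCLM.hasDerivAt (x := t)).const_mul (-s)
    have h2 := (hf t ht.1.le).mono (Ioi_subset_Ici ht.1.le)
    refine (h1.cexp.hasDerivWithinAt.mul h2).congr_deriv ?_
    ring

lemma ofReal_hasDerivWithinAt {f : ℝ → ℝ} {f' : ℝ} {s : Set ℝ} {t : ℝ}
    (h : HasDerivWithinAt f f' s t) : HasDerivWithinAt (fun t => (f t : ℂ)) (f' : ℂ) s t :=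
  Complex.ofRealCLM.hasFDerivAt.comp_hasDerivWithinAt t h

namespace IsSolution

variable {τb κ ν R δ₀ : ℝ} {ζ q : ℝ → L2r R} {δ : ℝ → ℝ}

lemma contDiffOn_one_delta (h : IsSolution τb κ ν R δ₀ ζ q δ) : ContDiffOn ℝ 1 δ (Ici 0) :=
  h.contDiffOn_delta.of_le (by norm_num)

/-- Testing the fluid equations against `K₀(σ r)` and `K₁(σ r)`, with `σ = s / √(1 + ν s + κ² s²)`,
eliminates the fluid: only boundary terms in time remain. -/
lemma exists_laplace_identity (hτb : 0 < τb) (hR : 0 < R) (hν : 0 ≤ ν)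
    (h : IsSolution τb κ ν R δ₀ ζ q δ) {s : ℂ} (hs : 0 < s.re) :
    ∃ (β : ℝ → ℂ) (K : ℝ), (∀ t, 0 ≤ t → ‖β t‖ ≤ K) ∧ ∀ T, 0 ≤ T →
      transferDenom τb κ ν R s *
        (∫ t in (0 : ℝ)..T, Complex.exp (-s * t) * ((timeDeriv δ t : ℝ) : ℂ)) + 2 * δ₀ =
        Complex.exp (-s * T) * β T := by
  obtain ⟨K, hK⟩ := h.exists_bound hτb hR hν
  have hσ := div_dispRoot_re_pos (κ := κ) hν hs
  have hw0 := dispRoot_ne_zero (κ := κ) hν hs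
  have hw2 := dispRoot_sq κ ν s
  have hs0 : s ≠ 0 := by rintro rfl; simp at hs
  have hR0 : (R : ℂ) ≠ 0 := by exact_mod_cast hR.ne'
  obtain ⟨A, B, hB, hA⟩ := exists_besselK_pairings hR hσ
  have hz : 0 < (s / dispRoot κ ν s * R).re := re_mul_ofReal_pos hσ hR
  have hK1 := besselK_one_ne_zero hz
  have hbr : besselRatio κ ν R s * besselK 1 (s / dispRoot κ ν s * R) =
      besselK 0 (s / dispRoot κ ν s * R) := by
    have e : (R : ℂ) * s / dispRoot κ ν s = s / dispRoot κ ν s * R := by ring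
    rw [besselRatio, e, div_mul_cancel₀ _ hK1]
  set w := dispRoot κ ν s
  set σ := s / w
  set k0 := besselK 0 (σ * R)
  set k1 := besselK 1 (σ * R)
  have hσw : σ * w = s := div_mul_cancel₀ _ hw0
  -- `y` keeps the factor `κ`: only `κ ∂_t ζ` is known to be differentiable in time.
  set a : ℝ → ℂ := fun t => A (ζ t)
  set a' : ℝ → ℂ := fun t => A (timeDeriv ζ t)
  set y : ℝ → ℂ := fun t => A (κ • timeDeriv ζ t)
  set y' : ℝ → ℂ := fun t => A (timeDeriv (fun t' => κ • timeDeriv ζ t') t)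
  set b : ℝ → ℂ := fun t => B (q t)
  set b' : ℝ → ℂ := fun t => B (timeDeriv q t)
  have da : ∀ t, 0 ≤ t → HasDerivWithinAt a (a' t) (Ici 0) t := fun t ht =>
    A.hasFDerivAt.comp_hasDerivWithinAt t (hasDerivWithinAt_timeDeriv h.contDiffOn_zeta ht)
  have dy : ∀ t, 0 ≤ t → HasDerivWithinAt y (y' t) (Ici 0) t := fun t ht =>
    A.hasFDerivAt.comp_hasDerivWithinAt t (hasDerivWithinAt_timeDeriv h.contDiffOn_disp ht)
  have db : ∀ t, 0 ≤ t → HasDerivWithinAt b (b' t) (Ici 0) t := fun t ht =>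
    B.hasFDerivAt.comp_hasDerivWithinAt t (hasDerivWithinAt_timeDeriv h.contDiffOn_q ht)
  have ca' : ContinuousOn a' (Ici 0) :=
    A.continuous.comp_continuousOn (continuousOn_timeDeriv h.contDiffOn_zeta)
  have cy' : ContinuousOn y' (Ici 0) :=
    A.continuous.comp_continuousOn (continuousOn_timeDeriv h.contDiffOn_disp)
  have cb' : ContinuousOn b' (Ici 0) :=
    B.continuous.comp_continuousOn (continuousOn_timeDeriv h.contDiffOn_q)
  have ca : ContinuousOn a (Ici 0) := fun t ht => (da t ht).continuousWithinAt
  have cb : ContinuousOn b (Ici 0) := fun t ht => (db t ht).continuousWithinAt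
  have dδ := fun t (ht : 0 ≤ t) => ofReal_hasDerivWithinAt
    (hasDerivWithinAt_timeDeriv h.contDiffOn_one_delta ht)
  have dδ' := fun t (ht : 0 ≤ t) => ofReal_hasDerivWithinAt
    (hasDerivWithinAt_timeDeriv (contDiffOn_timeDeriv h.contDiffOn_delta) ht)
  have cδ := ofReal_continuousOn h.contDiffOn_delta.continuousOn
  have cδ' := ofReal_continuousOn (continuousOn_timeDeriv h.contDiffOn_one_delta)
  have cδ'' := ofReal_continuousOn
    (continuousOn_timeDeriv (contDiffOn_timeDeriv h.contDiffOn_delta))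
  have eqa : ∀ t, 0 ≤ t → a' t = -σ * b t - R * (R / 2) * k0 * ((timeDeriv δ t : ℝ) : ℂ) := by
    intro t ht
    have := hA _ _ _ (h.mass t ht)
    rw [map_neg] at this
    push_cast at this
    linear_combination -this
  have eqb : ∀ t, 0 ≤ t → b' t = -σ * (a t + ν * a' t + κ * y' t) +
      R * k1 * ((addedMass τb κ R : ℂ) * ((timeDeriv (timeDeriv δ) t : ℝ) : ℂ) +
        ν * ((timeDeriv δ t : ℝ) : ℂ) + (δ t : ℂ)) := by
    intro t ht
    have := hB _ _ _ (h.momentum_newton t ht)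
    rw [map_neg, waveHead, map_add, map_add, map_smul, map_smul] at this
    push_cast at this
    simp only [Complex.real_smul] at this
    linear_combination -this
  have eqy : ∀ t, y t = κ * a' t := fun t => by simp [y, a']
  have a0 : a 0 = 0 := by simp [a, h.zeta_init]
  have b0 : b 0 = 0 := by simp [b, h.q_init]
  have y0 : y 0 = 0 := by rw [eqy, eqa 0 le_rfl, b0, h.delta_dot_init]; simp
  refine ⟨fun T => 2 * (s / R * (b T + (-a T + s * κ * y T) / w) / k1 -
      ((addedMass τb κ R : ℂ) * s * ((timeDeriv δ T : ℝ) : ℂ) - (δ T : ℂ))),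
    2 * (‖s / R‖ * (‖B‖ * K + (‖A‖ * K + ‖s * κ‖ * (‖A‖ * K)) / ‖w‖) / ‖k1‖ +
      (‖(addedMass τb κ R : ℂ) * s‖ * K + K)), fun t ht => ?_, fun T hT => ?_⟩
  · obtain ⟨h1, h2, h3, h4, h5⟩ := hK t ht
    have n1 : ‖b t‖ ≤ ‖B‖ * K := (B.le_opNorm _).trans (by gcongr)
    have n2 : ‖a t‖ ≤ ‖A‖ * K := (A.le_opNorm _).trans (by gcongr)
    have n3 : ‖y t‖ ≤ ‖A‖ * K := (A.le_opNorm _).trans (by gcongr)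
    have n4 : ‖(δ t : ℂ)‖ ≤ K := by rwa [Complex.norm_real]
    have n5 : ‖((timeDeriv δ t : ℝ) : ℂ)‖ ≤ K := by rwa [Complex.norm_real]
    rw [norm_mul, Complex.norm_ofNat]
    gcongr
    refine (norm_sub_le _ _).trans (add_le_add ?_ ((norm_sub_le _ _).trans ?_))
    · rw [norm_div, norm_mul]
      gcongr
      refine (norm_add_le _ _).trans ?_
      rw [norm_div]
      gcongr
      refine (norm_add_le _ _).trans ?_
      rw [norm_neg, norm_mul (s * (κ : ℂ))]
      gcongr
    · rw [norm_mul ((addedMass τb κ R : ℂ) * s)]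
      gcongr
  · beta_reduce
    have La := laplace_deriv s da ca' hT
    have Ly := laplace_deriv s dy cy' hT
    have Lb := laplace_deriv s db cb' hT
    have Ld := laplace_deriv s dδ cδ' hT
    have Ldd := laplace_deriv s dδ' cδ'' hT
    have ia := intervalIntegrable_laplace s ca hT
    have ia' := intervalIntegrable_laplace s ca' hT
    have iy' := intervalIntegrable_laplace s cy' hT
    have ib := intervalIntegrable_laplace s cb hT
    have id := intervalIntegrable_laplace s cδ hT
    have id' := intervalIntegrable_laplace s cδ' hT
    have id'' := intervalIntegrable_laplace s cδ'' hT
    have E1 : ∫ t in (0 : ℝ)..T, Complex.exp (-s * t) * a' t =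
        -σ * (∫ t in (0 : ℝ)..T, Complex.exp (-s * t) * b t) - R * (R / 2) * k0 *
          ∫ t in (0 : ℝ)..T, Complex.exp (-s * t) * ((timeDeriv δ t : ℝ) : ℂ) := by
      rw [← intervalIntegral.integral_const_mul, ← intervalIntegral.integral_const_mul,
        ← intervalIntegral.integral_sub (ib.const_mul _) (id'.const_mul _)]
      refine intervalIntegral.integral_congr fun t ht => ?_
      rw [uIcc_of_le hT] at ht
      rw [eqa t ht.1]
      ring
    have E2 : ∫ t in (0 : ℝ)..T, Complex.exp (-s * t) * y t =
        κ * ∫ t in (0 : ℝ)..T, Complex.exp (-s * t) * a' t := by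
      rw [← intervalIntegral.integral_const_mul]
      refine intervalIntegral.integral_congr fun t ht => ?_
      rw [eqy]
      ring
    have E3 : ∫ t in (0 : ℝ)..T, Complex.exp (-s * t) * b' t =
        -σ * ((∫ t in (0 : ℝ)..T, Complex.exp (-s * t) * a t) +
          ν * (∫ t in (0 : ℝ)..T, Complex.exp (-s * t) * a' t) +
          κ * ∫ t in (0 : ℝ)..T, Complex.exp (-s * t) * y' t) +
        R * k1 * ((addedMass τb κ R : ℂ) *
            (∫ t in (0 : ℝ)..T, Complex.exp (-s * t) * ((timeDeriv (timeDeriv δ) t : ℝ) : ℂ)) +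
          ν * (∫ t in (0 : ℝ)..T, Complex.exp (-s * t) * ((timeDeriv δ t : ℝ) : ℂ)) +
          ∫ t in (0 : ℝ)..T, Complex.exp (-s * t) * (δ t : ℂ)) := by
      simp only [← intervalIntegral.integral_const_mul]
      rw [← intervalIntegral.integral_add ia (ia'.const_mul _),
        ← intervalIntegral.integral_add (ia.add (ia'.const_mul _)) (iy'.const_mul _),
        ← intervalIntegral.integral_add (id''.const_mul _) (id'.const_mul _),
        ← intervalIntegral.integral_add ((id''.const_mul _).add (id'.const_mul _)) id,
        ← intervalIntegral.integral_const_mul, ← intervalIntegral.integral_const_mul,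
        ← intervalIntegral.integral_add
          (((ia.add (ia'.const_mul _)).add (iy'.const_mul _)).const_mul _)
          ((((id''.const_mul _).add (id'.const_mul _)).add id).const_mul _)]
      refine intervalIntegral.integral_congr fun t ht => ?_
      rw [uIcc_of_le hT] at ht
      rw [eqb t ht.1]
      ring
    rw [a0] at La
    rw [b0] at Lb
    rw [y0] at Ly
    rw [h.delta_dot_init, Complex.ofReal_zero] at Ldd
    rw [h.delta_init] at Ld
    generalize (∫ t in (0 : ℝ)..T, Complex.exp (-s * t) * a t) = Ia at *
    generalize (∫ t in (0 : ℝ)..T, Complex.exp (-s * t) * a' t) = Ia' at *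
    generalize (∫ t in (0 : ℝ)..T, Complex.exp (-s * t) * y t) = Iy at *
    generalize (∫ t in (0 : ℝ)..T, Complex.exp (-s * t) * y' t) = Iy' at *
    generalize (∫ t in (0 : ℝ)..T, Complex.exp (-s * t) * b t) = Ib at *
    generalize (∫ t in (0 : ℝ)..T, Complex.exp (-s * t) * b' t) = Ib' at *
    generalize (∫ t in (0 : ℝ)..T, Complex.exp (-s * t) * (δ t : ℂ)) = Iδ at *
    generalize (∫ t in (0 : ℝ)..T, Complex.exp (-s * t) * ((timeDeriv δ t : ℝ) : ℂ)) = X at *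
    generalize (∫ t in (0 : ℝ)..T,
      Complex.exp (-s * t) * ((timeDeriv (timeDeriv δ) t : ℝ) : ℂ)) = X' at *
    generalize Complex.exp (-s * T) = e at *
    generalize a T = aT at *
    generalize b T = bT at *
    generalize y T = yT at *
    generalize (δ T : ℂ) = δT at *
    generalize ((timeDeriv δ T : ℝ) : ℂ) = δT' at *
    have hD : w ^ 2 = 1 + ν * s + (κ : ℂ) ^ 2 * s ^ 2 := hw2
    -- `F1` turns the operator `1 + ν ∂_t + κ² ∂_t²` into the factor `w²`, up to boundary terms;
    -- `F3` and `hbr` then express what is left of the fluid through `X` alone.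
    have F1 : s * (Ia + ν * Ia' + κ * Iy') = w ^ 2 * Ia' + e * (-aT + s * κ * yT) := by
      rw [hD]
      linear_combination (-1 : ℂ) * La + s * κ * Ly + s ^ 2 * κ * E2
    have F2 : e * bT + s * Ib = -(w * Ia') - e * (-aT + s * κ * yT) / w +
        R * k1 * ((addedMass τb κ R : ℂ) * X' + ν * X + Iδ) := by
      have G : σ * (Ia + ν * Ia' + κ * Iy') = w * Ia' + e * (-aT + s * κ * yT) / w := by
        have : σ * (Ia + ν * Ia' + κ * Iy') = (s * (Ia + ν * Ia' + κ * Iy')) / w := by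
          simp only [σ]; ring
        rw [this, F1]
        field_simp
      linear_combination E3 - Lb - G
    have F3 : w * Ia' = -(s * Ib) - w * (R * (R / 2) * k0 * X) := by
      linear_combination w * E1 - Ib * hσw
    have F4 : R * k1 * (s * ((addedMass τb κ R : ℂ) * X' + ν * X + Iδ) +
        s * w * (R / 2) * besselRatio κ ν R s * X) =
        s * (e * (bT + (-aT + s * κ * yT) / w)) := by
      linear_combination (-s) * F2 + s * F3 + s * w * (R * (R / 2)) * X * hbr
    have F5 : s * ((addedMass τb κ R : ℂ) * X' + ν * X + Iδ) +
        s * w * (R / 2) * besselRatio κ ν R s * X =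
        e * (s / R * (bT + (-aT + s * κ * yT) / w) / k1) := by
      have : R * k1 * (e * (s / R * (bT + (-aT + s * κ * yT) / w) / k1)) =
          s * (e * (bT + (-aT + s * κ * yT) / w)) := by field_simp
      exact mul_left_cancel₀ (mul_ne_zero hR0 hK1) (F4.trans this.symm)
    rw [transferDenom]
    linear_combination 2 * F5 - 2 * s * (addedMass τb κ R : ℂ) * Ldd + 2 * Ld

/-- The boundary terms of `exists_laplace_identity` are bounded, hence damped by the exponential as
`T → ∞`. -/
lemma transferDenom_mul_laplace_timeDeriv (hτb : 0 < τb) (hR : 0 < R) (hν : 0 ≤ ν)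
    (h : IsSolution τb κ ν R δ₀ ζ q δ) {s : ℂ} (hs : 0 < s.re) :
    transferDenom τb κ ν R s *
      (∫ t in Ioi (0 : ℝ), Complex.exp (-s * t) * ((timeDeriv δ t : ℝ) : ℂ)) = -(2 * δ₀) := by
  obtain ⟨β, K', hβ, hid⟩ := h.exists_laplace_identity hτb hR hν hs
  obtain ⟨K, hK⟩ := h.exists_bound hτb hR hν
  have l1 := ((tendsto_laplace hs (ofReal_continuousOn
    (continuousOn_timeDeriv h.contDiffOn_one_delta)) (K := K) (fun t ht => by
      rw [Complex.norm_real]; exact (hK t ht).2.2.2.2)).const_mul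
    (transferDenom τb κ ν R s)).add_const (2 * (δ₀ : ℂ))
  have l2 := tendsto_exp_neg_mul_bounded hs hβ
  have := tendsto_nhds_unique (l1.congr' ?_) l2
  · linear_combination this
  · filter_upwards [eventually_ge_atTop (0 : ℝ)] with T hT
    exact hid T hT

lemma mul_laplace_delta (hτb : 0 < τb) (hR : 0 < R) (hν : 0 ≤ ν)
    (h : IsSolution τb κ ν R δ₀ ζ q δ) {s : ℂ} (hs : 0 < s.re) :
    ∫ t in Ioi (0 : ℝ), Complex.exp (-s * t) * ((timeDeriv δ t : ℝ) : ℂ) =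
      -δ₀ + s * ∫ t in Ioi (0 : ℝ), Complex.exp (-s * t) * (δ t : ℂ) := by
  obtain ⟨K, hK⟩ := h.exists_bound hτb hR hν
  have b1 : ∀ t, 0 ≤ t → ‖(δ t : ℂ)‖ ≤ K := fun t ht => by
    rw [Complex.norm_real]; exact (hK t ht).2.2.2.1
  have l1 := tendsto_laplace hs (ofReal_continuousOn
    (continuousOn_timeDeriv h.contDiffOn_one_delta)) (K := K) (fun t ht => by
      rw [Complex.norm_real]; exact (hK t ht).2.2.2.2)
  have l2 := (((tendsto_exp_neg_mul_bounded hs b1).sub_const (δ₀ : ℂ)).add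
    ((tendsto_laplace hs (ofReal_continuousOn h.contDiffOn_delta.continuousOn) b1).const_mul s))
  rw [zero_sub] at l2
  refine tendsto_nhds_unique (l1.congr' ?_) l2
  filter_upwards [eventually_ge_atTop (0 : ℝ)] with T hT
  rw [laplace_deriv s (fun t ht => ofReal_hasDerivWithinAt
    (hasDerivWithinAt_timeDeriv h.contDiffOn_one_delta ht)) (ofReal_continuousOn
    (continuousOn_timeDeriv h.contDiffOn_one_delta)) hT, h.delta_init]

end IsSolution

/-! ### Plancherel bounds on the half-line -/

lemma eLpNorm_two_le_of_integral_le {α E : Type*} [MeasurableSpace α] {μ : Measure α}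
    [NormedAddCommGroup E] {F : α → E} (hF : AEStronglyMeasurable F μ)
    (hi : Integrable (fun x => ‖F x‖ ^ 2) μ) {a : ℝ} (ha : ∫ x, ‖F x‖ ^ 2 ∂μ ≤ a) :
    eLpNorm F 2 μ ≤ ENNReal.ofReal (√a) := by
  have hmem : MemLp F 2 μ := (memLp_two_iff_integrable_sq_norm hF).2 hi
  rw [hmem.eLpNorm_eq_integral_rpow_norm (by norm_num) (by norm_num)]
  refine ENNReal.ofReal_le_ofReal ?_
  simp only [ENNReal.toReal_ofNat, Real.rpow_ofNat]
  rw [Real.sqrt_eq_rpow, ← one_div]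
  exact Real.rpow_le_rpow (by positivity) ha (by norm_num)

open scoped FourierTransform in
/-- Plancherel's inequality for a continuous integrable function with integrable Fourier
transform. -/
lemma eLpNorm_two_le_of_norm_fourier_le {F : ℝ → ℂ} (hc : Continuous F) (hi : Integrable F)
    (hi' : Integrable (𝓕 F)) {M : ℝ → ℝ} (hM : ∀ ξ, ‖𝓕 F ξ‖ ≤ M ξ)
    (hMi : Integrable fun ξ => M ξ ^ 2) :
    eLpNorm F 2 volume ≤ ENNReal.ofReal (√(∫ ξ, M ξ ^ 2)) := by
  have key : ∫ ξ, inner ℂ (𝓕 F ξ) (𝓕 F ξ) = ∫ x, inner ℂ (F x) (F x) := by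
    have h := VectorFourier.integral_sesq_fourierIntegral_eq_neg_flip (innerSL ℂ)
      (L := innerₗ ℝ) (μ := volume) (ν := volume) Real.continuous_fourierChar continuous_inner
      hi hi'
    have h2 := hc.fourierInv_fourier_eq hi hi'
    have h3 : VectorFourier.fourierIntegral Real.fourierChar volume (-(innerₗ ℝ).flip) (𝓕 F)
        = F := by
      rw [flip_innerₗ]
      exact h2
    rw [h3] at h
    exact h
  have hbd : ∀ x, ‖F x‖ ≤ ∫ ξ, ‖𝓕 F ξ‖ := by
    intro x
    have h2 := congrFun (hc.fourierInv_fourier_eq hi hi') x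
    rw [← h2]
    exact VectorFourier.norm_fourierIntegral_le_integral_norm _ _ _ _ _
  have hF2 : Integrable fun x => ‖F x‖ ^ 2 := by
    refine (hi.norm.const_mul (∫ ξ, ‖𝓕 F ξ‖)).mono' (by fun_prop) (ae_of_all _ fun x => ?_)
    rw [Real.norm_of_nonneg (by positivity), sq]
    exact mul_le_mul_of_nonneg_right (hbd x) (norm_nonneg _)
  have hreal : ∫ x, ‖F x‖ ^ 2 = ∫ ξ, ‖𝓕 F ξ‖ ^ 2 := by
    have e : ∀ z : ℂ, inner ℂ z z = ((‖z‖ ^ 2 : ℝ) : ℂ) := fun z => by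
      rw [inner_self_eq_norm_sq_to_K]; norm_cast
    simp only [e] at key
    rw [integral_complex_ofReal, integral_complex_ofReal] at key
    exact (Complex.ofReal_injective key).symm
  have hle : ∫ x, ‖F x‖ ^ 2 ≤ ∫ ξ, M ξ ^ 2 := by
    rw [hreal]
    refine integral_mono_of_nonneg (ae_of_all _ fun ξ => by positivity) hMi
      (ae_of_all _ fun ξ => ?_)
    exact pow_le_pow_left₀ (norm_nonneg _) (hM ξ) 2
  exact eLpNorm_two_le_of_integral_le hi.1 hF2 hle

open scoped FourierTransform in
lemma fourier_differenceQuotient {g : ℝ → ℂ} (hg : Integrable g) (h ξ : ℝ) :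
    𝓕 (fun t => (h : ℂ)⁻¹ • (g (t + h) - g t)) ξ =
      (h : ℂ)⁻¹ • ((Complex.exp (Complex.I * (2 * Real.pi * ξ * h : ℝ)) - 1) * 𝓕 g ξ) := by
  have e2 : 𝓕 (fun t => g (t + h)) ξ =
      Complex.exp (Complex.I * (2 * Real.pi * ξ * h : ℝ)) * 𝓕 g ξ := by
    have := VectorFourier.fourierIntegral_comp_add_right Real.fourierChar volume (innerₗ ℝ) g h
    refine (congrFun this ξ).trans ?_
    rw [Circle.smul_def, Real.fourierChar_apply, smul_eq_mul]
    congr 2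
    simp
    ring
  have hg' : Integrable fun t => g (t + h) := hg.comp_add_right h
  have i1 : ∀ u : ℝ → ℂ, Integrable u → Integrable fun v : ℝ =>
      Complex.exp (↑(-2 * Real.pi * v * ξ) * Complex.I) • u v := by
    intro u hu
    refine hu.bdd_mul (c := 1) (Continuous.aestronglyMeasurable (by fun_prop))
      (ae_of_all _ fun v => ?_)
    rw [Complex.norm_exp_ofReal_mul_I]
  have e3 : ∀ v : ℝ, Complex.exp (↑(-2 * Real.pi * v * ξ) * Complex.I) •
      ((h : ℂ)⁻¹ • (g (v + h) - g v)) = (h : ℂ)⁻¹ •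
      (Complex.exp (↑(-2 * Real.pi * v * ξ) * Complex.I) • g (v + h) -
        Complex.exp (↑(-2 * Real.pi * v * ξ) * Complex.I) • g v) := by
    intro v
    simp only [smul_eq_mul]
    ring
  rw [Real.fourier_real_eq_integral_exp_smul] at e2 ⊢
  simp_rw [e3]
  rw [integral_smul, integral_sub (i1 _ hg') (i1 _ hg), e2,
    ← Real.fourier_real_eq_integral_exp_smul]
  simp only [smul_eq_mul]
  ring

open scoped FourierTransform in
/-- Difference quotients are bounded in `L²` by any square-integrable majorant of the Fourier
transform of the derivative. -/
lemma eLpNorm_differenceQuotient_le {g : ℝ → ℂ} (hgc : Continuous g) (hgi : Integrable g)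
    (hgF : Integrable (𝓕 g)) {M : ℝ → ℝ} (hM : ∀ ξ, ‖𝓕 g ξ‖ ≤ M ξ)
    (hMi : Integrable fun ξ => (2 * Real.pi * ξ * M ξ) ^ 2) {h : ℝ} (hh : 0 < h) :
    eLpNorm (fun t => (h : ℂ)⁻¹ • (g (t + h) - g t)) 2 volume ≤
      ENNReal.ofReal (√(∫ ξ, (2 * Real.pi * ξ * M ξ) ^ 2)) := by
  have hbound : ∀ ξ : ℝ, ‖𝓕 (fun t => (h : ℂ)⁻¹ • (g (t + h) - g t)) ξ‖ ≤
      |2 * Real.pi * ξ| * M ξ := by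
    intro ξ
    have := Real.norm_exp_I_mul_ofReal_sub_one_le (x := 2 * Real.pi * ξ * h)
    rw [fourier_differenceQuotient hgi, norm_smul, norm_mul, norm_inv, Complex.norm_real,
      Real.norm_of_nonneg hh.le]
    rw [Real.norm_eq_abs, abs_mul, abs_of_pos hh] at this
    calc h⁻¹ * (‖Complex.exp (Complex.I * (2 * Real.pi * ξ * h : ℝ)) - 1‖ * ‖𝓕 g ξ‖)
        ≤ h⁻¹ * (|2 * Real.pi * ξ| * h * M ξ) := by
          gcongr
          exact hM ξ
      _ = _ := by field_simp
  have hint : Integrable (𝓕 (fun t => (h : ℂ)⁻¹ • (g (t + h) - g t))) := by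
    rw [funext (fourier_differenceQuotient hgi h)]
    refine Integrable.smul (h : ℂ)⁻¹ (hgF.bdd_mul (c := 2)
      (Continuous.aestronglyMeasurable (by fun_prop)) (ae_of_all _ fun ξ => ?_))
    refine (norm_sub_le _ _).trans ?_
    rw [mul_comm, Complex.norm_exp_ofReal_mul_I]
    norm_num
  have hsq : ∀ ξ : ℝ, (|2 * Real.pi * ξ| * M ξ) ^ 2 = (2 * Real.pi * ξ * M ξ) ^ 2 := fun ξ => by
    rw [mul_pow, sq_abs, mul_pow _ (M ξ)]
  have hqc : Continuous fun t : ℝ => (h : ℂ)⁻¹ • (g (t + h) - g t) := by fun_prop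
  have hqi : Integrable fun t : ℝ => (h : ℂ)⁻¹ • (g (t + h) - g t) :=
    Integrable.smul (h : ℂ)⁻¹ ((hgi.comp_add_right h).sub hgi)
  have := eLpNorm_two_le_of_norm_fourier_le hqc hqi hint hbound (by simpa only [hsq] using hMi)
  simpa only [hsq] using this

/-- The damped causal extension of `f`. It vanishes on `(-∞, 0]` when `f 0 = 0`. -/
noncomputable def dampedExtension (η : ℝ) (f : ℝ → ℝ) (t : ℝ) : ℂ :=
  ((Real.exp (-η * t) * f (max t 0) : ℝ) : ℂ)

section Damped

variable {f : ℝ → ℝ} {η : ℝ}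

lemma continuous_dampedExtension (hf : ContinuousOn f (Ici 0)) :
    Continuous (dampedExtension η f) := by
  have h : Continuous fun t : ℝ => f (max t 0) :=
    hf.comp_continuous (by fun_prop) fun t => le_max_right t 0
  have h2 : Continuous fun t : ℝ => Real.exp (-η * t) := by fun_prop
  exact Complex.continuous_ofReal.comp (h2.mul h)

lemma dampedExtension_of_nonpos (h0 : f 0 = 0) {t : ℝ} (ht : t ≤ 0) :
    dampedExtension η f t = 0 := by
  simp [dampedExtension, max_eq_right ht, h0]

lemma dampedExtension_of_pos {t : ℝ} (ht : 0 < t) :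
    dampedExtension η f t = ((Real.exp (-η * t) * f t : ℝ) : ℂ) := by
  simp [dampedExtension, max_eq_left ht.le]

lemma integrable_dampedExtension (hη : 0 < η) (hf : ContinuousOn f (Ici 0)) (h0 : f 0 = 0)
    {K : ℝ} (hK : ∀ t, 0 ≤ t → |f t| ≤ K) : Integrable (dampedExtension η f) := by
  have h1 : IntegrableOn (dampedExtension η f) (Ioi 0) := by
    refine Integrable.mono' ((exp_neg_integrableOn_Ioi 0 hη).mul_const K)
      (continuous_dampedExtension hf).aestronglyMeasurable ?_
    filter_upwards [ae_restrict_mem measurableSet_Ioi] with t ht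
    rw [dampedExtension_of_pos ht, Complex.norm_real, norm_mul,
      Real.norm_of_nonneg (Real.exp_nonneg _)]
    gcongr
    exact hK t (le_of_lt ht)
  refine h1.integrable_of_forall_notMem_eq_zero fun t ht => ?_
  exact dampedExtension_of_nonpos h0 (not_lt.1 ht)

open scoped FourierTransform in
/-- The Fourier transform of the damped causal extension is the Laplace transform on the vertical
line of abscissa `η`. -/
lemma fourier_dampedExtension (h0 : f 0 = 0) (ξ : ℝ) :
    𝓕 (dampedExtension η f) ξ =
      ∫ t in Ioi (0 : ℝ), Complex.exp (-(η + (2 * Real.pi * ξ : ℝ) * Complex.I) * t) *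
        (f t : ℂ) := by
  rw [Real.fourier_real_eq_integral_exp_smul,
    ← setIntegral_eq_integral_of_forall_compl_eq_zero (s := Ioi (0 : ℝ))]
  · refine setIntegral_congr_fun measurableSet_Ioi fun t ht => ?_
    simp only [dampedExtension_of_pos ht, smul_eq_mul]
    push_cast
    rw [← mul_assoc, ← Complex.exp_add]
    congr 2
    ring
  · intro t ht
    rw [dampedExtension_of_nonpos h0 (not_lt.1 ht), smul_zero]

open scoped FourierTransform in
lemma integrable_fourier_dampedExtension (hη : 0 < η) (hf : ContinuousOn f (Ici 0))
    (h0 : f 0 = 0) {K : ℝ} (hK : ∀ t, 0 ≤ t → |f t| ≤ K) {c : ℝ}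
    (hc : ∀ y : ℝ, ‖∫ t in Ioi (0 : ℝ), Complex.exp (-(η + (y : ℝ) * Complex.I) * t) *
      (f t : ℂ)‖ ≤ c / (1 + y ^ 2)) : Integrable (𝓕 (dampedExtension η f)) := by
  have hi := integrable_dampedExtension hη hf h0 hK
  have h1 : Integrable fun y : ℝ => c / (1 + y ^ 2) := by
    simpa [div_eq_mul_inv] using integrable_inv_one_add_sq.const_mul c
  have h2 := h1.comp_mul_left' (R := 2 * Real.pi) (by positivity)
  have hcont : Continuous (𝓕 (dampedExtension η f)) :=
    VectorFourier.fourierIntegral_continuous Real.continuous_fourierChar continuous_inner hi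
  refine h2.mono' hcont.aestronglyMeasurable (ae_of_all _ fun ξ => ?_)
  rw [fourier_dampedExtension h0]
  exact hc _

lemma eLpNorm_halfLine_le {F : ℝ → ℂ} {u : ℝ → ℝ} (h : ∀ t, 0 < t → ‖F t‖ = |u t|) :
    eLpNorm u 2 halfLine ≤ eLpNorm F 2 volume := by
  calc eLpNorm u 2 halfLine = eLpNorm F 2 halfLine := by
        refine eLpNorm_congr_norm_ae ?_
        filter_upwards [ae_restrict_mem measurableSet_Ioi] with t ht
        rw [h t ht, Real.norm_eq_abs]
    _ ≤ _ := eLpNorm_mono_measure _ Measure.restrict_le_self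

lemma integral_comp_two_pi_mul_le {m : ℝ → ℝ} (hm : ∀ y, 0 ≤ m y) :
    ∫ ξ, m (2 * Real.pi * ξ) ≤ ∫ y, m y := by
  rw [Measure.integral_comp_mul_left, smul_eq_mul]
  refine mul_le_of_le_one_left (integral_nonneg hm) ?_
  rw [abs_of_nonneg (by positivity)]
  refine inv_le_one_of_one_le₀ ?_
  linarith [Real.pi_gt_three]

/-- A square-integrable bound on a vertical line for the Laplace transform of `f` controls the
`L²` norm of the damped function. -/
lemma eLpNorm_exp_mul_le (hη : 0 < η) (hf : ContinuousOn f (Ici 0))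
    (h0 : f 0 = 0) {K : ℝ} (hK : ∀ t, 0 ≤ t → |f t| ≤ K) {c : ℝ}
    (hc : ∀ y : ℝ, ‖∫ t in Ioi (0 : ℝ), Complex.exp (-(η + (y : ℝ) * Complex.I) * t) *
      (f t : ℂ)‖ ≤ c / (1 + y ^ 2)) {m : ℝ → ℝ}
    (hm : ∀ y : ℝ, ‖∫ t in Ioi (0 : ℝ), Complex.exp (-(η + (y : ℝ) * Complex.I) * t) *
      (f t : ℂ)‖ ≤ m y) (hmi : Integrable fun y => m y ^ 2) :
    eLpNorm (fun t => Real.exp (-η * t) * f t) 2 halfLine ≤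
      ENNReal.ofReal (√(∫ y, m y ^ 2)) := by
  refine (eLpNorm_halfLine_le (F := dampedExtension η f) fun t ht => ?_).trans ?_
  · rw [dampedExtension_of_pos ht, Complex.norm_real, Real.norm_eq_abs]
  · refine (eLpNorm_two_le_of_norm_fourier_le (continuous_dampedExtension hf)
      (integrable_dampedExtension hη hf h0 hK)
      (integrable_fourier_dampedExtension hη hf h0 hK hc)
      (M := fun ξ => m (2 * Real.pi * ξ)) (fun ξ => ?_)
      (hmi.comp_mul_left' (R := 2 * Real.pi) (by positivity))).trans ?_
    · rw [fourier_dampedExtension h0]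
      exact hm _
    · exact ENNReal.ofReal_le_ofReal (Real.sqrt_le_sqrt
        (integral_comp_two_pi_mul_le (m := fun y => m y ^ 2) fun y => sq_nonneg _))

open scoped FourierTransform in
/-- The same control for the derivative of the damped function, obtained from its difference
quotients. -/
lemma eLpNorm_deriv_exp_mul_le (hη : 0 < η) (hf : ContinuousOn f (Ici 0))
    (h0 : f 0 = 0) {K : ℝ} (hK : ∀ t, 0 ≤ t → |f t| ≤ K) {f' : ℝ → ℝ}
    (hf' : ∀ t, 0 < t → HasDerivAt f (f' t) t) {c : ℝ}
    (hc : ∀ y : ℝ, ‖∫ t in Ioi (0 : ℝ), Complex.exp (-(η + (y : ℝ) * Complex.I) * t) *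
      (f t : ℂ)‖ ≤ c / (1 + y ^ 2)) {m : ℝ → ℝ}
    (hm : ∀ y : ℝ, ‖∫ t in Ioi (0 : ℝ), Complex.exp (-(η + (y : ℝ) * Complex.I) * t) *
      (f t : ℂ)‖ ≤ m y) (hmi : Integrable fun y => (y * m y) ^ 2) :
    eLpNorm (fun t => Real.exp (-η * t) * (f' t - η * f t)) 2 halfLine ≤
      ENNReal.ofReal (√(∫ y, (y * m y) ^ 2)) := by
  set g := dampedExtension η f with hg
  have hgc : Continuous g := continuous_dampedExtension hf
  have hgi : Integrable g := integrable_dampedExtension hη hf h0 hK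
  have hgF : Integrable (𝓕 g) := integrable_fourier_dampedExtension hη hf h0 hK hc
  have hquot : ∀ h : ℝ, 0 < h →
      eLpNorm (fun t => (h : ℂ)⁻¹ • (g (t + h) - g t)) 2 volume ≤
        ENNReal.ofReal (√(∫ y, (y * m y) ^ 2)) := by
    intro h hh
    refine (eLpNorm_differenceQuotient_le hgc hgi hgF (M := fun ξ => m (2 * Real.pi * ξ))
      (fun ξ => ?_) (hmi.comp_mul_left' (R := 2 * Real.pi) (by positivity)) hh).trans ?_
    · rw [fourier_dampedExtension h0]
      exact hm _
    · exact ENNReal.ofReal_le_ofReal (Real.sqrt_le_sqrt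
        (integral_comp_two_pi_mul_le (m := fun y => (y * m y) ^ 2) fun y => sq_nonneg _))
  have hlim : ∀ t : ℝ, 0 < t → Tendsto (fun h : ℝ => (h : ℂ)⁻¹ • (g (t + h) - g t)) (𝓝[>] 0)
      (𝓝 ((Real.exp (-η * t) * (f' t - η * f t) : ℝ) : ℂ)) := by
    intro t ht
    have hd : HasDerivAt (fun t => Real.exp (-η * t) * f t)
        (Real.exp (-η * t) * (f' t - η * f t)) t := by
      have h1 : HasDerivAt (fun t : ℝ => -η * t) (-η) t := by
        simpa using (hasDerivAt_id t).const_mul (-η)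
      refine (h1.exp.mul (hf' t ht)).congr_deriv ?_
      ring
    have hd2 : HasDerivAt g ((Real.exp (-η * t) * (f' t - η * f t) : ℝ) : ℂ) t := by
      refine (hd.ofReal_comp).congr_of_eventuallyEq ?_
      filter_upwards [Ioi_mem_nhds ht] with x hx
      exact dampedExtension_of_pos hx
    have := (hasDerivAt_iff_tendsto_slope_zero.1 hd2).mono_left
      (nhdsWithin_mono 0 (fun x (hx : 0 < x) => ne_of_gt hx))
    refine this.congr fun h => ?_
    rw [← Complex.ofReal_inv, Complex.coe_smul]
  have hfin : eLpNorm (fun t => ((Real.exp (-η * t) * (f' t - η * f t) : ℝ) : ℂ)) 2 halfLine ≤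
      ENNReal.ofReal (√(∫ y, (y * m y) ^ 2)) := by
    refine Lp.eLpNorm_le_of_ae_tendsto (u := 𝓝[>] (0 : ℝ))
      (f := fun h t => (h : ℂ)⁻¹ • (g (t + h) - g t)) ?_ (fun h => ?_) ?_
    · filter_upwards [self_mem_nhdsWithin] with h hh
      exact (eLpNorm_mono_measure _ Measure.restrict_le_self).trans (hquot h hh)
    · exact Continuous.aestronglyMeasurable (by fun_prop)
    · filter_upwards [ae_restrict_mem measurableSet_Ioi] with t ht
      exact hlim t ht
  refine le_trans (le_of_eq ?_) hfin
  refine eLpNorm_congr_norm_ae (ae_of_all _ fun t => ?_)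
  rw [Complex.norm_real]

end Damped

/-- Removal of the damping in `L²` bounds. -/
lemma eLpNorm_le_of_damped {u v : ℝ → ℝ} (hu : ContinuousOn u (Ioi 0))
    (hv : ContinuousOn v (Ioi 0)) {η₀ : ℝ} (hη₀ : 0 < η₀) {C : ℝ≥0∞}
    (h : ∀ η, 0 < η → η ≤ η₀ →
      eLpNorm (fun t => Real.exp (-η * t) * (u t - η * v t)) 2 halfLine ≤ C) :
    eLpNorm u 2 halfLine ≤ C := by
  refine Lp.eLpNorm_le_of_ae_tendsto (u := 𝓝[>] (0 : ℝ))
    (f := fun η t => Real.exp (-η * t) * (u t - η * v t)) ?_ (fun η => ?_) ?_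
  · filter_upwards [Ioc_mem_nhdsGT hη₀] with η hη
    exact h η hη.1 hη.2
  · exact ContinuousOn.aestronglyMeasurable (by fun_prop) measurableSet_Ioi
  · refine ae_of_all _ fun t => ?_
    have : Continuous fun η : ℝ => Real.exp (-η * t) * (u t - η * v t) := by fun_prop
    have h2 := this.tendsto 0
    simp only [neg_zero, zero_mul, Real.exp_zero, one_mul, sub_zero] at h2
    exact h2.mono_left nhdsWithin_le_nhds

/-! ### Weak derivatives -/

lemma isWeakDeriv_of_hasDerivAt {f f' : ℝ → ℝ} (hf : ∀ t, 0 < t → HasDerivAt f (f' t) t)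
    (hf' : ContinuousOn f' (Ioi 0)) : IsWeakDeriv f f' := by
  intro φ hφ hφc hφs
  have hfc : ContinuousOn f (Ioi 0) := fun t ht => (hf t ht).continuousAt.continuousWithinAt
  have hφ' : Continuous (deriv φ) := hφ.continuous_deriv (by simp)
  have hd : ∀ t, HasDerivAt φ (deriv φ t) t := fun t =>
    (hφ.differentiable (by simp)).differentiableAt.hasDerivAt
  have hsd : tsupport (deriv φ) ⊆ tsupport φ :=
    closure_minimal support_deriv_subset (isClosed_tsupport φ)
  have hcont : ∀ u ψ : ℝ → ℝ, ContinuousOn u (Ioi 0) → Continuous ψ → tsupport ψ ⊆ tsupport φ →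
      Integrable fun t => u t * ψ t := by
    intro u ψ hu hψ hs
    refine Continuous.integrable_of_hasCompactSupport (continuous_of_tsupport fun x hx => ?_)
      ((hφc.mono' (subset_closure.trans hs)).mul_left)
    have hx0 : x ∈ Ioi (0 : ℝ) := hφs (hs (tsupport_mul_subset_right hx))
    exact (hu.continuousAt (Ioi_mem_nhds hx0)).mul hψ.continuousAt
  have i1 := hcont f (deriv φ) hfc hφ' hsd
  have i2 := hcont f' φ hf' hφ.continuous subset_rfl
  have i3 := hcont f φ hfc hφ.continuous subset_rfl
  have hderiv : ∀ t, HasDerivAt (fun t => f t * φ t) (f' t * φ t + f t * deriv φ t) t := by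
    intro t
    by_cases ht : t ∈ tsupport φ
    · exact (hf t (hφs ht)).mul (hd t)
    · have h0 : φ =ᶠ[𝓝 t] 0 := notMem_tsupport_iff_eventuallyEq.1 ht
      have e1 : φ t = 0 := h0.eq_of_nhds
      have e2 : deriv φ t = 0 := by
        rw [h0.deriv_eq]
        simp
      rw [e1, e2, mul_zero, mul_zero, add_zero]
      refine (hasDerivAt_const t (0 : ℝ)).congr_of_eventuallyEq ?_
      filter_upwards [h0] with x hx
      simp [hx]
  have h := integral_eq_zero_of_hasDerivAt_of_integrable hderiv (i2.add i1) i3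
  rw [integral_add i2 i1] at h
  have hz : ∀ t, t ∉ Ioi (0 : ℝ) → t ∉ tsupport φ := fun t ht hs => ht (hφs hs)
  rw [setIntegral_eq_integral_of_forall_compl_eq_zero,
    setIntegral_eq_integral_of_forall_compl_eq_zero]
  · linarith
  · intro t ht
    rw [image_eq_zero_of_notMem_tsupport (hz t ht), mul_zero]
  · intro t ht
    rw [image_eq_zero_of_notMem_tsupport fun hs => hz t ht (hsd hs), mul_zero]

/-! ### `L²` bounds on the solution -/

/-- The quadratic growth of the denominator at high frequency and its lower bound `Pmin` at low
frequency combine into one bound along vertical lines. -/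
lemma exists_mul_one_add_sq_le_norm_transferDenom {τb : ℝ} (hτb : 0 < τb) (Λ : ℝ) :
    ∃ C : ℝ, 0 < C ∧ ∀ κ ν R Pmin : ℝ, 0 ≤ κ → κ ≤ Λ → 0 ≤ ν → ν ≤ Λ → 0 < R → 0 < Pmin →
      (∀ s : ℂ, 0 < s.re → Pmin ≤ ‖transferDenom τb κ ν R s‖) →
      ∀ s : ℂ, 0 < s.re → Pmin * (1 + s.im ^ 2) ≤ C * ‖transferDenom τb κ ν R s‖ := by
  obtain ⟨M, hM1, hM⟩ := exists_mul_sq_le_norm_transferDenom hτb Λ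
  refine ⟨1 + M ^ 2 + 4 / τb ^ 2, by positivity, ?_⟩
  intro κ ν R Pmin hκ hκΛ hν hνΛ hR hPpos hP s hs
  have him : s.im ^ 2 ≤ ‖s‖ ^ 2 := sq_le_sq'
    (by linarith [neg_abs_le s.im, Complex.abs_im_le_norm s])
    ((le_abs_self _).trans (Complex.abs_im_le_norm s))
  have h1 := hP s hs
  rcases le_total M ‖s‖ with h | h
  · have h2 := hM κ ν R hκ hκΛ hν hνΛ hR s hs h
    have hP2 : Pmin ≤ 2 := le_two_of_le_norm_transferDenom hκ hν hR hP
    have h3 : (1 : ℝ) ≤ ‖s‖ ^ 2 := one_le_pow₀ (hM1.trans h)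
    have h4 : ‖s‖ ^ 2 ≤ 1 / τb ^ 2 * ‖transferDenom τb κ ν R s‖ := by
      rw [one_div, inv_mul_eq_div, le_div_iff₀ (by positivity)]
      linarith
    calc Pmin * (1 + s.im ^ 2) ≤ 2 * (‖s‖ ^ 2 + ‖s‖ ^ 2) := by gcongr
      _ = 4 * ‖s‖ ^ 2 := by ring
      _ ≤ 4 * (1 / τb ^ 2 * ‖transferDenom τb κ ν R s‖) := by gcongr
      _ = 4 / τb ^ 2 * ‖transferDenom τb κ ν R s‖ := by ring
      _ ≤ (1 + M ^ 2 + 4 / τb ^ 2) * ‖transferDenom τb κ ν R s‖ := by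
        gcongr
        nlinarith
  · calc Pmin * (1 + s.im ^ 2) ≤ ‖transferDenom τb κ ν R s‖ * (1 + M ^ 2) := by
          have := him.trans (pow_le_pow_left₀ (norm_nonneg _) h 2)
          gcongr ?_ * (1 + ?_)
      _ = (1 + M ^ 2) * ‖transferDenom τb κ ν R s‖ := by ring
      _ ≤ (1 + M ^ 2 + 4 / τb ^ 2) * ‖transferDenom τb κ ν R s‖ := by
        refine mul_le_mul_of_nonneg_right ?_ (norm_nonneg _)
        have : 0 ≤ 4 / τb ^ 2 := by positivity
        linarith

/-- Square integrability of a function dominated by the profile `c ρ (1 + (ρ y)²)^(-1/2)`. -/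
lemma sqrt_integral_sq_le {m : ℝ → ℝ} (hm : Continuous m) {c ρ : ℝ} (hc : 0 ≤ c) (hρ : 1 ≤ ρ)
    (h : ∀ y, m y ^ 2 ≤ (c * ρ) ^ 2 * (1 + (ρ * y) ^ 2)⁻¹) :
    Integrable (fun y => m y ^ 2) ∧ √(∫ y, m y ^ 2) ≤ 2 * c * ρ := by
  have hρ0 : 0 < ρ := by linarith
  have hi : Integrable fun y : ℝ => (c * ρ) ^ 2 * (1 + (ρ * y) ^ 2)⁻¹ :=
    (integrable_inv_one_add_sq.comp_mul_left' hρ0.ne').const_mul _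
  refine ⟨hi.mono' (by fun_prop) (ae_of_all _ fun y => ?_), ?_⟩
  · rw [Real.norm_of_nonneg (sq_nonneg _)]
    exact h y
  · refine Real.sqrt_le_iff.2 ⟨by positivity, ?_⟩
    calc ∫ y, m y ^ 2 ≤ ∫ y, (c * ρ) ^ 2 * (1 + (ρ * y) ^ 2)⁻¹ :=
          integral_mono_of_nonneg (ae_of_all _ fun y => sq_nonneg _) hi (ae_of_all _ h)
      _ = c ^ 2 * ρ * Real.pi := by
          rw [integral_const_mul, Measure.integral_comp_mul_left (fun y : ℝ => (1 + y ^ 2)⁻¹),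
            integral_univ_inv_one_add_sq, abs_of_pos (by positivity), smul_eq_mul]
          field_simp
      _ ≤ c ^ 2 * ρ * (4 * ρ) := by
          gcongr
          linarith [Real.pi_le_four]
      _ = _ := by ring

section Solution

variable {τb κ ν R δ₀ : ℝ} {ζ q : ℝ → L2r R} {δ : ℝ → ℝ}

/-- Bounds on the first two derivatives of the displacement, from the decay of the transfer
function. -/
lemma IsSolution.eLpNorm_timeDeriv_le (hτb : 0 < τb) (hR : 0 < R) (hν : 0 ≤ ν)
    (h : IsSolution τb κ ν R δ₀ ζ q δ) {A : ℝ} (hA : 0 < A)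
    (hP : ∀ s : ℂ, 0 < s.re → 1 + s.im ^ 2 ≤ A * ‖transferDenom τb κ ν R s‖) :
    eLpNorm (timeDeriv δ) 2 halfLine ≤ ENNReal.ofReal (4 * A * |δ₀|) ∧
      eLpNorm (timeDeriv (timeDeriv δ)) 2 halfLine ≤ ENNReal.ofReal (4 * A * |δ₀|) := by
  obtain ⟨K, hK⟩ := h.exists_bound hτb hR hν
  have h1 : ContDiffOn ℝ 1 (timeDeriv δ) (Ici 0) := contDiffOn_timeDeriv h.contDiffOn_delta
  have hc1 : ContinuousOn (timeDeriv δ) (Ici 0) := h1.continuousOn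
  have hc2 : ContinuousOn (timeDeriv (timeDeriv δ)) (Ici 0) := continuousOn_timeDeriv h1
  set m : ℝ → ℝ := fun y => 2 * A * |δ₀| / (1 + y ^ 2) with hm
  have hmc : Continuous m := by
    refine continuous_const.div (by fun_prop) fun y => by positivity
  have hL : ∀ η : ℝ, 0 < η → ∀ y : ℝ, ‖∫ t in Ioi (0 : ℝ),
      Complex.exp (-(η + (y : ℝ) * Complex.I) * t) * ((timeDeriv δ t : ℝ) : ℂ)‖ ≤ m y := by
    intro η hη y
    have hs : 0 < ((η : ℂ) + (y : ℝ) * Complex.I).re := by simpa using hη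
    have e := congrArg norm (h.transferDenom_mul_laplace_timeDeriv hτb hR hν hs)
    have e2 := hP _ hs
    rw [norm_mul, norm_neg, norm_mul, Complex.norm_real, Complex.norm_ofNat, Real.norm_eq_abs] at e
    have him : ((η : ℂ) + (y : ℝ) * Complex.I).im = y := by simp
    rw [him] at e2
    simp only [hm]
    rw [le_div_iff₀ (by positivity)]
    calc _ ≤ ‖∫ t in Ioi (0 : ℝ),
          Complex.exp (-(η + (y : ℝ) * Complex.I) * t) * ((timeDeriv δ t : ℝ) : ℂ)‖ *
          (A * ‖transferDenom τb κ ν R ((η : ℂ) + (y : ℝ) * Complex.I)‖) := by gcongr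
      _ = A * (2 * |δ₀|) := by rw [← e]; ring
      _ = _ := by ring
  have hm1 : ∀ y, m y ^ 2 ≤ (2 * A * |δ₀| * 1) ^ 2 * (1 + (1 * y) ^ 2)⁻¹ := by
    intro y
    simp only [hm, mul_one, one_mul]
    rw [← div_eq_mul_inv, div_pow]
    gcongr
    nlinarith [sq_nonneg y]
  have hm2 : ∀ y, (y * m y) ^ 2 ≤ (2 * A * |δ₀| * 1) ^ 2 * (1 + (1 * y) ^ 2)⁻¹ := by
    intro y
    simp only [hm, mul_one, one_mul]
    rw [← div_eq_mul_inv, mul_div_assoc', div_pow, div_le_div_iff₀ (by positivity) (by positivity),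
      mul_pow]
    have : 0 ≤ (2 * A * |δ₀|) ^ 2 * (1 + y ^ 2) := by positivity
    nlinarith
  obtain ⟨i1, b1⟩ := sqrt_integral_sq_le hmc (by positivity) le_rfl hm1
  obtain ⟨i2, b2⟩ := sqrt_integral_sq_le (m := fun y => y * m y) (by fun_prop) (by positivity)
    le_rfl hm2
  have hKd : ∀ t, 0 ≤ t → |timeDeriv δ t| ≤ K := fun t ht => (hK t ht).2.2.2.2
  constructor
  · refine eLpNorm_le_of_damped (v := fun _ => 0) (hc1.mono Ioi_subset_Ici_self) (by fun_prop)
      one_pos fun η hη _ => ?_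
    simp only [mul_zero, sub_zero]
    refine (eLpNorm_exp_mul_le hη hc1 h.delta_dot_init hKd (hL η hη) (hL η hη) i1).trans ?_
    exact ENNReal.ofReal_le_ofReal (by linarith)
  · refine eLpNorm_le_of_damped (hc2.mono Ioi_subset_Ici_self) (hc1.mono Ioi_subset_Ici_self)
      one_pos fun η hη _ => ?_
    refine (eLpNorm_deriv_exp_mul_le hη hc1 h.delta_dot_init hKd
      (fun t ht => hasDerivAt_timeDeriv h1 ht) (hL η hη) (hL η hη) i2).trans ?_
    exact ENNReal.ofReal_le_ofReal (by linarith)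

end Solution

lemma laplace_exp_neg {s : ℂ} (hs : 0 < s.re) :
    ∫ t in Ioi (0 : ℝ), Complex.exp (-s * t) * ((Real.exp (-t) : ℝ) : ℂ) = 1 / (s + 1) := by
  have h := integral_exp_mul_complex_Ioi (a := -(s + 1)) (by simp; linarith) 0
  have e : ∀ t : ℝ, Complex.exp (-s * t) * ((Real.exp (-t) : ℝ) : ℂ) =
      Complex.exp (-(s + 1) * t) := by
    intro t
    push_cast
    rw [← Complex.exp_add]
    congr 1
    ring
  simp_rw [e]
  rw [h, Complex.ofReal_zero, mul_zero, Complex.exp_zero, neg_div_neg_eq]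

lemma eLpNorm_exp_neg_le : eLpNorm (fun t : ℝ => Real.exp (-t)) 2 halfLine ≤ 1 := by
  have e : ∀ t : ℝ, ‖Real.exp (-t)‖ ^ 2 = Real.exp (-2 * t) := fun t => by
    rw [Real.norm_of_nonneg (Real.exp_nonneg _), ← Real.exp_nat_mul]
    congr 1
    push_cast
    ring
  have h := eLpNorm_two_le_of_integral_le (μ := halfLine) (F := fun t : ℝ => Real.exp (-t))
    (a := 1) (Continuous.aestronglyMeasurable (by fun_prop))
    (by simp_rw [e]; exact exp_neg_integrableOn_Ioi 0 two_pos)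
    (by
      simp_rw [e]
      rw [integral_exp_mul_Ioi (by norm_num)]
      norm_num)
  simpa using h

section Solution

variable {τb κ ν R δ₀ : ℝ} {ζ q : ℝ → L2r R} {δ : ℝ → ℝ}

/-- The Laplace transform of the displacement has no pole at the origin: its denominator is `𝒫`
alone. -/
lemma IsSolution.transferDenom_mul_laplace_delta (hτb : 0 < τb) (hR : 0 < R) (hν : 0 ≤ ν)
    (h : IsSolution τb κ ν R δ₀ ζ q δ) {s : ℂ} (hs : 0 < s.re) :
    transferDenom τb κ ν R s * (∫ t in Ioi (0 : ℝ), Complex.exp (-s * t) * (δ t : ℂ)) =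
      δ₀ * (2 * (addedMass τb κ R : ℂ) * s + 2 * (ν : ℂ) +
        (R : ℂ) * dispRoot κ ν s * besselRatio κ ν R s) := by
  have hs0 : s ≠ 0 := fun h0 => by simp [h0] at hs
  have e1 := h.transferDenom_mul_laplace_timeDeriv hτb hR hν hs
  rw [h.mul_laplace_delta hτb hR hν hs] at e1
  refine mul_left_cancel₀ hs0 ?_
  have e2 : transferDenom τb κ ν R s = 2 * (addedMass τb κ R : ℂ) * s ^ 2 + 2 * (ν : ℂ) * s
    + (R : ℂ) * s * dispRoot κ ν s * besselRatio κ ν R s + 2 := rfl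
  linear_combination e1 + (δ₀ : ℂ) * e2

/-- The numerator of the Laplace transform of the displacement is `O(1 + R)` at the frequencies
`|s| ≤ 2 / (1 + R)`. -/
lemma norm_laplace_numerator_le {Λ : ℝ} (hκ : 0 ≤ κ) (hκΛ : κ ≤ Λ) (hν : 0 ≤ ν) (hνΛ : ν ≤ Λ)
    (hR : 0 < R) {s : ℂ} (hs : 0 < s.re) (hs2 : (1 + R) * ‖s‖ ≤ 2) :
    ‖2 * (addedMass τb κ R : ℂ) * s + 2 * (ν : ℂ) +
        (R : ℂ) * dispRoot κ ν s * besselRatio κ ν R s‖ ≤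
      (4 * τb ^ 2 + 4 * Λ ^ 2 + 10 * Λ + 5) * (1 + R) := by
  have hn := norm_nonneg s
  have hΛ : 0 ≤ Λ := hκ.trans hκΛ
  have hs1 : ‖s‖ ≤ 2 := by nlinarith
  have hRs : R * ‖s‖ ≤ 2 := by nlinarith
  have h1 := norm_radiation_le hκ hν hR hs
  have hsq : √(ν * ‖s‖) ≤ 1 + 2 * Λ := by
    refine Real.sqrt_le_iff.2 ⟨by positivity, ?_⟩
    nlinarith [mul_le_mul hνΛ hs1 hn hΛ]
  have h2 : R * (1 + √(ν * ‖s‖) + κ * ‖s‖) * √2 ≤ R * (1 + (1 + 2 * Λ) + Λ * 2) * 2 := by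
    gcongr
    exact Real.sqrt_le_iff.2 ⟨by norm_num, by norm_num⟩
  have h3 : ‖2 * (addedMass τb κ R : ℂ) * s‖ = 2 * (τb ^ 2 + κ ^ 2 + R ^ 2 / 8) * ‖s‖ := by
    have : 0 ≤ τb ^ 2 + κ ^ 2 + R ^ 2 / 8 := by positivity
    rw [norm_mul, norm_mul, Complex.norm_real, Complex.norm_ofNat, addedMass,
      Real.norm_of_nonneg this]
  have h4 : ‖2 * (ν : ℂ)‖ = 2 * ν := by
    rw [norm_mul, Complex.norm_real, Complex.norm_ofNat, Real.norm_of_nonneg hν]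
  have h5 : 2 * (τb ^ 2 + κ ^ 2 + R ^ 2 / 8) * ‖s‖ ≤ 4 * (τb ^ 2 + Λ ^ 2) + R / 2 := by
    have a1 : κ ^ 2 ≤ Λ ^ 2 := pow_le_pow_left₀ hκ hκΛ 2
    have a2 : (τb ^ 2 + κ ^ 2) * ‖s‖ ≤ (τb ^ 2 + Λ ^ 2) * 2 := by gcongr
    have a3 : R * (R * ‖s‖) ≤ R * 2 := by gcongr
    nlinarith
  calc _ ≤ ‖2 * (addedMass τb κ R : ℂ) * s‖ + ‖2 * (ν : ℂ)‖ +
        ‖(R : ℂ) * dispRoot κ ν s * besselRatio κ ν R s‖ := norm_add₃_le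
    _ ≤ 4 * (τb ^ 2 + Λ ^ 2) + R / 2 + 2 * Λ + R * (1 + (1 + 2 * Λ) + Λ * 2) * 2 := by
        rw [h3, h4]
        linarith
    _ ≤ _ := by
        have b1 : 0 ≤ Λ * R := by positivity
        have b2 : 0 ≤ τb ^ 2 * R := by positivity
        have b3 : 0 ≤ Λ ^ 2 * R := by positivity
        nlinarith

/-- Bound on the Laplace transform of the displacement near the imaginary axis. The crossover
frequency is `1 / (1 + R)`. -/
lemma IsSolution.norm_laplace_delta_le {Λ Pmin : ℝ} (hτb : 0 < τb) (hκ : 0 ≤ κ) (hκΛ : κ ≤ Λ)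
    (hν : 0 ≤ ν) (hνΛ : ν ≤ Λ) (hR : 0 < R) (h : IsSolution τb κ ν R δ₀ ζ q δ) (hPpos : 0 < Pmin)
    (hP : ∀ s : ℂ, 0 < s.re → Pmin ≤ ‖transferDenom τb κ ν R s‖) {s : ℂ} (hs : 0 < s.re)
    (hsR : (1 + R) * s.re ≤ 1) :
    ‖∫ t in Ioi (0 : ℝ), Complex.exp (-s * t) * (δ t : ℂ)‖ * √(1 + ((1 + R) * s.im) ^ 2) ≤
      2 * (4 * τb ^ 2 + 4 * Λ ^ 2 + 10 * Λ + 5) * (|δ₀| / Pmin) * (1 + R) := by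
  set D := ∫ t in Ioi (0 : ℝ), Complex.exp (-s * t) * (δ t : ℂ) with hD
  have hΛ : 0 ≤ Λ := hκ.trans hκΛ
  have hPs := hP s hs
  have hρ : 0 < 1 + R := by linarith
  set y := (1 + R) * |s.im| with hy
  have hy0 : 0 ≤ y := by positivity
  have hyy : ((1 + R) * s.im) ^ 2 = y ^ 2 := by rw [hy, mul_pow, mul_pow, sq_abs]
  rw [hyy]
  rcases le_total y 1 with hy1 | hy1
  · have e := congrArg norm (h.transferDenom_mul_laplace_delta hτb hR hν hs)
    rw [norm_mul, norm_mul, Complex.norm_real, Real.norm_eq_abs, ← hD] at e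
    have hs2 : (1 + R) * ‖s‖ ≤ 2 := by
      have := Complex.norm_le_abs_re_add_abs_im s
      rw [abs_of_pos hs] at this
      nlinarith
    have hN := norm_laplace_numerator_le (τb := τb) hκ hκΛ hν hνΛ hR hs hs2
    have hD1 : Pmin * ‖D‖ ≤ |δ₀| * ((4 * τb ^ 2 + 4 * Λ ^ 2 + 10 * Λ + 5) * (1 + R)) := by
      calc Pmin * ‖D‖ ≤ ‖transferDenom τb κ ν R s‖ * ‖D‖ := by gcongr
        _ ≤ _ := by
          rw [e]
          gcongr
    have hq : √(1 + y ^ 2) ≤ 2 := Real.sqrt_le_iff.2 ⟨by norm_num, by nlinarith⟩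
    have hD2 : ‖D‖ ≤ |δ₀| * ((4 * τb ^ 2 + 4 * Λ ^ 2 + 10 * Λ + 5) * (1 + R)) / Pmin := by
      rw [le_div_iff₀ hPpos]
      linarith
    calc ‖D‖ * √(1 + y ^ 2)
        ≤ |δ₀| * ((4 * τb ^ 2 + 4 * Λ ^ 2 + 10 * Λ + 5) * (1 + R)) / Pmin * 2 := by gcongr
      _ = _ := by ring
  · have hP2 : Pmin ≤ 2 := le_two_of_le_norm_transferDenom hκ hν hR hP
    have e1 := h.transferDenom_mul_laplace_timeDeriv hτb hR hν hs
    set V := ∫ t in Ioi (0 : ℝ), Complex.exp (-s * t) * ((timeDeriv δ t : ℝ) : ℂ) with hV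
    have e2 : s * D = V + δ₀ := by
      linear_combination -(h.mul_laplace_delta hτb hR hν hs)
    have hV1 : Pmin * ‖V‖ ≤ 2 * |δ₀| := by
      have e3 := congrArg norm e1
      rw [norm_mul, norm_neg, norm_mul, Complex.norm_real, Complex.norm_ofNat,
        Real.norm_eq_abs] at e3
      rw [← e3]
      gcongr
    have hsD : ‖s‖ * ‖D‖ ≤ ‖V‖ + |δ₀| := by
      rw [← norm_mul, e2]
      refine (norm_add_le _ _).trans ?_
      rw [Complex.norm_real, Real.norm_eq_abs]
    have hD3 : Pmin * (‖s‖ * ‖D‖) ≤ 4 * |δ₀| := by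
      have := mul_le_mul_of_nonneg_left hsD hPpos.le
      nlinarith [abs_nonneg δ₀]
    have hq : √(1 + y ^ 2) ≤ 2 * y := Real.sqrt_le_iff.2 ⟨by positivity, by nlinarith⟩
    have hqs : √(1 + y ^ 2) ≤ 2 * (1 + R) * ‖s‖ := by
      refine hq.trans ?_
      rw [hy, ← mul_assoc]
      gcongr
      exact Complex.abs_im_le_norm s
    calc ‖D‖ * √(1 + y ^ 2) ≤ ‖D‖ * (2 * (1 + R) * ‖s‖) := by gcongr
      _ = 2 * (1 + R) / Pmin * (Pmin * (‖s‖ * ‖D‖)) := by field_simp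
      _ ≤ 2 * (1 + R) / Pmin * (4 * |δ₀|) := by gcongr
      _ = 2 * 4 * (|δ₀| / Pmin) * (1 + R) := by ring
      _ ≤ _ := by
        gcongr
        nlinarith [sq_nonneg τb, sq_nonneg Λ]

/-- Bound on the displacement. The jump of `δ` at `t = 0`, which makes its transform decay only
like `1 / s`, is removed by subtracting `δ₀ e^{-t}`. -/
lemma IsSolution.eLpNorm_delta_le {Λ Pmin A : ℝ} (hτb : 0 < τb) (hκ : 0 ≤ κ) (hκΛ : κ ≤ Λ)
    (hν : 0 ≤ ν) (hνΛ : ν ≤ Λ) (hR : 0 < R) (h : IsSolution τb κ ν R δ₀ ζ q δ) (hPpos : 0 < Pmin)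
    (hP : ∀ s : ℂ, 0 < s.re → Pmin ≤ ‖transferDenom τb κ ν R s‖) (hA : 0 < A)
    (hPA : ∀ s : ℂ, 0 < s.re → 1 + s.im ^ 2 ≤ A * ‖transferDenom τb κ ν R s‖) :
    eLpNorm δ 2 halfLine ≤ ENNReal.ofReal
      ((4 * (4 * τb ^ 2 + 4 * Λ ^ 2 + 10 * Λ + 5) + 6) * (|δ₀| / Pmin) * (1 + R)) := by
  obtain ⟨K, hK⟩ := h.exists_bound hτb hR hν
  have hΛ : 0 ≤ Λ := hκ.trans hκΛ
  have hP2 : Pmin ≤ 2 := le_two_of_le_norm_transferDenom hκ hν hR hP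
  have hδP : |δ₀| ≤ 2 * (|δ₀| / Pmin) := by
    rw [mul_div_assoc', le_div_iff₀ hPpos]
    nlinarith [abs_nonneg δ₀]
  have hδc : ContinuousOn δ (Ici 0) := h.contDiffOn_delta.continuousOn
  have hKδ : ∀ t, 0 ≤ t → |δ t| ≤ K := fun t ht => (hK t ht).2.2.2.1
  set f : ℝ → ℝ := fun t => δ t - δ₀ * Real.exp (-t) with hf
  have hfc : ContinuousOn f (Ici 0) := by fun_prop
  have hf0 : f 0 = 0 := by simp [hf, h.delta_init]
  have hfK : ∀ t, 0 ≤ t → |f t| ≤ K + |δ₀| := by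
    intro t ht
    refine (abs_sub _ _).trans (add_le_add (hKδ t ht) ?_)
    rw [abs_mul, Real.abs_exp]
    exact mul_le_of_le_one_right (abs_nonneg _) (Real.exp_le_one_iff.2 (by linarith))
  have hL : ∀ s : ℂ, 0 < s.re → ∫ t in Ioi (0 : ℝ), Complex.exp (-s * t) * (f t : ℂ) =
      (∫ t in Ioi (0 : ℝ), Complex.exp (-s * t) * (δ t : ℂ)) - δ₀ / (s + 1) := by
    intro s hs
    have i1 := integrableOn_laplace hs (ofReal_continuousOn hδc) (K := K) fun t ht => by
      rw [Complex.norm_real]; exact hKδ t ht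
    have i2 := integrableOn_laplace hs (f := fun t : ℝ => ((Real.exp (-t) : ℝ) : ℂ)) (K := 1)
      (ofReal_continuousOn (by fun_prop)) fun t ht => by
        rw [Complex.norm_real, Real.norm_eq_abs, Real.abs_exp]
        exact Real.exp_le_one_iff.2 (by linarith)
    have e : ∀ t : ℝ, Complex.exp (-s * t) * (f t : ℂ) = Complex.exp (-s * t) * (δ t : ℂ) -
        δ₀ * (Complex.exp (-s * t) * ((Real.exp (-t) : ℝ) : ℂ)) := by
      intro t
      simp only [hf]
      push_cast
      ring
    simp_rw [e]
    rw [integral_sub i1 (i2.const_mul _), integral_const_mul, laplace_exp_neg hs]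
    ring
  set c : ℝ := 2 * (4 * τb ^ 2 + 4 * Λ ^ 2 + 10 * Λ + 5) * (|δ₀| / Pmin) + 2 * (|δ₀| / Pmin)
    with hc
  have hcpos : 0 ≤ c := by positivity
  set m : ℝ → ℝ := fun y => c * (1 + R) / √(1 + ((1 + R) * y) ^ 2) with hm
  have hmc : Continuous m := by
    refine continuous_const.div (by fun_prop) fun y => ?_
    positivity
  have hmb : ∀ y, m y ^ 2 ≤ (c * (1 + R)) ^ 2 * (1 + ((1 + R) * y) ^ 2)⁻¹ := by
    intro y
    simp only [hm]
    rw [div_pow, Real.sq_sqrt (by positivity), div_eq_mul_inv]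
  obtain ⟨mi, mb⟩ := sqrt_integral_sq_le hmc hcpos (by linarith) hmb
  have hfL : eLpNorm f 2 halfLine ≤ ENNReal.ofReal (2 * c * (1 + R)) := by
    refine eLpNorm_le_of_damped (v := fun _ => 0) (hfc.mono Ioi_subset_Ici_self) (by fun_prop)
      (η₀ := (1 + R)⁻¹) (by positivity) fun η hη hη1 => ?_
    simp only [mul_zero, sub_zero]
    have hsre : ∀ y : ℝ, ((η : ℂ) + (y : ℝ) * Complex.I).re = η := fun y => by simp
    have hsim : ∀ y : ℝ, ((η : ℂ) + (y : ℝ) * Complex.I).im = y := fun y => by simp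
    have hηR : (1 + R) * η ≤ 1 := by
      calc (1 + R) * η ≤ (1 + R) * (1 + R)⁻¹ := by gcongr
        _ = 1 := mul_inv_cancel₀ (by positivity)
    have hη1' : η ≤ 1 := by nlinarith
    refine (eLpNorm_exp_mul_le hη hfc hf0 hfK
      (c := |δ₀| / η ^ 2 + 2 * |δ₀| * A / η) (m := m) ?_ ?_ mi).trans
      (ENNReal.ofReal_le_ofReal mb)
    -- The leading terms `δ₀ / s` and `δ₀ / (s + 1)` cancel at infinity. The constant may depend on
    -- `η`, since this bound only serves to make the transform integrable.
    · intro y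
      set s : ℂ := (η : ℂ) + (y : ℝ) * Complex.I with hs_def
      have hs : 0 < s.re := by rw [hsre]; exact hη
      have hs0 : s ≠ 0 := fun h0 => by simp [h0] at hs
      have hs1 : s + 1 ≠ 0 := fun h0 => by
        have := congrArg Complex.re h0
        simp only [Complex.add_re, Complex.one_re, Complex.zero_re] at this
        linarith
      rw [hL s hs]
      have e1 := h.transferDenom_mul_laplace_timeDeriv hτb hR hν hs
      have e2 := h.mul_laplace_delta hτb hR hν hs
      set V := ∫ t in Ioi (0 : ℝ), Complex.exp (-s * t) * ((timeDeriv δ t : ℝ) : ℂ)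
      set D := ∫ t in Ioi (0 : ℝ), Complex.exp (-s * t) * (δ t : ℂ)
      have e3 : D - δ₀ / (s + 1) = δ₀ / (s * (s + 1)) + V / s := by
        field_simp
        linear_combination -(s + 1) * e2
      have hV : ‖V‖ * (1 + y ^ 2) ≤ 2 * |δ₀| * A := by
        have e4 := congrArg norm e1
        rw [norm_mul, norm_neg, norm_mul, Complex.norm_real, Complex.norm_ofNat,
          Real.norm_eq_abs] at e4
        have := hPA s hs
        rw [hsim] at this
        calc ‖V‖ * (1 + y ^ 2) ≤ ‖V‖ * (A * ‖transferDenom τb κ ν R s‖) := by gcongr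
          _ = A * (2 * |δ₀|) := by rw [← e4]; ring
          _ = _ := by ring
      have hnsq : ‖s‖ ^ 2 = η ^ 2 + y ^ 2 := by
        rw [Complex.sq_norm, Complex.normSq_apply, hsre, hsim]
        ring
      have hnsq1 : ‖s + 1‖ ^ 2 = (η + 1) ^ 2 + y ^ 2 := by
        rw [Complex.sq_norm, Complex.normSq_apply, Complex.add_re, Complex.add_im, hsre, hsim]
        simp only [Complex.one_re, Complex.one_im]
        ring
      have hle : ‖s‖ ≤ ‖s + 1‖ :=
        (pow_le_pow_iff_left₀ (norm_nonneg _) (norm_nonneg _) two_ne_zero).1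
          (by rw [hnsq, hnsq1]; nlinarith)
      have hηs : η ≤ ‖s‖ := by
        have := Complex.re_le_norm s
        rwa [hsre] at this
      have hprod : η ^ 2 * (1 + y ^ 2) ≤ ‖s‖ * ‖s + 1‖ := by
        have a1 : ‖s‖ * ‖s‖ ≤ ‖s‖ * ‖s + 1‖ := by gcongr
        have a2 : η ^ 2 ≤ 1 := pow_le_one₀ hη.le hη1'
        nlinarith [mul_le_mul_of_nonneg_right a2 (sq_nonneg y)]
      rw [e3, add_div]
      refine (norm_add_le _ _).trans (add_le_add ?_ ?_)
      · rw [norm_div, norm_mul, Complex.norm_real, Real.norm_eq_abs, div_div]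
        gcongr
      · rw [norm_div, div_div, div_le_div_iff₀ (by positivity) (by positivity)]
        calc ‖V‖ * (η * (1 + y ^ 2)) = ‖V‖ * (1 + y ^ 2) * η := by ring
          _ ≤ 2 * |δ₀| * A * ‖s‖ := by gcongr
    · intro y
      set s : ℂ := (η : ℂ) + (y : ℝ) * Complex.I with hs_def
      have hs : 0 < s.re := by rw [hsre]; exact hη
      rw [hL s hs]
      have hD := h.norm_laplace_delta_le hτb hκ hκΛ hν hνΛ hR hPpos hP hs (by rwa [hsre])
      rw [hsim] at hD
      have hq : √(1 + ((1 + R) * y) ^ 2) ≤ (1 + R) * ‖s + 1‖ := by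
        refine Real.sqrt_le_iff.2 ⟨by positivity, ?_⟩
        have hnsq1 : ‖s + 1‖ ^ 2 = (η + 1) ^ 2 + y ^ 2 := by
          rw [Complex.sq_norm, Complex.normSq_apply, Complex.add_re, Complex.add_im, hsre, hsim]
          simp only [Complex.one_re, Complex.one_im]
          ring
        rw [mul_pow, mul_pow, hnsq1]
        have b1 : 1 ≤ (1 + R) ^ 2 := one_le_pow₀ (by linarith)
        have b2 : 1 ≤ (η + 1) ^ 2 := one_le_pow₀ (by linarith)
        nlinarith
      have hs1 : 0 < ‖s + 1‖ := norm_pos_iff.2 fun h0 => by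
        have := congrArg Complex.re h0
        simp only [Complex.add_re, Complex.one_re, Complex.zero_re] at this
        linarith
      simp only [hm]
      rw [le_div_iff₀ (by positivity)]
      calc _ ≤ (‖∫ t in Ioi (0 : ℝ), Complex.exp (-s * t) * (δ t : ℂ)‖ + |δ₀| / ‖s + 1‖) *
            √(1 + ((1 + R) * y) ^ 2) := by
            gcongr
            refine (norm_sub_le _ _).trans ?_
            rw [norm_div, Complex.norm_real, Real.norm_eq_abs]
        _ = ‖∫ t in Ioi (0 : ℝ), Complex.exp (-s * t) * (δ t : ℂ)‖ * √(1 + ((1 + R) * y) ^ 2) +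
            |δ₀| / ‖s + 1‖ * √(1 + ((1 + R) * y) ^ 2) := by ring
        _ ≤ 2 * (4 * τb ^ 2 + 4 * Λ ^ 2 + 10 * Λ + 5) * (|δ₀| / Pmin) * (1 + R) +
            |δ₀| / ‖s + 1‖ * ((1 + R) * ‖s + 1‖) := by gcongr
        _ = 2 * (4 * τb ^ 2 + 4 * Λ ^ 2 + 10 * Λ + 5) * (|δ₀| / Pmin) * (1 + R) +
            |δ₀| * (1 + R) := by field_simp
        _ ≤ 2 * (4 * τb ^ 2 + 4 * Λ ^ 2 + 10 * Λ + 5) * (|δ₀| / Pmin) * (1 + R) +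
            2 * (|δ₀| / Pmin) * (1 + R) := by gcongr
        _ = _ := by rw [hc]; ring
  have hexp : eLpNorm (fun t => δ₀ * Real.exp (-t)) 2 halfLine ≤ ENNReal.ofReal |δ₀| := by
    have := eLpNorm_const_smul_le (c := δ₀) (f := fun t : ℝ => Real.exp (-t)) (p := 2)
      (μ := halfLine)
    refine this.trans ?_
    rw [← Real.enorm_eq_ofReal_abs]
    exact mul_le_of_le_one_right' eLpNorm_exp_neg_le
  have hsplit : δ = f + fun t => δ₀ * Real.exp (-t) := by
    funext t
    simp [hf]
  calc eLpNorm δ 2 halfLine = eLpNorm (f + fun t => δ₀ * Real.exp (-t)) 2 halfLine := by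
        rw [← hsplit]
    _ ≤ eLpNorm f 2 halfLine + eLpNorm (fun t => δ₀ * Real.exp (-t)) 2 halfLine :=
        eLpNorm_add_le ((hfc.mono Ioi_subset_Ici_self).aestronglyMeasurable measurableSet_Ioi)
          (Continuous.aestronglyMeasurable (by fun_prop)) (by norm_num)
    _ ≤ ENNReal.ofReal (2 * c * (1 + R)) + ENNReal.ofReal |δ₀| := add_le_add hfL hexp
    _ = ENNReal.ofReal (2 * c * (1 + R) + |δ₀|) :=
        (ENNReal.ofReal_add (by positivity) (by positivity)).symm
    _ ≤ _ := by
        refine ENNReal.ofReal_le_ofReal ?_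
        have : 0 ≤ |δ₀| / Pmin * R := by positivity
        rw [hc]
        nlinarith

end Solution

lemma kappaStar_pos {κ : ℝ} : 0 < kappaStar κ := by
  unfold kappaStar
  split_ifs with h
  · exact h
  · exact one_pos

lemma one_le_sqrt_mul_kappaStar_rpow {κ Λ : ℝ} (h : κ ≤ Λ) :
    1 ≤ √(max Λ 1) * kappaStar κ ^ (-(1 / 2) : ℝ) := by
  have h1 : kappaStar κ ≤ max Λ 1 := by
    unfold kappaStar
    split_ifs
    · exact h.trans (le_max_left _ _)
    · exact le_max_right _ _
  rw [Real.rpow_neg kappaStar_pos.le, ← Real.sqrt_eq_rpow, ← div_eq_mul_inv,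
    one_le_div (Real.sqrt_pos.2 kappaStar_pos)]
  exact Real.sqrt_le_sqrt h1

end FloatingCylinder

theorem theorem4p2 (τb : ℝ) (hτb : 0 < τb) (Λ : ℝ) :
    ∃ C : ℝ, 0 < C ∧
      ∀ κ ν R Pmin δ₀ : ℝ, 0 ≤ κ → κ ≤ Λ → 0 ≤ ν → ν ≤ Λ → 0 < R → 0 < Pmin →
        (∀ s : ℂ, 0 < s.re → Pmin ≤ ‖FloatingCylinder.transferDenom τb κ ν R s‖) →
        ∀ (ζ q : ℝ → FloatingCylinder.L2r R) (δ : ℝ → ℝ),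
          FloatingCylinder.IsSolution τb κ ν R δ₀ ζ q δ →
          FloatingCylinder.MemH2 δ ∧
          eLpNorm δ 2 FloatingCylinder.halfLine ≤
            ENNReal.ofReal (C * |δ₀| *
              (FloatingCylinder.kappaStar κ ^ (-(1 / 2) : ℝ) *
                  ((FloatingCylinder.kappaStar κ)⁻¹ + 1 +
                    R * (1 + ν * (FloatingCylinder.kappaStar κ)⁻¹)) * Pmin⁻¹ +
                FloatingCylinder.kappaStar κ ^ (-(1 / 2) : ℝ))) ∧
          eLpNorm (FloatingCylinder.timeDeriv δ) 2 FloatingCylinder.halfLine ≤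
            ENNReal.ofReal (C * |δ₀| *
              (FloatingCylinder.kappaStar κ ^ (-(1 / 2) : ℝ) * Pmin⁻¹ +
                FloatingCylinder.kappaStar κ ^ (-(3 / 2) : ℝ) / τb ^ 2)) ∧
          eLpNorm (FloatingCylinder.timeDeriv (FloatingCylinder.timeDeriv δ)) 2
              FloatingCylinder.halfLine ≤
            ENNReal.ofReal (C * |δ₀| *
              (FloatingCylinder.kappaStar κ ^ (-(1 / 2) : ℝ) * Pmin⁻¹ +
                FloatingCylinder.kappaStar κ ^ (-(1 / 2) : ℝ) / τb ^ 2)) := by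
  obtain ⟨A, hA, hAP⟩ := FloatingCylinder.exists_mul_one_add_sq_le_norm_transferDenom hτb Λ
  -- Since `κ_* ≤ max Λ 1`, the weight `κ_* ^ (-1/2)` is bounded below and may be inserted freely.
  set B : ℝ := 4 * A + (4 * (4 * τb ^ 2 + 4 * Λ ^ 2 + 10 * |Λ| + 5) + 6) with hB
  have hBpos : 0 < B := by positivity
  refine ⟨B * √(max Λ 1), by positivity, ?_⟩
  intro κ ν R Pmin δ₀ hκ hκΛ hν hνΛ hR hPpos hP ζ q δ h
  have hΛ : 0 ≤ Λ := hκ.trans hκΛ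
  have hk := FloatingCylinder.kappaStar_pos (κ := κ)
  have hk1 := FloatingCylinder.one_le_sqrt_mul_kappaStar_rpow hκΛ
  set k := FloatingCylinder.kappaStar κ
  have hPA : ∀ s : ℂ, 0 < s.re →
      1 + s.im ^ 2 ≤ A / Pmin * ‖FloatingCylinder.transferDenom τb κ ν R s‖ := by
    intro s hs
    rw [div_mul_eq_mul_div, le_div_iff₀ hPpos]
    linarith [hAP κ ν R Pmin hκ hκΛ hν hνΛ hR hPpos hP s hs]
  have hδ := h.eLpNorm_delta_le hτb hκ hκΛ hν hνΛ hR hPpos hP (by positivity) hPA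
  obtain ⟨hd1, hd2⟩ := h.eLpNorm_timeDeriv_le hτb hR hν (by positivity) hPA
  have h1 := FloatingCylinder.contDiffOn_timeDeriv h.contDiffOn_delta
  have hc0 : ContinuousOn δ (Ioi 0) := h.contDiffOn_delta.continuousOn.mono Ioi_subset_Ici_self
  have hc1 : ContinuousOn (FloatingCylinder.timeDeriv δ) (Ioi 0) :=
    h1.continuousOn.mono Ioi_subset_Ici_self
  have hc2 : ContinuousOn (FloatingCylinder.timeDeriv (FloatingCylinder.timeDeriv δ)) (Ioi 0) :=
    (FloatingCylinder.continuousOn_timeDeriv h1).mono Ioi_subset_Ici_self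
  refine ⟨⟨_, _, ⟨hc0.aestronglyMeasurable measurableSet_Ioi, hδ.trans_lt ENNReal.ofReal_lt_top⟩,
    ⟨hc1.aestronglyMeasurable measurableSet_Ioi, hd1.trans_lt ENNReal.ofReal_lt_top⟩,
    ⟨hc2.aestronglyMeasurable measurableSet_Ioi, hd2.trans_lt ENNReal.ofReal_lt_top⟩,
    FloatingCylinder.isWeakDeriv_of_hasDerivAt (fun t ht =>
      FloatingCylinder.hasDerivAt_timeDeriv h.contDiffOn_one_delta ht) hc1,
    FloatingCylinder.isWeakDeriv_of_hasDerivAt (fun t ht =>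
      FloatingCylinder.hasDerivAt_timeDeriv h1 ht) hc2⟩, hδ.trans ?_, hd1.trans ?_, hd2.trans ?_⟩
  · refine ENNReal.ofReal_le_ofReal ?_
    have hΛB : 4 * (4 * τb ^ 2 + 4 * Λ ^ 2 + 10 * Λ + 5) + 6 ≤ B := by
      rw [hB, abs_of_nonneg hΛ]
      linarith
    calc _ ≤ B * (|δ₀| / Pmin) * (1 + R) := by gcongr
      _ ≤ (√(max Λ 1) * k ^ (-(1 / 2) : ℝ)) * (B * (|δ₀| / Pmin) * (1 + R)) :=
          le_mul_of_one_le_left (by positivity) hk1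
      _ = B * √(max Λ 1) * |δ₀| * (k ^ (-(1 / 2) : ℝ) * (1 + R) * Pmin⁻¹) := by ring
      _ ≤ _ := by
          have e1 : 1 + R ≤ k⁻¹ + 1 + R * (1 + ν * k⁻¹) := by
            have : 0 ≤ k⁻¹ + R * (ν * k⁻¹) := by positivity
            linarith
          have e2 : 0 ≤ k ^ (-(1 / 2) : ℝ) := by positivity
          gcongr ?_ * ?_
          calc k ^ (-(1 / 2) : ℝ) * (1 + R) * Pmin⁻¹
              ≤ k ^ (-(1 / 2) : ℝ) * (k⁻¹ + 1 + R * (1 + ν * k⁻¹)) * Pmin⁻¹ := by gcongr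
            _ ≤ _ := le_add_of_nonneg_right e2
  all_goals
    refine ENNReal.ofReal_le_ofReal ?_
    have hAB : 4 * A ≤ B := by
      rw [hB]
      have : 0 ≤ 4 * (4 * τb ^ 2 + 4 * Λ ^ 2 + 10 * |Λ| + 5) + 6 := by positivity
      linarith
    calc _ = 4 * A * (|δ₀| / Pmin) := by ring
      _ ≤ B * (|δ₀| / Pmin) := by gcongr
      _ ≤ (√(max Λ 1) * k ^ (-(1 / 2) : ℝ)) * (B * (|δ₀| / Pmin)) :=
          le_mul_of_one_le_left (by positivity) hk1
      _ = B * √(max Λ 1) * |δ₀| * (k ^ (-(1 / 2) : ℝ) * Pmin⁻¹) := by ring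
      _ ≤ _ := by
          gcongr ?_ * ?_
          exact le_add_of_nonneg_right (by positivity)
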